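/- Work over $\mathbb C$. For a cubic form $F$ in $x_0,\dots,x_5$ with $X=V(F)\subset\mathbb P^5$, let $J_X$ be the space of quadratic forms spanned by the partial derivatives $\partial F/\partial x_i$. For $N=\mathbb P(W)\subset|J_X|=\mathbb P(J_X)$ with $W\subset J_X$ a $3$-dimensional subspace, let $\Delta_N\subset N\cong\mathbb P^2$ be the plane section by $N$ of the discriminant locus $\Delta_5^X\subset|J_X|$ of singular quadrics; that is, if $Q_0,Q_1,Q_2$ is a basis of $W$, $\Delta_N$ is the curve with equation $\det M(\lambda_0Q_0+\lambda_1Q_1+\lambda_2Q_2)=0$, where $M(Q)$ is the symmetric coefficient matrix of $Q$. Let $V^{irr}_{6,10}(N)\subset|\mathcal O_N(6)|$ be the Zariski closure of the set of integral sextics whose singular locus consists of exactly $10$ ordinary double points. The Severi locus is the set of cubic fourfolds $X$ with $\dim J_X=6$ for which some plane $N\subset|J_X|$ satisfies $\Delta_N\in V^{irr}_{6,10}(N)$ (in particular $\Delta_N\neq N$), and the Severi divisor $\mathcal D_{sn}$ is the closure of its image in the moduli space $\mathcal C$ of smooth cubic fourfolds. A smooth sextic del Pezzo surface $S\subset\mathbb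 P^6$ is the closure of the image of $\mathbb P^2$ under the rational map given by the linear system of plane cubics through three non-collinear points. Theorem. Let $X_F=V(x_0^3+\dots+x_5^3)$ be the Fermat cubic fourfold. There is a dense Zariski-open subset $U\subset Gr(3,J_{X_F})$ such that for every plane $N$ parametrized by $U$ the following hold. (1) $\Delta_N$ is a union of six lines in general position (no three of them concurrent). (2) $\Delta_N$ is the limit of a flat family of integral $10$-nodal plane sextics: there are a smooth irreducible affine curve $T$, a point $o\in T$ and a flat family $\{\Gamma_t\}_{t\in T}$ of sextics in $N\cong\mathbb P^2$ such that $\Gamma_o=\Delta_N$ and, for all $t\neq o$, $\Gamma_t$ is integral and its singular locus consists of exactly ten ordinary double points. (3) For every smooth sextic del Pezzo surface $S\subset\mathbb P^6$, such a family can be obtained by projecting hyperplane sections of $S$: there are $(T,o,\{\Gamma_t\})$ as in (2), an algebraic family $\{H_t\}_{t\in T}$ of hyperplane sections of $S$, and a projection $\pi_P:\mathbb P^6\dashrightarrow N\cong\mathbb P^2$ with center a $3$-dimensional linear subspace $P$ disjoint from $S$, such that $\Gamma_t=\pi_P(H_t)$ as subsets of $N$ for all $t\in T$. (4) $\Delta_N\in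 V^{irr}_{6,10}(N)$. Consequently $X_F$ belongs to the Severi locus, and its class $[X_F]\in\mathcal C$ belongs to the Severi divisor $\mathcal D_{sn}$. -/

import Mathlib

open MvPolynomial
open scoped LinearAlgebra.Projectivization Topology

noncomputable section

namespace SeveriFermat

/-! ### Zariski topology and Grassmannians of planes -/

/-- The Zariski topology of a complex vector space: the basic open sets are the non-vanishing
loci of polynomials in linear functionals. -/
@[reducible] def zariskiTopology (V : Type*) [AddCommGroup V] [Module ℂ V] : TopologicalSpace V :=
  TopologicalSpace.generateFrom
    {U | ∃ Φ : MvPolynomial (Module.Dual ℂ V) ℂ, U = {v | eval (fun φ => φ v) Φ ≠ 0}}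

/-- The Grassmannian `Gr(3, V)` of 3-dimensional subspaces of `V`, that is, of the projective
planes in `ℙ(V)`. -/
def Gr3 (V : Type*) [AddCommGroup V] [Module ℂ V] : Type _ :=
  {W : Submodule ℂ V // Module.finrank ℂ W = 3}

/-- The plane spanned by a linearly independent triple. -/
def Gr3.ofFrame {V : Type*} [AddCommGroup V] [Module ℂ V]
    (Q : {Q : Fin 3 → V // LinearIndependent ℂ Q}) : Gr3 V :=
  ⟨Submodule.span ℂ (Set.range Q.1), by
    rw [finrank_span_eq_card Q.2, Fintype.card_fin]⟩

/-- The Zariski topology of `Gr(3, V)`: the quotient topology from the space of frames, which is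
open in `V × V × V`. -/
instance Gr3.instTopologicalSpace (V : Type*) [AddCommGroup V] [Module ℂ V] :
    TopologicalSpace (Gr3 V) :=
  TopologicalSpace.coinduced Gr3.ofFrame
    (TopologicalSpace.induced Subtype.val (zariskiTopology (Fin 3 → V)))

/-! ### Polar quadrics and discriminants -/

/-- The space of polar quadratic forms `J_X` of the cubic `X = V(F)`. -/
def polarSpace (F : MvPolynomial (Fin 6) ℂ) : Submodule ℂ (MvPolynomial (Fin 6) ℂ) :=
  Submodule.span ℂ (Set.range fun i => pderiv i F)

/-- The symmetric coefficient matrix of a quadratic form in six variables. -/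
def coeffMatrix (q : MvPolynomial (Fin 6) ℂ) : Matrix (Fin 6) (Fin 6) ℂ :=
  Matrix.of fun i j => (1 / 2 : ℂ) * constantCoeff (pderiv i (pderiv j q))

/-- The equation `det M(λ₀ Q₀ + λ₁ Q₁ + λ₂ Q₂)`, a form in `λ₀, λ₁, λ₂`, of the discriminant curve
of the net spanned by three quadrics. -/
def discriminantForm (Q : Fin 3 → MvPolynomial (Fin 6) ℂ) : MvPolynomial (Fin 3) ℂ :=
  (∑ k, (X k : MvPolynomial (Fin 3) ℂ) • (coeffMatrix (Q k)).map C).det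

/-- The equation of `Δ_N`, the section of the discriminant hypersurface by the plane `N = ℙ(W)`
with `W ∈ Gr(3, J_X)`, in the coordinates of `N` given by a basis of `W`. -/
def planeSectionForm {F : MvPolynomial (Fin 6) ℂ} {N : Gr3 (polarSpace F)}
    (Q : Module.Basis (Fin 3) ℂ N.1) : MvPolynomial (Fin 3) ℂ :=
  discriminantForm fun k => ((Q k : polarSpace F) : MvPolynomial (Fin 6) ℂ)

/-- The equation of the Fermat cubic fourfold. -/
def fermatCubic : MvPolynomial (Fin 6) ℂ := ∑ i, X i ^ 3

/-! ### Plane sextics -/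

/-- The curve `V(D)` is a union of six lines in general position: no three of them have a
common point. -/
def IsUnionOfSixGeneralLines (D : MvPolynomial (Fin 3) ℂ) : Prop :=
  ∃ l : Fin 6 → Fin 3 → ℂ, D = ∏ i, ∑ k, C (l i k) * X k ∧
    ∀ s : Fin 3 ↪ Fin 6, LinearIndependent ℂ fun j => l (s j)

/-- The singular points of the plane curve `V(D)`. -/
def singularPoints (D : MvPolynomial (Fin 3) ℂ) : Set (ℙ ℂ (Fin 3 → ℂ)) :=
  {p | eval p.rep D = 0 ∧ ∀ i, eval p.rep (pderiv i D) = 0}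

/-- A singular point is an ordinary double point: the tangent cone there is a pair of distinct
lines. In homogeneous coordinates the Hessian matrix, whose kernel contains the point, has rank
two. -/
def IsNode (D : MvPolynomial (Fin 3) ℂ) (p : ℙ ℂ (Fin 3 → ℂ)) : Prop :=
  p ∈ singularPoints D ∧
    (Matrix.of fun i j => eval p.rep (pderiv i (pderiv j D)) : Matrix (Fin 3) (Fin 3) ℂ).rank = 2

/-- `V(D)` is an integral plane sextic whose singular locus consists of exactly ten nodes. -/
def IsIntegralTenNodalSextic (D : MvPolynomial (Fin 3) ℂ) : Prop :=
  D.IsHomogeneous 6 ∧ Irreducible D ∧ (singularPoints D).encard = 10 ∧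
    ∀ p ∈ singularPoints D, IsNode D p

/-- The Severi variety `V_{6,10}^{irr}(ℙ²)`, as a set of nonzero sextic forms: the Zariski closure
of the integral sextics with ten nodes. -/
def severiVarietyIrr : Set (MvPolynomial (Fin 3) ℂ) :=
  {D | D.IsHomogeneous 6 ∧ D ≠ 0 ∧
    D ∈ @closure _ (zariskiTopology (MvPolynomial (Fin 3) ℂ)) {G | IsIntegralTenNodalSextic G}}

/-! ### Flat families -/

/-- A pointed smooth irreducible affine curve `(T, o)` over `ℂ`, through its coordinate ring. Its
closed points are the `ℂ`-algebra homomorphisms to `ℂ`. -/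
structure PointedCurve where
  A : Type
  [commRing : CommRing A]
  [algebra : Algebra ℂ A]
  finiteType : Algebra.FiniteType ℂ A
  isDedekindDomain : IsDedekindDomain A
  not_isField : ¬ IsField A
  o : A →ₐ[ℂ] ℂ

attribute [instance] PointedCurve.commRing PointedCurve.algebra

/-- The member over the point `t` of the family of plane curves with equation `P` over `T`. -/
def PointedCurve.fiber (T : PointedCurve) (P : MvPolynomial (Fin 3) T.A) (t : T.A →ₐ[ℂ] ℂ) :
    MvPolynomial (Fin 3) ℂ :=
  MvPolynomial.map (t : T.A →+* ℂ) P

/-- The subscheme `V(P)` of `ℙ² × T` is a flat family of plane sextics over `T`. Flatness is that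
of the homogeneous coordinate ring over the coordinate ring of `T`. -/
def PointedCurve.IsFlatFamilyOfSextics (T : PointedCurve) (P : MvPolynomial (Fin 3) T.A) : Prop :=
  P.IsHomogeneous 6 ∧ (∀ t, T.fiber P t ≠ 0) ∧
    Module.Flat T.A (MvPolynomial (Fin 3) T.A ⧸ Ideal.span {P})

/-- `V(P)` is a flat family of plane sextics whose member at the base point is `V(D)` and all of
whose other members are integral and have exactly ten nodes. -/
def PointedCurve.IsIntegralTenNodalFamilyWithLimit (T : PointedCurve)
    (P : MvPolynomial (Fin 3) T.A) (D : MvPolynomial (Fin 3) ℂ) : Prop :=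
  T.IsFlatFamilyOfSextics P ∧ T.fiber P T.o = D ∧
    ∀ t, t ≠ T.o → IsIntegralTenNodalSextic (T.fiber P t)

/-! ### Sextic del Pezzo surfaces -/

/-- `S` is the affine cone, without its vertex, over a smooth sextic del Pezzo surface in `ℙ⁶`: the
closure of the image of `ℙ²` under the rational map given by a basis of the 7-dimensional space
of plane cubics through three non-collinear points. -/
def IsSexticDelPezzo (S : Set (Fin 7 → ℂ)) : Prop :=
  ∃ (e : Fin 3 → Fin 3 → ℂ) (b : Fin 7 → MvPolynomial (Fin 3) ℂ),
    LinearIndependent ℂ e ∧ LinearIndependent ℂ b ∧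
    (∀ i, (b i).IsHomogeneous 3 ∧ ∀ j, eval (e j) (b i) = 0) ∧
    S = {v | v ≠ 0 ∧ ∀ G : MvPolynomial (Fin 7) ℂ, aeval b G = 0 → eval v G = 0}

/-- The members of the family `V(P)` over `T` are the images of the members of a family of
hyperplane sections `H_t = S ∩ {∑ hᵢ(t) yᵢ = 0}` of `S` under the linear projection `π` from a
3-space `ℙ(ker π) ⊂ ℙ⁶` disjoint from `S`. -/
def PointedCurve.IsProjectionOfHyperplaneSections (T : PointedCurve)
    (P : MvPolynomial (Fin 3) T.A) (S : Set (Fin 7 → ℂ)) : Prop :=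
  ∃ (π : (Fin 7 → ℂ) →ₗ[ℂ] (Fin 3 → ℂ)) (h : Fin 7 → T.A),
    Function.Surjective π ∧ (∀ v ∈ S, π v ≠ 0) ∧
    ∀ t : T.A →ₐ[ℂ] ℂ, (∃ i, t (h i) ≠ 0) ∧
      {w | w ≠ 0 ∧ eval w (T.fiber P t) = 0} = π '' {v | v ∈ S ∧ ∑ i, t (h i) * v i = 0}

/-! ### The Severi divisor -/

/-- The Severi locus in the space of cubic forms in six variables with `dim J_X = 6`: the cubics
having a net of polar quadrics whose discriminant curve lies in `V_{6,10}^{irr}`. -/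
def severiLocus : Set (MvPolynomial (Fin 6) ℂ) :=
  {F | F.IsHomogeneous 3 ∧ Module.finrank ℂ (polarSpace F) = 6 ∧
    ∃ (N : Gr3 (polarSpace F)) (Q : Module.Basis (Fin 3) ℂ N.1),
      planeSectionForm Q ∈ severiVarietyIrr}

/-- `F` is the equation of a smooth cubic fourfold in `ℙ⁵`. -/
def IsSmoothCubic (F : MvPolynomial (Fin 6) ℂ) : Prop :=
  F.IsHomogeneous 3 ∧ ∀ v : Fin 6 → ℂ, v ≠ 0 → ∃ i, eval v (pderiv i F) ≠ 0

/-- Projective equivalence: `G` arises from `F` by an invertible linear substitution. (Over `ℂ`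
this includes multiplication by nonzero scalars.) -/
def ProjEquiv (F G : {F : MvPolynomial (Fin 6) ℂ // IsSmoothCubic F}) : Prop :=
  ∃ g : GL (Fin 6) ℂ, G.1 = aeval (fun i => ∑ j, C (g.1 i j) * X j) F.1

/-- The moduli space of smooth cubic fourfolds, the quotient of the space of smooth cubic forms by
linear substitutions. -/
def CubicModuli : Type := Quot ProjEquiv

/-- The class of a smooth cubic fourfold. -/
def CubicModuli.mk (F : {F : MvPolynomial (Fin 6) ℂ // IsSmoothCubic F}) : CubicModuli :=
  Quot.mk ProjEquiv F

/-- The Zariski topology of the moduli space, as a quotient. -/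
instance CubicModuli.instTopologicalSpace : TopologicalSpace CubicModuli :=
  TopologicalSpace.coinduced CubicModuli.mk
    (TopologicalSpace.induced Subtype.val (zariskiTopology (MvPolynomial (Fin 6) ℂ)))

/-- The Severi divisor: the closure in the moduli space of the image of the Severi locus. -/
def severiDivisor : Set CubicModuli :=
  closure {c | ∃ F : {F : MvPolynomial (Fin 6) ℂ // IsSmoothCubic F},
    F.1 ∈ severiLocus ∧ c = CubicModuli.mk F}

theorem isSmoothCubic_fermatCubic : IsSmoothCubic fermatCubic := by
  refine ⟨IsHomogeneous.sum _ _ _ fun i _ => by simpa using (isHomogeneous_X ℂ i).pow 3, ?_⟩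
  intro v hv
  obtain ⟨i, hi⟩ := Function.ne_iff.mp hv
  refine ⟨i, ?_⟩
  have : pderiv i fermatCubic = 3 * (X i : MvPolynomial (Fin 6) ℂ) ^ 2 := by
    simp [fermatCubic, map_sum, Derivation.leibniz_pow, pderiv_X, Pi.single_apply]
  rw [this]
  simpa using hi

end SeveriFermat

end

/-!
The polar quadrics of the Fermat cubic are the diagonal ones, so the discriminant of a net of them
is the product of six linear forms (`netLine`). The nets for which no three of the six lines are
concurrent form a dense open set (`isOpen_generalNets`, `dense_generalNets`), and the theorem
reduces to an assertion on six lines in general position: they are a limit of integral ten-nodal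
sextics which are projections of hyperplane sections of a given sextic del Pezzo surface.

Any three non-collinear points of the plane can be moved to the coordinate points, so every smooth
sextic del Pezzo surface is projectively equivalent to the toric surface `hexCone` of the hexagon
(`IsSexticDelPezzo.exists_linearEquiv`). Its toric boundary is a hexagon of lines and a hyperplane
section. A linear projection `hexProj` sending the six vertices to the intersections of
consecutive lines sends this hexagon to the six lines. The image `q` of the remaining coordinate
point is free and can be chosen so that the centre of the projection misses the surface
(`exists_center`): for a surface, the bad values of `q` satisfy an algebraic equation.

The hexagon is deformed by explicit rational curves `psi t`. Each is a hyperplane section of the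
surface (`IsGenericParameter.mem_hyperplane_iff`, where the equation of the hyperplane appears as
the resultant of two binary quadratic forms), and in the `k`-th chart, after a rescaling of the
parameter by a power of `t`, it tends to the `k`-th edge of the hexagon (`psiChart_zero`). The
hyperplane sections have arithmetic genus one, so that `psi t` has a node already on the surface,
a coincidence of two parameters (`psi_zero_one`). Nine further nodes of the projected curve are
produced by the implicit function theorem near the intersections of the nine pairs of
non-adjacent lines (`IsGeneralPosition.exists_crossing`). They exist for small `t ≠ 0`, hence by
Chevalley's theorem for all but finitely many `t` (`exists_forall_hasTenNodes`).

A parametrized curve of degree six with ten double points lies on a sextic: sextics have 28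
coefficients, and vanishing at 27 suitable points is enough (`HasTenNodes.exists_sextic`). Since
`ℂ[t]` is a principal ideal domain, the equations of almost all members are values of one
polynomial `P` over `ℂ[t]` that does not vanish identically for any `t`
(`exists_family_of_forms`). Its value at `t = 0` vanishes on the six lines, so it is a multiple of
their product. By the same argument no quartic contains infinitely many members, as its limit
would contain six lines.

That the sextics are integral with exactly ten nodes is the criterion
`IsTenNodalParam.isIntegralTenNodalSextic`. Quartics have 15 coefficients, so one can be made to
pass through double points and further points of the curve while not containing it; counting its
24 intersections bounds the number of parameters of a point of the curve. Intersecting with a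
general line through a given point, one bounds the multiplicity there of a form vanishing on the
curve. It follows that every such form has degree at least six, whence integrality, and that the
only singular points are the ten double points. There the multiplicity is two and the two branches
have different tangents, so they are nodes.

Flatness over an open part of the affine line amounts to the equation of the family not being
divisible by a prime of the base (`flat_quotient_of_forall_map_ne_zero`). For the Severi variety it
suffices that a polynomial curve meeting a Zariski open set lies in it for all but finitely many
parameters (`finite_notMem_of_isOpen_zariski`).
-/

open MvPolynomial
open scoped LinearAlgebra.Projectivization Topology

noncomputable section

namespace SeveriFermat

/-! ### Evaluating forms along polynomial curves -/

theorem eval_aeval_polynomial {σ : Type*} (φ : σ → Polynomial ℂ) (E : MvPolynomial σ ℂ) (z : ℂ) :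
    (aeval φ E).eval z = eval (fun i => (φ i).eval z) E := by
  induction E using MvPolynomial.induction_on with
  | C a => simp
  | add p q hp hq => simp [hp, hq]
  | mul_X p i hp => simp [hp]

/-- The chain rule for a polynomial function along a polynomial curve. -/
theorem derivative_aeval_polynomial {σ : Type*} [Fintype σ] [DecidableEq σ] (φ : σ → Polynomial ℂ)
    (E : MvPolynomial σ ℂ) :
    Polynomial.derivative (aeval φ E) =
      ∑ i, aeval φ (pderiv i E) * Polynomial.derivative (φ i) := by
  induction E using MvPolynomial.induction_on with
  | C a => simp
  | add p q hp hq => simp [hp, hq, add_mul, Finset.sum_add_distrib]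
  | mul_X p i hp =>
    have h : ∀ j, aeval φ (pderiv j (p * X i)) * Polynomial.derivative (φ j) =
        φ i * (aeval φ (pderiv j p) * Polynomial.derivative (φ j)) +
          if j = i then aeval φ p * Polynomial.derivative (φ j) else 0 := by
      intro j
      rw [Derivation.leibniz, pderiv_X]
      rcases eq_or_ne j i with rfl | hj
      · simp
        ring
      · simp [hj, Ne.symm hj]
        ring
    rw [map_mul, aeval_X, Polynomial.derivative_mul, hp, Finset.sum_congr rfl fun j _ => h j,
      Finset.sum_add_distrib, Finset.sum_ite_eq' Finset.univ i, if_pos (Finset.mem_univ i),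
      Finset.sum_mul]
    exact congrArg (· + _) (Finset.sum_congr rfl fun j _ => mul_comm _ _)

theorem aeval_eq_sum_support {A : Type*} [CommRing A] [Algebra ℂ A] (φ : Fin 3 → A)
    (E : MvPolynomial (Fin 3) ℂ) :
    aeval φ E = ∑ m ∈ E.support,
      algebraMap ℂ A (coeff m E) * (φ 0 ^ m 0 * φ 1 ^ m 1 * φ 2 ^ m 2) := by
  rw [aeval_def, eval₂_eq']
  simp [Fin.prod_univ_three]

theorem IsHomogeneous.sum_exponents {R : Type*} [CommRing R] {n : ℕ} {E : MvPolynomial (Fin 3) R}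
    (hE : E.IsHomogeneous n) {m : Fin 3 →₀ ℕ} (hm : m ∈ E.support) : m 0 + m 1 + m 2 = n := by
  by_contra h
  refine mem_support_iff.mp hm (hE.coeff_eq_zero ?_)
  rwa [Finsupp.degree_eq_sum, Fin.sum_univ_three]

theorem IsHomogeneous.eval_smul {R : Type*} [CommRing R] {n : ℕ} {E : MvPolynomial (Fin 3) R}
    (hE : E.IsHomogeneous n) (a : R) (x : Fin 3 → R) : eval (a • x) E = a ^ n * eval x E := by
  rw [eval_eq', eval_eq', Finset.mul_sum]
  refine Finset.sum_congr rfl fun m hm => ?_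
  rw [← IsHomogeneous.sum_exponents hE hm]
  simp [Fin.prod_univ_three, mul_pow, pow_add]
  ring

theorem IsHomogeneous.natDegree_aeval_le {n d : ℕ} {E : MvPolynomial (Fin 3) ℂ}
    (hE : E.IsHomogeneous n) {φ : Fin 3 → Polynomial ℂ} (hφ : ∀ i, (φ i).natDegree ≤ d) :
    (aeval φ E).natDegree ≤ n * d := by
  rw [aeval_eq_sum_support]
  refine Polynomial.natDegree_sum_le_of_forall_le _ _ fun m hm => ?_
  have h := IsHomogeneous.sum_exponents hE hm
  refine (Polynomial.natDegree_C_mul_le _ _).trans ?_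
  calc _ ≤ m 0 * d + m 1 * d + m 2 * d := by
        refine Polynomial.natDegree_mul_le_of_le (Polynomial.natDegree_mul_le_of_le ?_ ?_) ?_ <;>
          exact Polynomial.natDegree_pow_le_of_le _ (hφ _)
    _ = n * d := by rw [← h]; ring

theorem IsHomogeneous.coeff_aeval {n d : ℕ} {E : MvPolynomial (Fin 3) ℂ}
    (hE : E.IsHomogeneous n) {φ : Fin 3 → Polynomial ℂ} (hφ : ∀ i, (φ i).natDegree ≤ d) :
    (aeval φ E).coeff (n * d) = eval (fun i => (φ i).coeff d) E := by
  rw [aeval_eq_sum_support, Polynomial.finsetSum_coeff, eval_eq']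
  refine Finset.sum_congr rfl fun m hm => ?_
  have h := IsHomogeneous.sum_exponents hE hm
  have hp : ∀ i, (φ i ^ m i).natDegree ≤ m i * d := fun i =>
    Polynomial.natDegree_pow_le_of_le _ (hφ _)
  rw [← h, add_mul, add_mul]
  change (Polynomial.C _ * _).coeff _ = _
  rw [Polynomial.coeff_C_mul, Polynomial.coeff_mul_add_eq_of_natDegree_le
      (Polynomial.natDegree_mul_le_of_le (hp 0) (hp 1)) (hp 2),
    Polynomial.coeff_mul_add_eq_of_natDegree_le (hp 0) (hp 1)]
  simp [Polynomial.coeff_pow_of_natDegree_le (hφ _), Fin.prod_univ_three]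

/-! ### Forms with given coefficients -/

/-- The exponents of the monomials of degree `n` in three variables. -/
abbrev Exponents (n : ℕ) : Type := {m : Fin 3 → ℕ // m ∈ Finset.Nat.antidiagonalTuple 3 n}

theorem card_exponents_four : Fintype.card (Exponents 4) = 15 := by
  rw [Fintype.card_coe]; decide

theorem card_exponents_six : Fintype.card (Exponents 6) = 28 := by
  rw [Fintype.card_coe]; rfl

/-- The ternary form of degree `n` with the given coefficients. -/
def formOfCoeffs (n : ℕ) {R : Type*} [CommRing R] (c : Exponents n → R) :
    MvPolynomial (Fin 3) R :=
  ∑ m, monomial (Finsupp.equivFunOnFinite.symm m.1) (c m)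

theorem isHomogeneous_formOfCoeffs (n : ℕ) {R : Type*} [CommRing R] (c : Exponents n → R) :
    (formOfCoeffs n c).IsHomogeneous n := by
  refine IsHomogeneous.sum _ _ _ fun m _ => isHomogeneous_monomial _ ?_
  rw [Finsupp.degree_eq_sum]
  simpa using Finset.Nat.mem_antidiagonalTuple.mp m.2

theorem coeff_formOfCoeffs (n : ℕ) {R : Type*} [CommRing R] (c : Exponents n → R)
    (m : Exponents n) : coeff (Finsupp.equivFunOnFinite.symm m.1) (formOfCoeffs n c) = c m := by
  classical
  rw [formOfCoeffs, coeff_sum, Finset.sum_eq_single m]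
  · simp
  · intro k _ hk
    rw [coeff_monomial, if_neg]
    intro h
    exact hk (Subtype.ext (Finsupp.equivFunOnFinite.symm.injective h))
  · simp

theorem formOfCoeffs_eq_zero {n : ℕ} {R : Type*} [CommRing R] {c : Exponents n → R}
    (h : formOfCoeffs n c = 0) : c = 0 := by
  funext m
  rw [← coeff_formOfCoeffs n c m, h]
  simp

theorem IsHomogeneous.eq_formOfCoeffs {n : ℕ} {R : Type*} [CommRing R]
    {E : MvPolynomial (Fin 3) R} (hE : E.IsHomogeneous n) :
    E = formOfCoeffs n fun m => coeff (Finsupp.equivFunOnFinite.symm m.1) E := by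
  ext m
  by_cases hm : m.degree = n
  · have h := coeff_formOfCoeffs n
      (fun m : Exponents n => coeff (Finsupp.equivFunOnFinite.symm m.1) E)
      ⟨m, Finset.Nat.mem_antidiagonalTuple.mpr (by rw [← hm, Finsupp.degree_eq_sum])⟩
    have hm' : Finsupp.equivFunOnFinite.symm (m : Fin 3 → ℕ) = m := by ext; simp
    rw [hm'] at h
    exact h.symm
  · rw [hE.coeff_eq_zero hm, (isHomogeneous_formOfCoeffs n _).coeff_eq_zero hm]

theorem map_formOfCoeffs (n : ℕ) {R S : Type*} [CommRing R] [CommRing S] (f : R →+* S)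
    (c : Exponents n → R) :
    MvPolynomial.map f (formOfCoeffs n c) = formOfCoeffs n fun m => f (c m) := by
  simp [formOfCoeffs, map_sum]

/-- Fewer linear conditions than there are coefficients leave a nonzero form. -/
theorem exists_form_of_conditions {n : ℕ} {κ : Type*} [Fintype κ]
    (hκ : Fintype.card κ < Fintype.card (Exponents n))
    (L : κ → MvPolynomial (Fin 3) ℂ →ₗ[ℂ] ℂ) :
    ∃ E : MvPolynomial (Fin 3) ℂ, E.IsHomogeneous n ∧ E ≠ 0 ∧ ∀ k, L k E = 0 := by
  let F : (Exponents n → ℂ) →ₗ[ℂ] MvPolynomial (Fin 3) ℂ :=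
    ∑ m, (monomial (Finsupp.equivFunOnFinite.symm m.1)).comp (LinearMap.proj m)
  have hF : ∀ c, F c = formOfCoeffs n c := fun c => by
    simp [F, formOfCoeffs, LinearMap.sum_apply]
  have hker := LinearMap.ker_ne_bot_of_finrank_lt (f := (LinearMap.pi L).comp F)
    (by simpa using hκ)
  obtain ⟨c, hc, hc0⟩ := Submodule.exists_mem_ne_zero_of_ne_bot hker
  refine ⟨F c, hF c ▸ isHomogeneous_formOfCoeffs n c, fun h => hc0 ?_, fun k => ?_⟩
  · exact formOfCoeffs_eq_zero (by rw [← hF, h])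
  · exact congrFun (LinearMap.mem_ker.mp hc) k

/-! ### Linear changes of coordinates -/

/-- The composite of a triple of polynomials, or forms, with a linear map. -/
def linComp {A : Type*} [CommRing A] [Algebra ℂ A] (M : (Fin 3 → ℂ) →ₗ[ℂ] (Fin 3 → ℂ))
    (φ : Fin 3 → A) : Fin 3 → A :=
  fun i => ∑ j, algebraMap ℂ A (M (Pi.single j 1) i) * φ j

theorem apply_eq_sum_single (M : (Fin 3 → ℂ) →ₗ[ℂ] (Fin 3 → ℂ)) (x : Fin 3 → ℂ) (i : Fin 3) :
    M x i = ∑ j, M (Pi.single j 1) i * x j := by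
  conv_lhs => rw [LinearMap.pi_apply_eq_sum_univ M x]
  rw [Finset.sum_apply]
  refine Finset.sum_congr rfl fun j _ => ?_
  rw [Pi.smul_apply, smul_eq_mul, mul_comm]
  have h : (fun k => if j = k then (1 : ℂ) else 0) = Pi.single j 1 := by
    funext k
    simp [Pi.single_apply, eq_comm]
  rw [h]

theorem eval_linComp_polynomial (M : (Fin 3 → ℂ) →ₗ[ℂ] (Fin 3 → ℂ)) (φ : Fin 3 → Polynomial ℂ)
    (z : ℂ) : (fun i => (linComp M φ i).eval z) = M fun i => (φ i).eval z := by
  funext i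
  rw [apply_eq_sum_single M]
  simp [linComp, Polynomial.eval_finsetSum]

theorem coeff_linComp (M : (Fin 3 → ℂ) →ₗ[ℂ] (Fin 3 → ℂ)) (φ : Fin 3 → Polynomial ℂ)
    (n : ℕ) : (fun i => (linComp M φ i).coeff n) = M fun i => (φ i).coeff n := by
  funext i
  rw [apply_eq_sum_single M]
  simp only [linComp, Polynomial.finsetSum_coeff]
  exact Finset.sum_congr rfl fun j _ => Polynomial.coeff_C_mul _

/-- The form obtained from `E` by the linear substitution `M`. -/
def subst (M : (Fin 3 → ℂ) →ₗ[ℂ] (Fin 3 → ℂ)) (E : MvPolynomial (Fin 3) ℂ) :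
    MvPolynomial (Fin 3) ℂ :=
  aeval (linComp M X) E

theorem eval_subst (M : (Fin 3 → ℂ) →ₗ[ℂ] (Fin 3 → ℂ)) (E : MvPolynomial (Fin 3) ℂ)
    (x : Fin 3 → ℂ) : eval x (subst M E) = eval (M x) E := by
  have h : (fun i => eval x (linComp M X i)) = M x := by
    funext i
    rw [apply_eq_sum_single M]
    simp [linComp, map_sum, algebraMap_eq]
  rw [← h, subst]
  generalize (linComp M X : Fin 3 → MvPolynomial (Fin 3) ℂ) = g
  induction E using MvPolynomial.induction_on with
  | C a => rw [aeval_C, algebraMap_eq, eval_C, eval_C]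
  | add p q hp hq => rw [map_add, map_add, map_add, hp, hq]
  | mul_X p i hp => rw [map_mul, map_mul, map_mul, hp, aeval_X, eval_X]

theorem isHomogeneous_subst (M : (Fin 3 → ℂ) →ₗ[ℂ] (Fin 3 → ℂ)) {n : ℕ}
    {E : MvPolynomial (Fin 3) ℂ} (hE : E.IsHomogeneous n) : (subst M E).IsHomogeneous n := by
  have h : ∀ i, IsHomogeneous (linComp M (X : Fin 3 → MvPolynomial (Fin 3) ℂ) i) 1 := by
    intro i
    refine IsHomogeneous.sum _ _ _ fun j _ => ?_
    rw [algebraMap_eq]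
    exact isHomogeneous_C_mul_X (R := ℂ) _ _
  have := hE.aeval _ h
  rwa [one_mul] at this

theorem aeval_linComp (M : (Fin 3 → ℂ) →ₗ[ℂ] (Fin 3 → ℂ)) (φ : Fin 3 → Polynomial ℂ)
    (E : MvPolynomial (Fin 3) ℂ) : aeval (linComp M φ) E = aeval φ (subst M E) := by
  refine Polynomial.funext fun z => ?_
  rw [eval_aeval_polynomial, eval_aeval_polynomial, eval_subst, eval_linComp_polynomial]

theorem subst_symm_subst (M : (Fin 3 → ℂ) ≃ₗ[ℂ] (Fin 3 → ℂ)) (E : MvPolynomial (Fin 3) ℂ) :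
    subst M.toLinearMap (subst M.symm.toLinearMap E) = E :=
  MvPolynomial.funext fun x => by simp [eval_subst]

theorem subst_eq_zero (M : (Fin 3 → ℂ) ≃ₗ[ℂ] (Fin 3 → ℂ)) {E : MvPolynomial (Fin 3) ℂ}
    (h : subst M.toLinearMap E = 0) : E = 0 := by
  have := subst_symm_subst M.symm E
  simp only [LinearEquiv.symm_symm] at this
  rw [← this, h]
  simp [subst]

theorem cross_map_eq_zero (M : (Fin 3 → ℂ) ≃ₗ[ℂ] (Fin 3 → ℂ)) (x y : Fin 3 → ℂ) :
    crossProduct (M x) (M y) = 0 ↔ crossProduct x y = 0 := by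
  rw [← not_iff_not, ← ne_eq, ← ne_eq, crossProduct_ne_zero_iff_linearIndependent,
    crossProduct_ne_zero_iff_linearIndependent]
  have : ![M x, M y] = M.toLinearMap ∘ ![x, y] := by
    ext i : 1; fin_cases i <;> rfl
  rw [this]
  exact LinearMap.linearIndependent_iff _ M.ker

theorem exists_smul_of_cross_eq_zero {x y : Fin 3 → ℂ} (hx : x ≠ 0)
    (h : crossProduct x y = 0) : ∃ a : ℂ, y = a • x := by
  by_contra! H
  have := (LinearIndependent.pair_iff' hx).mpr fun a ha => H a ha.symm
  exact crossProduct_ne_zero_iff_linearIndependent.mpr this h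

theorem exists_linearEquiv_apply_eq_single {x : Fin 3 → ℂ} (hx : x ≠ 0) :
    ∃ M : (Fin 3 → ℂ) ≃ₗ[ℂ] (Fin 3 → ℂ), M x = Pi.single 0 1 := by
  obtain ⟨A, hA⟩ := SeparatingDual.exists_continuousLinearEquiv_apply_eq (R := ℂ) hx
    (y := (Pi.single 0 1 : Fin 3 → ℂ)) (by simp)
  exact ⟨A.toLinearEquiv, hA⟩

theorem cross_single_zero_eq_zero {y : Fin 3 → ℂ} :
    crossProduct (Pi.single 0 1 : Fin 3 → ℂ) y = 0 ↔ y 1 = 0 ∧ y 2 = 0 := by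
  rw [cross_apply]
  simp [and_comm]

/-! ### Rational sextics with ten double points -/

/-- The point with parameter `z` of the polynomially parametrized curve `φ`. -/
def pt (φ : Fin 3 → Polynomial ℂ) (z : ℂ) : Fin 3 → ℂ := fun i => (φ i).eval z

/-- A parametrization of degree six of a plane curve, without base points (also at infinity), whose
image lies on no quartic, together with ten pairs of parameters having ten different points as
their common images. -/
structure IsTenNodalParam (φ : Fin 3 → Polynomial ℂ) (u v : Fin 10 → ℂ) : Prop where
  natDegree_le : ∀ i, (φ i).natDegree ≤ 6
  pt_ne_zero : ∀ z, pt φ z ≠ 0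
  lead_ne_zero : (fun i => (φ i).coeff 6) ≠ 0
  quartic : ∀ E : MvPolynomial (Fin 3) ℂ, E.IsHomogeneous 4 → aeval φ E = 0 → E = 0
  ne : ∀ i, u i ≠ v i
  cross_eq_zero : ∀ i, crossProduct (pt φ (u i)) (pt φ (v i)) = 0
  cross_ne_zero : ∀ i j, i ≠ j → crossProduct (pt φ (u i)) (pt φ (u j)) ≠ 0

theorem pt_linComp (M : (Fin 3 → ℂ) ≃ₗ[ℂ] (Fin 3 → ℂ)) (φ : Fin 3 → Polynomial ℂ) (z : ℂ) :
    pt (linComp M.toLinearMap φ) z = M (pt φ z) :=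
  eval_linComp_polynomial _ _ _

theorem IsTenNodalParam.map {φ : Fin 3 → Polynomial ℂ} {u v : Fin 10 → ℂ}
    (h : IsTenNodalParam φ u v) (M : (Fin 3 → ℂ) ≃ₗ[ℂ] (Fin 3 → ℂ)) :
    IsTenNodalParam (linComp M.toLinearMap φ) u v where
  natDegree_le i := Polynomial.natDegree_sum_le_of_forall_le _ _ fun j _ =>
    (Polynomial.natDegree_C_mul_le _ _).trans (h.natDegree_le j)
  pt_ne_zero z := by
    rw [pt_linComp]
    simpa using h.pt_ne_zero z
  lead_ne_zero := by
    rw [coeff_linComp]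
    simpa using h.lead_ne_zero
  quartic E hE h0 := by
    rw [aeval_linComp] at h0
    exact subst_eq_zero M (h.quartic _ (isHomogeneous_subst _ hE) h0)
  ne := h.ne
  cross_eq_zero i := by
    rw [pt_linComp, pt_linComp, cross_map_eq_zero]
    exact h.cross_eq_zero i
  cross_ne_zero i j hij := by
    rw [pt_linComp, pt_linComp, ne_eq, cross_map_eq_zero]
    exact h.cross_ne_zero i j hij

theorem cross_eq_zero_trans {x y z : Fin 3 → ℂ} (hy : y ≠ 0) (hxy : crossProduct x y = 0)
    (hyz : crossProduct y z = 0) : crossProduct x z = 0 := by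
  obtain ⟨a, rfl⟩ := exists_smul_of_cross_eq_zero hy hyz
  rw [map_smul, hxy, smul_zero]

theorem cross_eq_zero_symm {x y : Fin 3 → ℂ} (h : crossProduct x y = 0) :
    crossProduct y x = 0 := by
  rw [← cross_anticomm, h, neg_zero]

namespace IsTenNodalParam

variable {φ : Fin 3 → Polynomial ℂ} {u v : Fin 10 → ℂ}

/-- The twenty parameters of the double points, those of the two branches at the `i`-th double
point being indexed by `(i, true)` and `(i, false)`. -/
def params (u v : Fin 10 → ℂ) (k : Fin 10 × Bool) : ℂ := if k.2 then u k.1 else v k.1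

theorem cross_params (h : IsTenNodalParam φ u v) (k : Fin 10 × Bool) :
    crossProduct (pt φ (u k.1)) (pt φ (params u v k)) = 0 := by
  obtain ⟨i, b⟩ := k
  cases b
  · simpa [params] using h.cross_eq_zero i
  · simp [params]

theorem params_injective (h : IsTenNodalParam φ u v) : Function.Injective (params u v) := by
  intro k l hkl
  have h1 : k.1 = l.1 := by
    by_contra hne
    refine h.cross_ne_zero _ _ hne ?_
    have h2 := cross_eq_zero_symm (h.cross_params l)
    rw [← hkl] at h2
    exact cross_eq_zero_trans (h.pt_ne_zero _) (h.cross_params k) h2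
  obtain ⟨i, b⟩ := k
  obtain ⟨j, c⟩ := l
  obtain rfl : i = j := h1
  cases b <;> cases c <;> simp_all [params, h.ne i, (h.ne i).symm]

/-- The bound behind the genus formula. Suppose that quartics `E` satisfying `m` linear conditions
have the property that `E ∘ φ` is divisible by `c` and of degree at most `24 - d`. A quartic which
in addition passes through some of the double points and `14` minus the number of all these
conditions further points of the curve exists, because quartics have `15` coefficients; it yields
a nonzero polynomial `E ∘ φ` whose zeros are counted on both sides. -/
theorem natDegree_add_le (h : IsTenNodalParam φ u v) {m d : ℕ}
    (L : Fin m → MvPolynomial (Fin 3) ℂ →ₗ[ℂ] ℂ) {c : Polynomial ℂ} (hc0 : c ≠ 0) (hd : d ≤ 6)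
    (hL : ∀ E : MvPolynomial (Fin 3) ℂ, E.IsHomogeneous 4 → (∀ k, L k E = 0) →
      c ∣ aeval φ E ∧ (aeval φ E).natDegree ≤ 24 - d)
    (J : Finset (Fin 10)) (hJ : ∀ i ∈ J, c.eval (u i) ≠ 0 ∧ c.eval (v i) ≠ 0)
    (hm : m + J.card ≤ 14) : c.natDegree + d + J.card ≤ 10 + m := by
  classical
  set R : Finset ℂ := (J ×ˢ Finset.univ).image (params u v) with hR
  have hRcard : R.card = J.card * 2 := by
    rw [hR, Finset.card_image_of_injective _ h.params_injective, Finset.card_product]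
    simp
  obtain ⟨Z, hZ, hZcard⟩ := Set.Infinite.exists_subset_card_eq
    (s := {z : ℂ | z ∉ R ∧ c.eval z ≠ 0}) (by
      have : {z : ℂ | z ∉ R ∧ c.eval z ≠ 0} = ((R ∪ c.roots.toFinset : Finset ℂ) : Set ℂ)ᶜ := by
        ext z
        simp [hc0]
      rw [this]
      exact (Finset.finite_toSet _).infinite_compl) (14 - m - J.card)
  let κ := Fin m ⊕ (J ⊕ Z)
  let L' : κ → MvPolynomial (Fin 3) ℂ →ₗ[ℂ] ℂ := Sum.elim L (Sum.elim
    (fun i => (aeval (pt φ (u i)) : MvPolynomial (Fin 3) ℂ →ₐ[ℂ] ℂ).toLinearMap)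
    (fun z => (aeval (pt φ z) : MvPolynomial (Fin 3) ℂ →ₐ[ℂ] ℂ).toLinearMap))
  obtain ⟨E, hE, hE0, hLE⟩ := exists_form_of_conditions (n := 4) (κ := κ) (by
    rw [card_exponents_four]
    simp only [κ, Fintype.card_sum, Fintype.card_fin, Fintype.card_coe, hZcard]
    omega) L'
  obtain ⟨hdvd, hdeg⟩ := hL E hE fun k => hLE (Sum.inl k)
  have hG0 : aeval φ E ≠ 0 := fun h0 => hE0 (h.quartic E hE h0)
  have hroot : ∀ r ∈ R ∪ Z, (aeval φ E).eval r = 0 := by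
    intro r hr
    rw [eval_aeval_polynomial]
    rcases Finset.mem_union.mp hr with hr | hr
    · obtain ⟨k, hk, rfl⟩ := Finset.mem_image.mp hr
      have hk1 : k.1 ∈ J := (Finset.mem_product.mp hk).1
      have h0 : eval (pt φ (u k.1)) E = 0 := by
        have := hLE (Sum.inr (Sum.inl ⟨k.1, hk1⟩))
        simpa [L', aeval_eq_eval] using this
      obtain ⟨a, ha⟩ := exists_smul_of_cross_eq_zero (h.pt_ne_zero _) (h.cross_params k)
      change eval (pt φ (params u v k)) E = 0
      rw [ha, IsHomogeneous.eval_smul hE, h0, mul_zero]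
    · have := hLE (Sum.inr (Sum.inr ⟨r, hr⟩))
      change eval (pt φ r) E = 0
      simpa [L', aeval_eq_eval] using this
  have hcR : ∀ r ∈ R ∪ Z, c.eval r ≠ 0 := by
    intro r hr
    rcases Finset.mem_union.mp hr with hr | hr
    · obtain ⟨⟨i, b⟩, hk, rfl⟩ := Finset.mem_image.mp hr
      have hk1 : i ∈ J := (Finset.mem_product.mp hk).1
      cases b
      · exact (hJ i hk1).2
      · exact (hJ i hk1).1
    · exact (hZ hr).2
  have hprod : (∏ r ∈ R ∪ Z, (Polynomial.X - Polynomial.C r)) ∣ aeval φ E := by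
    refine Finset.prod_dvd_of_coprime ?_ fun r hr => Polynomial.dvd_iff_isRoot.mpr (hroot r hr)
    intro r _ s _ hrs
    exact Polynomial.isCoprime_X_sub_C_of_isUnit_sub (sub_ne_zero.mpr hrs).isUnit
  have hcop : IsCoprime c (∏ r ∈ R ∪ Z, (Polynomial.X - Polynomial.C r)) := by
    refine IsCoprime.prod_right fun r hr => IsCoprime.symm ?_
    refine (Polynomial.irreducible_X_sub_C r).coprime_iff_not_dvd.mpr fun hdv => ?_
    exact hcR r hr (Polynomial.dvd_iff_isRoot.mp hdv)
  have hle := Polynomial.natDegree_le_of_dvd (hcop.mul_dvd hdvd hprod) hG0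
  have hdisj : Disjoint R Z := by
    rw [Finset.disjoint_left]
    exact fun r hr hz => (hZ hz).1 hr
  rw [Polynomial.natDegree_mul hc0 (Finset.prod_ne_zero_iff.mpr fun r _ =>
      Polynomial.X_sub_C_ne_zero r), Polynomial.natDegree_prod_of_monic _ _ fun r _ =>
      Polynomial.monic_X_sub_C r] at hle
  simp only [Polynomial.natDegree_X_sub_C, Finset.sum_const, smul_eq_mul, mul_one,
    Finset.card_union_of_disjoint hdisj, hRcard, hZcard] at hle
  omega

/-- No coordinate vanishes identically along the curve. -/
theorem coord_ne_zero (h : IsTenNodalParam φ u v) (i : Fin 3) : φ i ≠ 0 := by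
  intro h0
  have := h.quartic (X i ^ 4) (by simpa using (isHomogeneous_X ℂ i).pow 4) (by simp [h0])
  exact pow_ne_zero 4 (X_ne_zero i) this

theorem exponents_of_coeff_eq_zero {E : MvPolynomial (Fin 3) ℂ} (hE : E.IsHomogeneous 4)
    (h0 : coeff (Finsupp.single 0 4) E = 0) {m : Fin 3 →₀ ℕ} (hm : m ∈ E.support) :
    1 ≤ m 1 + m 2 := by
  by_contra hlt
  have hsum := IsHomogeneous.sum_exponents hE hm
  have : m = Finsupp.single 0 4 := by
    ext i
    fin_cases i <;> simp <;> omega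
  exact mem_support_iff.mp hm (this ▸ h0)

/-- Let `c` divide the last two coordinates of the curve, and let these drop in degree by `d`; so
`natDegree c + d` is the number of parameters, with multiplicities, of the point `(1 : 0 : 0)`.
Quartics through this point lead to a bound on that number. -/
theorem natDegree_add_le_of_dvd (h : IsTenNodalParam φ u v) {d : ℕ} (hd : d ≤ 6)
    {c : Polynomial ℂ} (h1 : c ∣ φ 1) (h2 : c ∣ φ 2) (hd1 : (φ 1).natDegree ≤ 6 - d)
    (hd2 : (φ 2).natDegree ≤ 6 - d) (J : Finset (Fin 10))
    (hJ : ∀ i ∈ J, crossProduct (Pi.single 0 1) (pt φ (u i)) ≠ 0) :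
    c.natDegree + d + J.card ≤ 11 := by
  have hc0 : c ≠ 0 := fun h0 => h.coord_ne_zero 1 (zero_dvd_iff.mp (h0 ▸ h1))
  have hcard : J.card ≤ 10 := by simpa using J.card_le_univ
  have hpt : ∀ z, c.eval z = 0 → crossProduct (Pi.single 0 1) (pt φ z) = 0 := by
    intro z hz
    refine cross_single_zero_eq_zero.mpr ⟨?_, ?_⟩
    · exact Polynomial.eval_eq_zero_of_dvd_of_eval_eq_zero h1 hz
    · exact Polynomial.eval_eq_zero_of_dvd_of_eval_eq_zero h2 hz
  refine h.natDegree_add_le (m := 1) (fun _ => lcoeff ℂ (Finsupp.single 0 4)) hc0 hd ?_ J ?_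
    (by omega)
  · intro E hE hLE
    have hexp := fun m (hm : m ∈ E.support) => exponents_of_coeff_eq_zero hE (hLE 0) hm
    rw [aeval_eq_sum_support]
    constructor
    · refine Finset.dvd_sum fun m hm => dvd_mul_of_dvd_right ?_ _
      rcases Nat.eq_zero_or_pos (m 1) with h0 | h0
      · have := hexp m hm
        exact dvd_mul_of_dvd_right (dvd_pow h2 (by omega)) _
      · exact dvd_mul_of_dvd_left (dvd_mul_of_dvd_right (dvd_pow h1 h0.ne') _) _
    · refine Polynomial.natDegree_sum_le_of_forall_le _ _ fun m hm => ?_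
      refine (Polynomial.natDegree_C_mul_le _ _).trans ?_
      have h4 := IsHomogeneous.sum_exponents hE hm
      have h5 := hexp m hm
      calc _ ≤ m 0 * 6 + m 1 * (6 - d) + m 2 * (6 - d) := by
            refine Polynomial.natDegree_mul_le_of_le (Polynomial.natDegree_mul_le_of_le ?_ ?_) ?_
            · exact Polynomial.natDegree_pow_le_of_le _ (h.natDegree_le 0)
            · exact Polynomial.natDegree_pow_le_of_le _ hd1
            · exact Polynomial.natDegree_pow_le_of_le _ hd2
        _ ≤ 24 - d := by
            obtain ⟨e, rfl, he6⟩ : ∃ e, d = 6 - e ∧ e ≤ 6 := ⟨6 - d, by omega, by omega⟩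
            have he : 6 - (6 - e) = e := by omega
            rw [he]
            have h6 : (m 1 + m 2) * (6 - e) ≥ 6 - e := Nat.le_mul_of_pos_left _ h5
            have h7 : (m 1 + m 2) * (6 - e) + (m 1 + m 2) * e = (m 1 + m 2) * 6 := by
              rw [← mul_add]
              congr 1
              omega
            rw [add_assoc, ← add_mul]
            omega
  · exact fun i hi => ⟨fun h0 => hJ i hi (hpt _ h0), fun h0 => hJ i hi
      (cross_eq_zero_trans (h.pt_ne_zero _) (hpt _ h0) (cross_eq_zero_symm (h.cross_eq_zero i)))⟩

/-- The two branches at a double point, here put at `(1 : 0 : 0)`, have different tangents: the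
last coordinate cannot vanish doubly along both branches. -/
theorem not_sq_dvd (h : IsTenNodalParam φ u v) (k : Fin 10)
    (hk : crossProduct (Pi.single 0 1) (pt φ (u k)) = 0) :
    ¬ ((Polynomial.X - Polynomial.C (u k)) * (Polynomial.X - Polynomial.C (v k))) ^ 2 ∣ φ 2 := by
  intro h2
  set c := (Polynomial.X - Polynomial.C (u k)) * (Polynomial.X - Polynomial.C (v k)) with hc
  have hkv : crossProduct (Pi.single 0 1) (pt φ (v k)) = 0 :=
    cross_eq_zero_trans (h.pt_ne_zero _) hk (h.cross_eq_zero k)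
  have h1 : c ∣ φ 1 := by
    refine IsCoprime.mul_dvd ?_ ?_ ?_
    · exact Polynomial.isCoprime_X_sub_C_of_isUnit_sub (sub_ne_zero.mpr (h.ne k)).isUnit
    · exact Polynomial.dvd_iff_isRoot.mpr (cross_single_zero_eq_zero.mp hk).1
    · exact Polynomial.dvd_iff_isRoot.mpr (cross_single_zero_eq_zero.mp hkv).1
  have hc0 : c ≠ 0 := mul_ne_zero (Polynomial.X_sub_C_ne_zero _) (Polynomial.X_sub_C_ne_zero _)
  have hcdeg : c.natDegree = 2 := by
    rw [hc, Polynomial.natDegree_mul (Polynomial.X_sub_C_ne_zero _) (Polynomial.X_sub_C_ne_zero _)]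
    simp
  have hpt : ∀ z, (c ^ 2).eval z = 0 → z = u k ∨ z = v k := by
    intro z hz
    simpa [hc, sub_eq_zero] using hz
  have hcross : ∀ i ≠ k, ∀ z, crossProduct (pt φ (u i)) (pt φ z) = 0 → (c ^ 2).eval z ≠ 0 := by
    intro i hi z hz hz0
    refine h.cross_ne_zero i k hi ?_
    rcases hpt z hz0 with rfl | rfl
    · exact hz
    · exact cross_eq_zero_trans (h.pt_ne_zero _) hz (cross_eq_zero_symm (h.cross_eq_zero k))
  have hbound := h.natDegree_add_le (m := 2) (d := 0)
    ![lcoeff ℂ (Finsupp.single 0 4), lcoeff ℂ (Finsupp.single 0 3 + Finsupp.single 1 1)]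
    (pow_ne_zero 2 hc0) (by omega) ?_ (Finset.univ.erase k) ?_ ?_
  · rw [Polynomial.natDegree_pow, hcdeg, Finset.card_erase_of_mem (Finset.mem_univ _)] at hbound
    simp at hbound
  · intro E hE hLE
    refine ⟨?_, (IsHomogeneous.natDegree_aeval_le hE h.natDegree_le).trans (by omega)⟩
    rw [aeval_eq_sum_support]
    refine Finset.dvd_sum fun m hm => dvd_mul_of_dvd_right ?_ _
    have h3 := exponents_of_coeff_eq_zero hE (hLE 0) hm
    rcases Nat.eq_zero_or_pos (m 2) with h0 | h0
    · have h4 : 2 ≤ m 1 := by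
        by_contra hlt
        have hsum := IsHomogeneous.sum_exponents hE hm
        have : m = Finsupp.single 0 3 + Finsupp.single 1 1 := by
          ext i
          fin_cases i <;> simp <;> omega
        exact mem_support_iff.mp hm (this ▸ hLE 1)
      exact dvd_mul_of_dvd_left (dvd_mul_of_dvd_right (pow_dvd_pow_of_dvd h1 2 |>.trans
        (pow_dvd_pow _ h4)) _) _
    · exact dvd_mul_of_dvd_right (dvd_pow h2 h0.ne') _
  · intro i hi
    have hik := Finset.ne_of_mem_erase hi
    exact ⟨hcross i hik _ (by simp), hcross i hik _ (h.cross_eq_zero i)⟩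
  · rw [Finset.card_erase_of_mem (Finset.mem_univ _)]
    simp

end IsTenNodalParam

/-! ### Lines through a point of a rational curve -/

/-- A general member of a pencil of polynomials without common factor has distinct roots, as many
as the degrees permit, and these avoid a given finite set. -/
theorem exists_finite_forall_roots {f g : Polynomial ℂ} (hfg : IsCoprime f g)
    {S : Set ℂ} (hS : S.Finite) :
    ∃ B : Set ℂ, B.Finite ∧ ∀ s ∉ B, ∃ R : Finset ℂ,
      R.card = max f.natDegree g.natDegree ∧
      ∀ r ∈ R, r ∉ S ∧ f.eval r ≠ 0 ∧ g.eval r = s * f.eval r := by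
  classical
  by_cases hN : max f.natDegree g.natDegree = 0
  · exact ⟨∅, Set.finite_empty, fun s _ => ⟨∅, by simp [hN], by simp⟩⟩
  set W := f * Polynomial.derivative g - Polynomial.derivative f * g with hW
  have hcop : ∀ r, f.eval r = 0 → g.eval r ≠ 0 := by
    intro r hf hg
    obtain ⟨a, b, hab⟩ := hfg
    have := congrArg (Polynomial.eval r) hab
    simp [hf, hg] at this
  have hW0 : W ≠ 0 := by
    intro h0
    rw [sub_eq_zero] at h0
    have h1 : f ∣ Polynomial.derivative f :=
      hfg.dvd_of_dvd_mul_right ⟨_, h0.symm⟩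
    have h2 : g ∣ Polynomial.derivative g :=
      hfg.symm.dvd_of_dvd_mul_left ⟨Polynomial.derivative f, by rw [h0, mul_comm]⟩
    have h3 : ∀ p : Polynomial ℂ, p ∣ Polynomial.derivative p → p.natDegree = 0 := by
      intro p hp
      by_contra hp0
      exact hp0 (Polynomial.derivative_eq_zero.mp
        (Polynomial.eq_zero_of_dvd_of_natDegree_lt hp (Polynomial.natDegree_derivative_lt hp0)))
    exact hN (by simp [h3 f h1, h3 g h2])
  -- a value `s` is bad if the degree drops, or if `g - s f` vanishes at a bad parameter
  let S' : Set ℂ := S ∪ W.roots.toFinset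
  have hS' : S'.Finite := hS.union (Finset.finite_toSet _)
  refine ⟨(fun r => g.eval r / f.eval r) '' S' ∪
    {g.coeff (max f.natDegree g.natDegree) / f.coeff (max f.natDegree g.natDegree)} ∪ {0},
    ((hS'.image _).union (Set.finite_singleton _)).union (Set.finite_singleton _), ?_⟩
  intro s hs
  simp only [Set.mem_union, Set.mem_image, Set.mem_singleton_iff, not_or, not_exists, not_and]
    at hs
  obtain ⟨⟨hs1, hs2⟩, hs0⟩ := hs
  set q := g - Polynomial.C s * f with hq
  have hqdeg : q.natDegree = max f.natDegree g.natDegree := by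
    refine le_antisymm ?_ (Polynomial.le_natDegree_of_ne_zero ?_)
    · refine (Polynomial.natDegree_sub_le _ _).trans ?_
      have := Polynomial.natDegree_C_mul_le s f
      omega
    · rw [hq, Polynomial.coeff_sub, Polynomial.coeff_C_mul]
      intro h0
      by_cases hf : f.coeff (max f.natDegree g.natDegree) = 0
      · rw [hf, mul_zero, sub_zero] at h0
        rcases le_total f.natDegree g.natDegree with hle | hle
        · rw [max_eq_right hle] at h0
          have hg0 : g = 0 := Polynomial.leadingCoeff_eq_zero.mp h0
          rw [hg0] at hle hN
          simp at hle hN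
          omega
        · rw [max_eq_left hle] at hf
          have hf0 : f = 0 := Polynomial.leadingCoeff_eq_zero.mp hf
          rw [hf0] at hle hN
          simp at hle hN
          omega
      · exact hs2 (by rw [eq_div_iff hf]; linear_combination -h0)
  have hfr : ∀ r, q.eval r = 0 → f.eval r ≠ 0 ∧ g.eval r = s * f.eval r := by
    intro r hr
    have hr' : g.eval r = s * f.eval r := by
      simpa [hq, sub_eq_zero] using hr
    exact ⟨fun h0 => hcop r h0 (by rw [hr', h0, mul_zero]), hr'⟩
  have hnot : ∀ r, q.eval r = 0 → r ∉ S' := by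
    intro r hr hrS
    obtain ⟨h1, h2⟩ := hfr r hr
    exact hs1 r hrS (by rw [h2, mul_div_assoc, div_self h1, mul_one])
  have hq0 : q ≠ 0 := fun h0 => hN (by rw [← hqdeg, h0, Polynomial.natDegree_zero])
  have hnodup : q.roots.Nodup := by
    rw [Multiset.nodup_iff_count_le_one]
    intro r
    by_contra! hlt
    rw [Polynomial.count_roots, Polynomial.one_lt_rootMultiplicity_iff_isRoot hq0] at hlt
    obtain ⟨h1, h2⟩ := hlt
    have h3 := (hfr r h1).2
    have h4 : (Polynomial.derivative g).eval r = s * (Polynomial.derivative f).eval r := by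
      simpa [hq, sub_eq_zero] using h2
    refine hnot r h1 (Or.inr ?_)
    have : W.eval r = 0 := by
      rw [hW, Polynomial.eval_sub, Polynomial.eval_mul, Polynomial.eval_mul, h3, h4]
      ring
    simpa [hW0] using this
  refine ⟨q.roots.toFinset, ?_, ?_⟩
  · rw [Multiset.toFinset_card_of_nodup hnodup, ← hqdeg]
    exact (IsAlgClosed.splits q).natDegree_eq_card_roots.symm
  · intro r hr
    have hr0 : q.eval r = 0 := by simpa [hq0] using hr
    exact ⟨fun h => hnot r hr0 (Or.inl h), hfr r hr0⟩

theorem exists_cross_ne_zero_finite {φ : Fin 3 → Polynomial ℂ} {u v : Fin 10 → ℂ}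
    (h : IsTenNodalParam φ u v) {p : Fin 3 → ℂ} (hp : p ≠ 0) :
    {z | crossProduct p (pt φ z) = 0}.Finite := by
  obtain ⟨M, hM⟩ := exists_linearEquiv_apply_eq_single hp
  refine (Finset.finite_toSet (linComp M.toLinearMap φ 1).roots.toFinset).subset fun z hz => ?_
  have h1 : crossProduct (M p) (M (pt φ z)) = 0 := (cross_map_eq_zero M _ _).mpr hz
  rw [hM, ← pt_linComp, cross_single_zero_eq_zero] at h1
  have h2 : (linComp M.toLinearMap φ 1).eval z = 0 := h1.1
  simpa [(h.map M).coord_ne_zero 1] using h2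

/-- The parametrization is injective outside of the parameters of the double points. -/
theorem IsTenNodalParam.finite_noninjective {φ : Fin 3 → Polynomial ℂ} {u v : Fin 10 → ℂ}
    (h : IsTenNodalParam φ u v) :
    {z | ∃ w ≠ z, crossProduct (pt φ z) (pt φ w) = 0}.Finite := by
  refine (Set.finite_iUnion fun i =>
    exists_cross_ne_zero_finite h (h.pt_ne_zero (u i))).subset fun z hz => ?_
  obtain ⟨w, hwz, hw⟩ := hz
  rw [Set.mem_iUnion]
  by_contra! hno
  obtain ⟨M, hM⟩ := exists_linearEquiv_apply_eq_single (h.pt_ne_zero z)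
  have hz0 : crossProduct (Pi.single 0 1) (pt (linComp M.toLinearMap φ) z) = 0 := by
    rw [← hM, pt_linComp, cross_self]
  have hw0 : crossProduct (Pi.single 0 1) (pt (linComp M.toLinearMap φ) w) = 0 := by
    rw [← hM, pt_linComp, cross_map_eq_zero]
    exact hw
  rw [cross_single_zero_eq_zero] at hz0 hw0
  have hdvd : ∀ i, (pt (linComp M.toLinearMap φ) z) i = 0 →
      (pt (linComp M.toLinearMap φ) w) i = 0 →
      (Polynomial.X - Polynomial.C w) * (Polynomial.X - Polynomial.C z) ∣
        linComp M.toLinearMap φ i := fun i h1 h2 =>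
    IsCoprime.mul_dvd
      (Polynomial.isCoprime_X_sub_C_of_isUnit_sub (sub_ne_zero.mpr hwz).isUnit)
      (Polynomial.dvd_iff_isRoot.mpr h2) (Polynomial.dvd_iff_isRoot.mpr h1)
  have := (h.map M).natDegree_add_le_of_dvd (d := 0) (by omega)
    (hdvd 1 hz0.1 hw0.1) (hdvd 2 hz0.2 hw0.2) ((h.map M).natDegree_le 1)
    ((h.map M).natDegree_le 2) Finset.univ (fun i _ h0 => hno i ?_)
  · rw [Polynomial.natDegree_mul (Polynomial.X_sub_C_ne_zero _)
      (Polynomial.X_sub_C_ne_zero _)] at this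
    simp at this
  · rw [← hM, pt_linComp, cross_map_eq_zero] at h0
    exact cross_eq_zero_symm h0

/-- The restriction of the form `D` to the line through `p` with direction `w`. -/
def restrictLine (p w : Fin 3 → ℂ) (D : MvPolynomial (Fin 3) ℂ) : Polynomial ℂ :=
  aeval (fun i => Polynomial.C (p i) + Polynomial.X * Polynomial.C (w i)) D

theorem eval_restrictLine (p w : Fin 3 → ℂ) (D : MvPolynomial (Fin 3) ℂ) (y : ℂ) :
    (restrictLine p w D).eval y = eval (p + y • w) D := by
  rw [restrictLine, eval_aeval_polynomial]
  congr 2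
  funext i
  simp only [Polynomial.eval_add, Polynomial.eval_mul, Polynomial.eval_C, Polynomial.eval_X,
    Pi.add_apply, Pi.smul_apply, smul_eq_mul]

theorem natDegree_restrictLine_le {n : ℕ} (p w : Fin 3 → ℂ) {D : MvPolynomial (Fin 3) ℂ}
    (hD : D.IsHomogeneous n) : (restrictLine p w D).natDegree ≤ n := by
  have h1 : ∀ i, (Polynomial.C (p i) + Polynomial.X * Polynomial.C (w i)).natDegree ≤ 1 := by
    intro i
    refine (Polynomial.natDegree_add_le _ _).trans (max_le ?_ ?_)
    · rw [Polynomial.natDegree_C]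
      exact zero_le_one
    · exact (Polynomial.natDegree_mul_C_le _ _).trans Polynomial.natDegree_X_le
  exact (IsHomogeneous.natDegree_aeval_le hD h1).trans_eq (mul_one n)

theorem single_add_smul (y s : ℂ) :
    (Pi.single 0 1 + y • ![0, 1, s] : Fin 3 → ℂ) = ![1, y, y * s] := by
  funext i
  fin_cases i
  · change (1 : ℂ) + y * 0 = 1
    ring
  · change (0 : ℂ) + y * 1 = y
    ring
  · change (0 : ℂ) + y * s = y * s
    ring

/-- A form `D` of degree `n` containing the curve `φ` and vanishing to order `k` at `(1 : 0 : 0)`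
meets a general line through this point with multiplicity at least `k` there, and in one further
point for each root of the equation of the line along `φ` which is not a parameter of
`(1 : 0 : 0)`. -/
theorem IsTenNodalParam.max_natDegree_add_le {φ : Fin 3 → Polynomial ℂ} {u v : Fin 10 → ℂ}
    (h : IsTenNodalParam φ u v) {n : ℕ} {D : MvPolynomial (Fin 3) ℂ}
    (hD : D.IsHomogeneous n) (hD0 : D ≠ 0) (hφ : aeval φ D = 0) {c f g : Polynomial ℂ}
    (hf : φ 1 = c * f) (hg : φ 2 = c * g) (hfg : IsCoprime f g) {k : ℕ}
    (hk : ∀ w, Polynomial.X ^ k ∣ restrictLine (Pi.single 0 1) w D) :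
    max f.natDegree g.natDegree + k ≤ n := by
  classical
  by_contra! hlt
  have hc0 : c ≠ 0 := fun h0 => h.coord_ne_zero 1 (by rw [hf, h0, zero_mul])
  obtain ⟨B, hB, hBR⟩ := exists_finite_forall_roots hfg
    (S := {z | ∃ w ≠ z, crossProduct (pt φ z) (pt φ w) = 0} ∪
      (c * φ 0).roots.toFinset) (h.finite_noninjective.union (Finset.finite_toSet _))
  have hline : ∀ s ∉ B, restrictLine (Pi.single 0 1) ![0, 1, s] D = 0 := by
    intro s hs
    obtain ⟨R, hRcard, hR⟩ := hBR s hs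
    have hne : ∀ r ∈ R, c.eval r ≠ 0 ∧ (φ 0).eval r ≠ 0 := by
      intro r hr
      have h1 := (hR r hr).1
      simp only [Set.mem_union, not_or] at h1
      simpa [hc0, h.coord_ne_zero 0] using h1.2
    -- the affine coordinate on the line of the point with parameter `r`
    let y : ℂ → ℂ := fun r => c.eval r * f.eval r / (φ 0).eval r
    have hpt : ∀ r ∈ R, pt φ r = (φ 0).eval r • (Pi.single 0 1 + y r • ![0, 1, s]) := by
      intro r hr
      obtain ⟨h1, h2⟩ := hne r hr
      have h3 := (hR r hr).2.2
      rw [single_add_smul]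
      funext i
      fin_cases i
      · simp [pt]
      · simp [pt, y, hf]
        field_simp
      · simp [pt, y, hg, h3]
        field_simp
    have hy0 : ∀ r ∈ R, y r ≠ 0 := fun r hr =>
      div_ne_zero (mul_ne_zero (hne r hr).1 (hR r hr).2.1) (hne r hr).2
    have hinj : Set.InjOn y R := by
      intro r hr r' hr' hyy
      by_contra hrr
      refine (hR r hr).1 (Or.inl ⟨r', Ne.symm hrr, ?_⟩)
      rw [hpt r hr, hpt r' hr', hyy, map_smul, map_smul, LinearMap.smul_apply, cross_self,
        smul_zero, smul_zero]
    have hroot : ∀ a ∈ R.image y, (restrictLine (Pi.single 0 1) ![0, 1, s] D).eval a = 0 := by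
      intro a ha
      obtain ⟨r, hr, rfl⟩ := Finset.mem_image.mp ha
      have h1 : eval (pt φ r) D = 0 := by
        have := eval_aeval_polynomial φ D r
        rw [hφ, Polynomial.eval_zero] at this
        exact this.symm
      rw [hpt r hr, IsHomogeneous.eval_smul hD] at h1
      rw [eval_restrictLine]
      exact (mul_eq_zero.mp h1).resolve_left (pow_ne_zero _ (hne r hr).2)
    by_contra h0
    have hprod : (∏ a ∈ R.image y, (Polynomial.X - Polynomial.C a)) ∣
        restrictLine (Pi.single 0 1) ![0, 1, s] D := by
      refine Finset.prod_dvd_of_coprime ?_ fun r hr => Polynomial.dvd_iff_isRoot.mpr (hroot r hr)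
      intro r _ s _ hrs
      exact Polynomial.isCoprime_X_sub_C_of_isUnit_sub (sub_ne_zero.mpr hrs).isUnit
    have hcop : IsCoprime (Polynomial.X ^ k)
        (∏ a ∈ R.image y, (Polynomial.X - Polynomial.C a)) := by
      refine IsCoprime.prod_right fun a ha => IsCoprime.pow_left ?_
      obtain ⟨r, hr, rfl⟩ := Finset.mem_image.mp ha
      have := Polynomial.isCoprime_X_sub_C_of_isUnit_sub (a := (0 : ℂ)) (b := y r)
        (by simpa using (hy0 r hr).isUnit)
      simpa using this
    have hle := Polynomial.natDegree_le_of_dvd (hcop.mul_dvd (hk _) hprod) h0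
    rw [Polynomial.natDegree_mul (pow_ne_zero _ Polynomial.X_ne_zero)
      (Finset.prod_ne_zero_iff.mpr fun r _ => Polynomial.X_sub_C_ne_zero r),
      Polynomial.natDegree_prod_of_monic _ _ fun r _ => Polynomial.monic_X_sub_C r] at hle
    simp only [Polynomial.natDegree_X_sub_C, Finset.sum_const, smul_eq_mul, mul_one,
      Finset.card_image_of_injOn hinj, hRcard, Polynomial.natDegree_pow,
      Polynomial.natDegree_X] at hle
    have := natDegree_restrictLine_le (Pi.single 0 1) ![0, 1, s] hD
    omega
  -- so `D` vanishes on almost all lines through the point, and therefore everywhere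
  have hzero : D * (X 0 * X 1 * ∏ s ∈ hB.toFinset, (X 2 - C s * X 1)) = 0 := by
    refine MvPolynomial.funext fun x => ?_
    rw [map_mul, map_zero]
    by_cases hx0 : x 0 = 0
    · simp [hx0]
    by_cases hx1 : x 1 = 0
    · simp [hx1]
    by_cases hs : x 2 / x 1 ∈ B
    · rw [map_mul, map_prod, Finset.prod_eq_zero ((hB.mem_toFinset).mpr hs), mul_zero, mul_zero]
      simp
      field_simp
      ring
    · have h1 := hline _ hs
      have h2 := eval_restrictLine (Pi.single 0 1) ![0, 1, x 2 / x 1] D (x 1 / x 0)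
      have h3 : x = x 0 • (Pi.single 0 1 + (x 1 / x 0) • ![0, 1, x 2 / x 1]) := by
        rw [single_add_smul]
        funext i
        fin_cases i
        · simp
        · simp
          field_simp
        · simp
          field_simp
      rw [h1, Polynomial.eval_zero] at h2
      rw [h3, IsHomogeneous.eval_smul hD, ← h2, mul_zero, zero_mul]
  refine mul_ne_zero hD0 (mul_ne_zero (mul_ne_zero (X_ne_zero _) (X_ne_zero _)) ?_) hzero
  refine Finset.prod_ne_zero_iff.mpr fun s _ h0 => ?_
  have := congrArg (eval (![0, 0, 1] : Fin 3 → ℂ)) h0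
  simp at this

/-! ### Sextics containing a rational curve with ten double points -/

theorem restrictLine_subst_symm (M : (Fin 3 → ℂ) ≃ₗ[ℂ] (Fin 3 → ℂ)) (p w : Fin 3 → ℂ)
    (D : MvPolynomial (Fin 3) ℂ) :
    restrictLine (M p) w (subst M.symm.toLinearMap D) = restrictLine p (M.symm w) D := by
  refine Polynomial.funext fun y => ?_
  rw [eval_restrictLine, eval_restrictLine, eval_subst]
  congr 2
  simp

theorem aeval_linComp_subst_symm (M : (Fin 3 → ℂ) ≃ₗ[ℂ] (Fin 3 → ℂ)) (φ : Fin 3 → Polynomial ℂ)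
    (D : MvPolynomial (Fin 3) ℂ) :
    aeval (linComp M.toLinearMap φ) (subst M.symm.toLinearMap D) = aeval φ D := by
  rw [aeval_linComp, subst_symm_subst]

theorem subst_ne_zero (M : (Fin 3 → ℂ) ≃ₗ[ℂ] (Fin 3 → ℂ)) {E : MvPolynomial (Fin 3) ℂ}
    (h : E ≠ 0) : subst M.toLinearMap E ≠ 0 := fun h0 => h (subst_eq_zero M h0)

theorem exists_gcd_decomposition {a b : Polynomial ℂ} (ha : a ≠ 0) :
    ∃ c f g : Polynomial ℂ, c ≠ 0 ∧ a = c * f ∧ b = c * g ∧ IsCoprime f g := by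
  classical
  obtain ⟨f, g, h1, h2, h3⟩ := extract_gcd a b
  refine ⟨gcd a b, f, g, ?_, h1, h2, ?_⟩
  · intro h0
    exact ha (by rw [h1, h0, zero_mul])
  · exact (gcd_isUnit_iff f g).mp h3

namespace IsTenNodalParam

variable {φ : Fin 3 → Polynomial ℂ} {u v : Fin 10 → ℂ}

/-- The multiplicity at `p` of a sextic containing the curve is at most the number of parameters
of `p`. By the adjoint quartics that number is at most two at the ten double points, and at most
one at all other points. -/
theorem order_add_card_le (h : IsTenNodalParam φ u v) {D : MvPolynomial (Fin 3) ℂ}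
    (hD : D.IsHomogeneous 6) (hD0 : D ≠ 0) (hφ : aeval φ D = 0) {p : Fin 3 → ℂ} (hp : p ≠ 0)
    {k : ℕ} (hk : ∀ w, Polynomial.X ^ k ∣ restrictLine p w D) (J : Finset (Fin 10))
    (hJ : ∀ i ∈ J, crossProduct p (pt φ (u i)) ≠ 0) : k + J.card ≤ 11 := by
  obtain ⟨M, hM⟩ := exists_linearEquiv_apply_eq_single hp
  have h' := h.map M
  obtain ⟨c, f, g, hc0, hf, hg, hfg⟩ := exists_gcd_decomposition (b := linComp M.toLinearMap φ 2)
    (h'.coord_ne_zero 1)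
  have h1 := h'.max_natDegree_add_le (isHomogeneous_subst M.symm.toLinearMap hD)
    (subst_ne_zero M.symm hD0) (by rw [aeval_linComp_subst_symm, hφ]) hf hg hfg (k := k)
    (fun w => by rw [← hM, restrictLine_subst_symm]; exact hk _)
  have hf0 : f ≠ 0 := fun h0 => h'.coord_ne_zero 1 (by rw [hf, h0, mul_zero])
  have hg0 : g ≠ 0 := fun h0 => h'.coord_ne_zero 2 (by rw [hg, h0, mul_zero])
  have hdf : (linComp M.toLinearMap φ 1).natDegree = c.natDegree + f.natDegree := by
    rw [hf, Polynomial.natDegree_mul hc0 hf0]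
  have hdg : (linComp M.toLinearMap φ 2).natDegree = c.natDegree + g.natDegree := by
    rw [hg, Polynomial.natDegree_mul hc0 hg0]
  have h61 := h'.natDegree_le 1
  have h62 := h'.natDegree_le 2
  have h2 := h'.natDegree_add_le_of_dvd
    (d := 6 - (c.natDegree + max f.natDegree g.natDegree)) (by omega) ⟨f, hf⟩ ⟨g, hg⟩ (by omega)
    (by omega) J (fun i hi => by
      rw [← hM, pt_linComp, ne_eq, cross_map_eq_zero]
      exact hJ i hi)
  omega

/-- At a point outside of the curve, a form of degree `n` containing the curve has a multiplicity
of at most `n - 6`. -/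
theorem order_add_six_le (h : IsTenNodalParam φ u v) {n : ℕ} {E : MvPolynomial (Fin 3) ℂ}
    (hE : E.IsHomogeneous n) (hE0 : E ≠ 0) (hφ : aeval φ E = 0) {p : Fin 3 → ℂ} (hp : p ≠ 0)
    (hpt : ∀ z, crossProduct p (pt φ z) ≠ 0)
    (hlead : crossProduct p (fun i => (φ i).coeff 6) ≠ 0)
    {k : ℕ} (hk : ∀ w, Polynomial.X ^ k ∣ restrictLine p w E) : 6 + k ≤ n := by
  obtain ⟨M, hM⟩ := exists_linearEquiv_apply_eq_single hp
  have h' := h.map M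
  have hcop : IsCoprime (linComp M.toLinearMap φ 1) (linComp M.toLinearMap φ 2) := by
    rw [Polynomial.isCoprime_iff_aeval_ne_zero_of_isAlgClosed ℂ ℂ]
    intro z
    by_contra! h0
    refine hpt z ?_
    rw [← cross_map_eq_zero M, hM, ← pt_linComp, cross_single_zero_eq_zero]
    simpa [Polynomial.aeval_def, pt] using h0
  have h1 := h'.max_natDegree_add_le (isHomogeneous_subst M.symm.toLinearMap hE)
    (subst_ne_zero M.symm hE0) (by rw [aeval_linComp_subst_symm, hφ]) (one_mul _).symm
    (one_mul _).symm hcop (k := k) (fun w => by rw [← hM, restrictLine_subst_symm]; exact hk _)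
  have h2 : 6 ≤ max (linComp M.toLinearMap φ 1).natDegree
      (linComp M.toLinearMap φ 2).natDegree := by
    by_contra! hlt
    refine hlead ?_
    rw [← cross_map_eq_zero M, hM]
    have := coeff_linComp M.toLinearMap φ 6
    rw [LinearEquiv.coe_coe] at this
    rw [← this, cross_single_zero_eq_zero]
    exact ⟨Polynomial.coeff_eq_zero_of_natDegree_lt (by omega),
      Polynomial.coeff_eq_zero_of_natDegree_lt (by omega)⟩
  omega

theorem X_dvd_restrictLine {p : Fin 3 → ℂ} {D : MvPolynomial (Fin 3) ℂ} (h0 : eval p D = 0)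
    (w : Fin 3 → ℂ) : Polynomial.X ∣ restrictLine p w D := by
  rw [Polynomial.X_dvd_iff, Polynomial.coeff_zero_eq_eval_zero, eval_restrictLine]
  simpa using h0

/-- The zeros of a sextic containing the curve are the points of the curve. -/
theorem eval_eq_zero_iff (h : IsTenNodalParam φ u v) {D : MvPolynomial (Fin 3) ℂ}
    (hD : D.IsHomogeneous 6) (hD0 : D ≠ 0) (hφ : aeval φ D = 0) {p : Fin 3 → ℂ} (hp : p ≠ 0) :
    eval p D = 0 ↔ (∃ z, crossProduct p (pt φ z) = 0) ∨
      crossProduct p (fun i => (φ i).coeff 6) = 0 := by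
  constructor
  · intro h0
    by_contra! hno
    have := h.order_add_six_le hD hD0 hφ hp hno.1 hno.2 (k := 1)
      (fun w => by simpa using X_dvd_restrictLine h0 w)
    omega
  · rintro (⟨z, hz⟩ | hz)
    · obtain ⟨a, ha⟩ := exists_smul_of_cross_eq_zero (h.pt_ne_zero z) (cross_eq_zero_symm hz)
      have := eval_aeval_polynomial φ D z
      rw [hφ, Polynomial.eval_zero] at this
      rw [ha, IsHomogeneous.eval_smul hD, show eval (pt φ z) D = 0 from this.symm, mul_zero]
    · obtain ⟨a, ha⟩ := exists_smul_of_cross_eq_zero h.lead_ne_zero (cross_eq_zero_symm hz)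
      have := IsHomogeneous.coeff_aeval hD h.natDegree_le
      rw [hφ, Polynomial.coeff_zero] at this
      rw [ha, IsHomogeneous.eval_smul hD, ← this, mul_zero]

/-- A nonzero form containing the curve has degree at least six, given that some sextic contains
it. -/
theorem six_le_degree (h : IsTenNodalParam φ u v) {D : MvPolynomial (Fin 3) ℂ}
    (hD : D.IsHomogeneous 6) (hD0 : D ≠ 0) (hφ : aeval φ D = 0) {n : ℕ}
    {E : MvPolynomial (Fin 3) ℂ} (hE : E.IsHomogeneous n) (hE0 : E ≠ 0) (hEφ : aeval φ E = 0) :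
    6 ≤ n := by
  obtain ⟨p, hp⟩ : ∃ p, eval p D ≠ 0 := by
    by_contra! hall
    exact hD0 (MvPolynomial.funext fun x => by rw [hall x, map_zero])
  have hp0 : p ≠ 0 := by
    rintro rfl
    refine hp ?_
    have := IsHomogeneous.eval_smul hD 0 0
    rwa [zero_smul, zero_pow (by norm_num), zero_mul] at this
  rw [ne_eq, h.eval_eq_zero_iff hD hD0 hφ hp0] at hp
  push Not at hp
  simpa using h.order_add_six_le hE hE0 hEφ hp0 hp.1 hp.2 (k := 0) (fun w => by simp)

theorem aeval_C_mul_X (φ : Fin 3 → Polynomial ℂ) {m : ℕ} {E : MvPolynomial (Fin 3) ℂ}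
    (hE : E.IsHomogeneous m) :
    aeval (fun i => Polynomial.C (φ i) * Polynomial.X) E =
      Polynomial.C (aeval φ E) * Polynomial.X ^ m := by
  rw [aeval_eq_sum_support, aeval_eq_sum_support, map_sum, Finset.sum_mul]
  refine Finset.sum_congr rfl fun k hk => ?_
  rw [← IsHomogeneous.sum_exponents hE hk]
  have : algebraMap ℂ (Polynomial (Polynomial ℂ)) (coeff k E) =
      Polynomial.C (algebraMap ℂ (Polynomial ℂ) (coeff k E)) := rfl
  rw [this]
  simp only [map_mul, map_pow, mul_pow, pow_add]
  ring

theorem aeval_homogeneousComponent_eq_zero {a : MvPolynomial (Fin 3) ℂ}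
    (ha : aeval (fun i => Polynomial.C (φ i) * Polynomial.X) a = 0) (m : ℕ) :
    aeval φ (homogeneousComponent m a) = 0 := by
  rw [← sum_homogeneousComponent a, map_sum] at ha
  have h1 := congrArg (fun q => Polynomial.coeff q m) ha
  simp only [Polynomial.finsetSum_coeff, Polynomial.coeff_zero] at h1
  by_cases hm : m < a.totalDegree + 1
  · rw [Finset.sum_eq_single m] at h1
    · rw [aeval_C_mul_X φ (homogeneousComponent_isHomogeneous m a)] at h1
      rwa [Polynomial.coeff_C_mul, Polynomial.coeff_X_pow_self, mul_one] at h1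
    · intro k _ hk
      rw [aeval_C_mul_X φ (homogeneousComponent_isHomogeneous k a)]
      rw [Polynomial.coeff_C_mul, Polynomial.coeff_X_pow, if_neg hk.symm, mul_zero]
    · intro h2
      exact absurd (Finset.mem_range.mpr hm) h2
  · rw [homogeneousComponent_eq_zero m a (by omega), map_zero]

/-- The sextic is irreducible: one of two factors contains the curve, and by `six_le_degree` it has
the degree of the product. -/
theorem irreducible (h : IsTenNodalParam φ u v) {D : MvPolynomial (Fin 3) ℂ}
    (hD : D.IsHomogeneous 6) (hD0 : D ≠ 0) (hφ : aeval φ D = 0) : Irreducible D := by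
  have htd : D.totalDegree = 6 := hD.totalDegree hD0
  -- a factor vanishing on the cone over the curve has the full degree six
  have key : ∀ a b : MvPolynomial (Fin 3) ℂ, D = a * b →
      aeval (fun i => Polynomial.C (φ i) * Polynomial.X) a = 0 → IsUnit b := by
    intro a b hab ha
    have ha0 : a ≠ 0 := by
      rintro rfl
      exact hD0 (by rw [hab, zero_mul])
    have hb0 : b ≠ 0 := by
      rintro rfl
      exact hD0 (by rw [hab, mul_zero])
    have htop : homogeneousComponent a.totalDegree a ≠ 0 := by
      intro h0
      obtain ⟨m, hm, hdeg⟩ := Finset.exists_mem_eq_sup a.support (support_nonempty.mpr ha0)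
        (fun m : Fin 3 →₀ ℕ => m.sum fun _ e => e)
      have h1 := congrArg (coeff m) h0
      rw [coeff_homogeneousComponent, if_pos, coeff_zero] at h1
      · exact mem_support_iff.mp hm h1
      · exact hdeg.symm
    have h6 := h.six_le_degree hD hD0 hφ (homogeneousComponent_isHomogeneous _ a) htop
      (aeval_homogeneousComponent_eq_zero ha _)
    have hsum := totalDegree_mul_of_isDomain ha0 hb0
    rw [← hab, htd] at hsum
    have hb : b.totalDegree = 0 := by omega
    rw [totalDegree_eq_zero_iff_eq_C] at hb
    rw [hb]
    refine (IsUnit.mk0 _ fun h0 => hb0 ?_).map C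
    rw [hb, h0, map_zero]
  refine ⟨fun hu => ?_, fun a b hab => ?_⟩
  · have h1 := hu.map (eval (0 : Fin 3 → ℂ))
    have := IsHomogeneous.eval_smul hD 0 0
    rw [zero_smul, zero_pow (by norm_num), zero_mul] at this
    exact h1.ne_zero this
  · have h1 := aeval_C_mul_X φ hD
    rw [hφ, map_zero, zero_mul, hab, map_mul, mul_eq_zero] at h1
    rcases h1 with h1 | h1
    · exact Or.inr (key a b hab h1)
    · exact Or.inl (key b a (by rw [hab, mul_comm]) h1)

end IsTenNodalParam

/-! ### The singular points of a sextic containing such a curve -/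

theorem pderiv_comm {σ : Type*} [DecidableEq σ] (i j : σ) (D : MvPolynomial σ ℂ) :
    pderiv i (pderiv j D) = pderiv j (pderiv i D) := by
  induction D using MvPolynomial.induction_on with
  | C a => simp
  | add p q hp hq => simp only [map_add, hp, hq]
  | mul_X p k hp =>
    have h : ∀ l m : σ, pderiv l (pderiv m (X k : MvPolynomial σ ℂ)) = 0 := by
      intro l m
      rcases eq_or_ne m k with rfl | hm
      · simp
      · rw [pderiv_X_of_ne hm.symm, map_zero]
    simp only [Derivation.leibniz, map_add, smul_eq_mul, hp, h]
    ring

/-- The gradient of `D` at `p`. -/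
def grad (D : MvPolynomial (Fin 3) ℂ) (p : Fin 3 → ℂ) : Fin 3 → ℂ := fun i => eval p (pderiv i D)

/-- The Hessian matrix of `D` at `p`. -/
def hess (D : MvPolynomial (Fin 3) ℂ) (p : Fin 3 → ℂ) : Matrix (Fin 3) (Fin 3) ℂ :=
  Matrix.of fun i j => eval p (pderiv i (pderiv j D))

theorem hess_transpose (D : MvPolynomial (Fin 3) ℂ) (p : Fin 3 → ℂ) :
    (hess D p).transpose = hess D p := by
  ext i j
  simp [hess, pderiv_comm i j]

theorem IsHomogeneous.dotProduct_grad {n : ℕ} {D : MvPolynomial (Fin 3) ℂ}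
    (hD : D.IsHomogeneous n) (p : Fin 3 → ℂ) : p ⬝ᵥ grad D p = n * eval p D := by
  have := congrArg (eval p) hD.sum_X_mul_pderiv
  simpa [dotProduct, grad] using this

theorem IsHomogeneous.vecMul_hess {n : ℕ} {D : MvPolynomial (Fin 3) ℂ}
    (hD : D.IsHomogeneous n) (p : Fin 3 → ℂ) :
    Matrix.vecMul p (hess D p) = ((n - 1 : ℕ) : ℂ) • grad D p := by
  funext j
  exact IsHomogeneous.dotProduct_grad (hD.pderiv (i := j)) p

theorem IsHomogeneous.grad_smul {n : ℕ} {D : MvPolynomial (Fin 3) ℂ}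
    (hD : D.IsHomogeneous n) (a : ℂ) (p : Fin 3 → ℂ) :
    grad D (a • p) = a ^ (n - 1) • grad D p := by
  funext i
  exact IsHomogeneous.eval_smul hD.pderiv a p

theorem IsHomogeneous.hess_smul {n : ℕ} {D : MvPolynomial (Fin 3) ℂ}
    (hD : D.IsHomogeneous n) (a : ℂ) (p : Fin 3 → ℂ) :
    hess D (a • p) = a ^ (n - 2) • hess D p := by
  ext i j
  exact IsHomogeneous.eval_smul hD.pderiv.pderiv a p

/-- The derivative of the parametrization at the parameter `z`. -/
def dpt (φ : Fin 3 → Polynomial ℂ) (z : ℂ) : Fin 3 → ℂ :=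
  fun i => (Polynomial.derivative (φ i)).eval z

theorem derivative_aeval_eval (φ : Fin 3 → Polynomial ℂ) (D : MvPolynomial (Fin 3) ℂ) (z : ℂ) :
    (Polynomial.derivative (aeval φ D)).eval z = grad D (pt φ z) ⬝ᵥ dpt φ z := by
  rw [derivative_aeval_polynomial, Polynomial.eval_finsetSum]
  refine Finset.sum_congr rfl fun i _ => ?_
  rw [Polynomial.eval_mul, eval_aeval_polynomial]
  rfl

theorem derivative_derivative_aeval_eval (φ : Fin 3 → Polynomial ℂ) (D : MvPolynomial (Fin 3) ℂ)
    (z : ℂ) (h : grad D (pt φ z) = 0) :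
    (Polynomial.derivative (Polynomial.derivative (aeval φ D))).eval z =
      dpt φ z ⬝ᵥ (hess D (pt φ z)).mulVec (dpt φ z) := by
  rw [derivative_aeval_polynomial, Polynomial.derivative_sum, Polynomial.eval_finsetSum]
  have h1 : ∀ i, (Polynomial.derivative (aeval φ (pderiv i D) *
      Polynomial.derivative (φ i))).eval z =
      (grad (pderiv i D) (pt φ z) ⬝ᵥ dpt φ z) * dpt φ z i := by
    intro i
    have h2 : (aeval φ (pderiv i D)).eval z = 0 := by
      rw [eval_aeval_polynomial]
      exact congrFun h i
    rw [Polynomial.derivative_mul, Polynomial.eval_add, Polynomial.eval_mul, Polynomial.eval_mul,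
      h2, zero_mul, add_zero, derivative_aeval_eval]
    rfl
  rw [Finset.sum_congr rfl fun i _ => h1 i]
  simp only [dotProduct, Matrix.mulVec, hess, grad, Matrix.of_apply, Finset.sum_mul,
    Finset.mul_sum]
  refine Finset.sum_congr rfl fun i _ => Finset.sum_congr rfl fun j _ => ?_
  rw [pderiv_comm i j]
  ring

theorem X_sq_dvd_iff {q : Polynomial ℂ} :
    Polynomial.X ^ 2 ∣ q ↔ q.eval 0 = 0 ∧ (Polynomial.derivative q).eval 0 = 0 := by
  rw [Polynomial.X_pow_dvd_iff, ← Polynomial.coeff_zero_eq_eval_zero,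
    ← Polynomial.coeff_zero_eq_eval_zero, Polynomial.coeff_derivative]
  constructor
  · exact fun h => ⟨h 0 (by omega), by rw [h 1 (by omega), zero_mul]⟩
  · intro h d hd
    interval_cases d
    · exact h.1
    · simpa using h.2

theorem X_cube_dvd_of {q : Polynomial ℂ} (h0 : q.eval 0 = 0)
    (h1 : (Polynomial.derivative q).eval 0 = 0)
    (h2 : (Polynomial.derivative (Polynomial.derivative q)).eval 0 = 0) :
    Polynomial.X ^ 3 ∣ q := by
  rw [← Polynomial.coeff_zero_eq_eval_zero] at h0 h1 h2
  rw [Polynomial.coeff_derivative] at h1 h2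
  rw [Polynomial.coeff_derivative] at h2
  rw [Polynomial.X_pow_dvd_iff]
  intro d hd
  interval_cases d
  · exact h0
  · simpa using h1
  · rcases mul_eq_zero.mp h2 with h2 | h2
    · rcases mul_eq_zero.mp h2 with h2 | h2
      · exact h2
      · norm_num at h2
    · norm_num at h2

theorem pt_line (p w : Fin 3 → ℂ) :
    pt (fun i => Polynomial.C (p i) + Polynomial.X * Polynomial.C (w i)) 0 = p := by
  funext i
  simp [pt]

theorem X_sq_dvd_restrictLine {p : Fin 3 → ℂ} {D : MvPolynomial (Fin 3) ℂ} (h0 : eval p D = 0)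
    (h1 : grad D p = 0) (w : Fin 3 → ℂ) : Polynomial.X ^ 2 ∣ restrictLine p w D := by
  refine X_sq_dvd_iff.mpr ⟨?_, ?_⟩
  · rw [eval_restrictLine]
    simpa using h0
  · rw [restrictLine, derivative_aeval_eval, pt_line, h1, zero_dotProduct]

theorem X_cube_dvd_restrictLine {p : Fin 3 → ℂ} {D : MvPolynomial (Fin 3) ℂ} (h0 : eval p D = 0)
    (h1 : grad D p = 0) (h2 : hess D p = 0) (w : Fin 3 → ℂ) :
    Polynomial.X ^ 3 ∣ restrictLine p w D := by
  refine X_cube_dvd_of ?_ ?_ ?_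
  · rw [eval_restrictLine]
    simpa using h0
  · rw [restrictLine, derivative_aeval_eval, pt_line, h1, zero_dotProduct]
  · rw [restrictLine, derivative_derivative_aeval_eval _ _ _ (by rw [pt_line, h1]), pt_line, h2,
      Matrix.zero_mulVec, dotProduct_zero]

/-- Coordinates in which the point `q` is `(1 : 0 : 0)` and the line `l` through `q` is the line
where the last coordinate vanishes. -/
theorem exists_linearEquiv_of_dotProduct_eq_zero {q l : Fin 3 → ℂ} (hq : q ≠ 0) (hl : l ≠ 0)
    (hlq : l ⬝ᵥ q = 0) :
    ∃ M : (Fin 3 → ℂ) ≃ₗ[ℂ] (Fin 3 → ℂ), M q = Pi.single 0 1 ∧ ∀ x, M x 2 = l ⬝ᵥ x := by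
  obtain ⟨x, hx⟩ : ∃ x : Fin 3 → ℂ, q ⬝ᵥ x = 1 := by
    obtain ⟨i, hi⟩ := Function.ne_iff.mp hq
    exact ⟨Pi.single i (q i)⁻¹, by simpa using mul_inv_cancel₀ hi⟩
  obtain ⟨w, hw⟩ : ∃ w : Fin 3 → ℂ, l ⬝ᵥ w = 1 := by
    obtain ⟨i, hi⟩ := Function.ne_iff.mp hl
    exact ⟨Pi.single i (l i)⁻¹, by simpa using mul_inv_cancel₀ hi⟩
  let A : Matrix (Fin 3) (Fin 3) ℂ := (Matrix.of ![q, crossProduct l x, w]).transpose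
  have hdet : A.det = 1 := by
    rw [Matrix.det_transpose, Matrix.det_fin_three]
    simp only [dotProduct, Fin.sum_univ_three] at hx hw hlq
    simp [cross_apply]
    linear_combination (l 0 * w 0 + l 1 * w 1 + l 2 * w 2) * hx + hw -
      (w 0 * x 0 + w 1 * x 1 + w 2 * x 2) * hlq
  let e := Matrix.toLinearEquiv' A (Matrix.invertibleOfIsUnitDet A (by simp [hdet]))
  have he : ∀ y, e y = A.mulVec y := fun y => rfl
  refine ⟨e.symm, ?_, fun y => ?_⟩
  · rw [LinearEquiv.symm_apply_eq, he]
    ext i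
    fin_cases i <;> simp [A]
  · obtain ⟨z, rfl⟩ := e.surjective y
    rw [LinearEquiv.symm_apply_apply, he]
    simp only [dotProduct, Fin.sum_univ_three] at hx hw hlq ⊢
    simp [A, Matrix.mulVec, cross_apply, Fin.sum_univ_three, dotProduct]
    linear_combination -(z 0) * hlq - (z 2) * hw

namespace IsTenNodalParam

variable {φ : Fin 3 → Polynomial ℂ} {u v : Fin 10 → ℂ}

/-- The branches of the curve at a double point are immersed, and their tangents differ. -/
theorem det_tangents_ne_zero (h : IsTenNodalParam φ u v) (k : Fin 10) {q : Fin 3 → ℂ}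
    (hq : q ≠ 0) (hqk : crossProduct q (pt φ (u k)) = 0) :
    (Matrix.of ![q, dpt φ (u k), dpt φ (v k)]).det ≠ 0 := by
  intro h0
  obtain ⟨l, hl, hAl⟩ := Matrix.exists_mulVec_eq_zero_iff.mpr h0
  have h1 : q ⬝ᵥ l = 0 := congrFun hAl 0
  have h2 : dpt φ (u k) ⬝ᵥ l = 0 := congrFun hAl 1
  have h3 : dpt φ (v k) ⬝ᵥ l = 0 := congrFun hAl 2
  obtain ⟨M, hMq, hM⟩ := exists_linearEquiv_of_dotProduct_eq_zero hq hl
    ((dotProduct_comm _ _).trans h1)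
  have hd : ∀ z, (Polynomial.derivative (linComp M.toLinearMap φ 2)).eval z =
      l ⬝ᵥ dpt φ z := by
    intro z
    rw [← hM]
    have := congrFun (eval_linComp_polynomial M.toLinearMap
      (fun i => Polynomial.derivative (φ i)) z) 2
    refine Eq.trans ?_ this
    congr 1
    simp only [linComp, Polynomial.derivative_sum]
    exact Finset.sum_congr rfl fun j _ => Polynomial.derivative_C_mul _ _
  have hsq : ∀ z, crossProduct q (pt φ z) = 0 → dpt φ z ⬝ᵥ l = 0 →
      (Polynomial.X - Polynomial.C z) ^ 2 ∣ linComp M.toLinearMap φ 2 := by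
    intro z hz hz'
    have hne := (h.map M).coord_ne_zero 2
    rw [← Polynomial.le_rootMultiplicity_iff hne]
    refine (Polynomial.one_lt_rootMultiplicity_iff_isRoot hne).mpr ⟨?_, ?_⟩
    · rw [← cross_map_eq_zero M, hMq, ← pt_linComp, cross_single_zero_eq_zero] at hz
      exact hz.2
    · exact (hd z).trans ((dotProduct_comm _ _).trans hz')
  refine (h.map M).not_sq_dvd k ?_ ?_
  · rw [← hMq, pt_linComp, cross_map_eq_zero]
    exact hqk
  · rw [mul_pow]
    refine IsCoprime.mul_dvd (IsCoprime.pow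
      (Polynomial.isCoprime_X_sub_C_of_isUnit_sub (sub_ne_zero.mpr (h.ne k)).isUnit))
      (hsq _ hqk h2) (hsq _ ?_ h3)
    exact cross_eq_zero_trans (h.pt_ne_zero _) hqk (h.cross_eq_zero k)

/-- The sextic is singular at a double point: its gradient is orthogonal to the point and to the
tangents of the two branches, which span the space. -/
theorem grad_eq_zero (h : IsTenNodalParam φ u v) {D : MvPolynomial (Fin 3) ℂ}
    (hD : D.IsHomogeneous 6) (hφ : aeval φ D = 0) (k : Fin 10) {q : Fin 3 → ℂ}
    (hq : q ≠ 0) (hqk : crossProduct q (pt φ (u k)) = 0) (hDq : eval q D = 0) :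
    grad D q = 0 := by
  refine Matrix.eq_zero_of_mulVec_eq_zero (h.det_tangents_ne_zero k hq hqk) ?_
  have key : ∀ z, crossProduct q (pt φ z) = 0 → dpt φ z ⬝ᵥ grad D q = 0 := by
    intro z hz
    obtain ⟨a, ha⟩ := exists_smul_of_cross_eq_zero hq hz
    have ha0 : a ≠ 0 := by
      rintro rfl
      exact h.pt_ne_zero z (by rw [ha, zero_smul])
    have h1 := derivative_aeval_eval φ D z
    rw [hφ, Polynomial.derivative_zero, Polynomial.eval_zero, ha, IsHomogeneous.grad_smul hD,
      smul_dotProduct, smul_eq_mul, eq_comm, mul_eq_zero] at h1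
    rw [dotProduct_comm]
    exact h1.resolve_left (pow_ne_zero _ ha0)
  funext i
  fin_cases i
  · exact (IsHomogeneous.dotProduct_grad hD q).trans (by rw [hDq, mul_zero]; rfl)
  · exact key _ hqk
  · exact key _ (cross_eq_zero_trans (h.pt_ne_zero _) hqk (h.cross_eq_zero k))

/-- A double point is a node of the sextic: the Hessian is not zero, since the multiplicity is two,
and in the basis consisting of the point and the tangents of the two branches it is a multiple of
a hyperbolic plane, because the point lies in its kernel and the tangents are isotropic. -/
theorem rank_hess (h : IsTenNodalParam φ u v) {D : MvPolynomial (Fin 3) ℂ}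
    (hD : D.IsHomogeneous 6) (hD0 : D ≠ 0) (hφ : aeval φ D = 0) (k : Fin 10) {q : Fin 3 → ℂ}
    (hq : q ≠ 0) (hqk : crossProduct q (pt φ (u k)) = 0) (hDq : eval q D = 0) :
    (hess D q).rank = 2 := by
  have hg := h.grad_eq_zero hD hφ k hq hqk hDq
  set A := Matrix.of ![q, dpt φ (u k), dpt φ (v k)] with hA
  have hdet := h.det_tangents_ne_zero k hq hqk
  rw [← hA] at hdet
  have hH0 : hess D q ≠ 0 := by
    intro h0
    have := h.order_add_card_le hD hD0 hφ hq (k := 3)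
      (fun w => X_cube_dvd_restrictLine hDq hg h0 w) (Finset.univ.erase k) (fun i hi h1 =>
        h.cross_ne_zero i k (Finset.ne_of_mem_erase hi)
          (cross_eq_zero_trans hq (cross_eq_zero_symm h1) hqk))
    rw [Finset.card_erase_of_mem (Finset.mem_univ _)] at this
    simp at this
  have hqH : Matrix.vecMul q (hess D q) = 0 := by
    rw [IsHomogeneous.vecMul_hess hD, hg, smul_zero]
  have hHq : (hess D q).mulVec q = 0 := by
    rw [← hess_transpose, Matrix.mulVec_transpose, hqH]
  -- the tangent directions of the branches are isotropic for the Hessian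
  have key : ∀ z, crossProduct q (pt φ z) = 0 →
      dpt φ z ⬝ᵥ (hess D q).mulVec (dpt φ z) = 0 := by
    intro z hz
    obtain ⟨a, ha⟩ := exists_smul_of_cross_eq_zero hq hz
    have ha0 : a ≠ 0 := by
      rintro rfl
      exact h.pt_ne_zero z (by rw [ha, zero_smul])
    have h1 := derivative_derivative_aeval_eval φ D z
      (by rw [ha, IsHomogeneous.grad_smul hD, hg, smul_zero])
    rw [hφ, Polynomial.derivative_zero, Polynomial.derivative_zero, Polynomial.eval_zero, ha,
      IsHomogeneous.hess_smul hD, Matrix.smul_mulVec, dotProduct_smul, smul_eq_mul, eq_comm,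
      mul_eq_zero] at h1
    exact h1.resolve_left (pow_ne_zero _ ha0)
  have hB : ∀ i j, (A * hess D q * A.transpose) i j = A i ⬝ᵥ (hess D q).mulVec (A j) := by
    intro i j
    rw [Matrix.mul_assoc, Matrix.mul_apply]
    rfl
  have hA0 : A 0 = q := rfl
  have hA1 : A 1 = dpt φ (u k) := rfl
  have hA2 : A 2 = dpt φ (v k) := rfl
  set b := dpt φ (u k) ⬝ᵥ (hess D q).mulVec (dpt φ (v k)) with hb
  have hb' : dpt φ (v k) ⬝ᵥ (hess D q).mulVec (dpt φ (u k)) = b := by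
    rw [hb, Matrix.dotProduct_mulVec, ← Matrix.mulVec_transpose, hess_transpose, dotProduct_comm]
  have hvk := cross_eq_zero_trans (h.pt_ne_zero _) hqk (h.cross_eq_zero k)
  have hBe : A * hess D q * A.transpose =
      Matrix.diagonal ![0, b, b] * !![1, 0, 0; 0, 0, 1; 0, 1, 0] := by
    ext i j
    rw [hB]
    fin_cases i <;> fin_cases j <;>
      simp [hA0, hA1, hA2, hHq, ← hb, hb', key _ hqk, key _ hvk, Matrix.dotProduct_mulVec q, hqH]
  have hrank : (hess D q).rank = (A * hess D q * A.transpose).rank := by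
    rw [Matrix.rank_mul_eq_left_of_det_ne_zero _ _ (by rwa [Matrix.det_transpose]),
      Matrix.rank_mul_eq_right_of_det_ne_zero _ _ hdet]
  have hb0 : b ≠ 0 := by
    intro h0
    have h3 : (![0, 0, 0] : Fin 3 → ℂ) = 0 := by simp
    rw [h0, h3, Matrix.diagonal_zero', Matrix.zero_mul] at hBe
    have hA' : IsUnit A := (Matrix.isUnit_iff_isUnit_det A).mpr hdet.isUnit
    exact hH0 (hA'.mul_right_eq_zero.mp
      (((Matrix.isUnit_transpose A).mpr hA').mul_left_eq_zero.mp hBe))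
  rw [hrank, hBe, Matrix.rank_mul_eq_left_of_det_ne_zero _ _ (by simp [Matrix.det_fin_three]),
    Matrix.rank_diagonal, Fintype.card_subtype]
  have : (Finset.univ.filter fun i : Fin 3 => (![0, b, b] : Fin 3 → ℂ) i ≠ 0) = {1, 2} := by
    ext i
    fin_cases i <;> simp [hb0]
  rw [this]
  rfl

/-- The key criterion: a sextic containing a curve with ten double points as above is integral,
and exactly these points are singular; they are nodes. -/
theorem isIntegralTenNodalSextic (h : IsTenNodalParam φ u v) {D : MvPolynomial (Fin 3) ℂ}
    (hD : D.IsHomogeneous 6) (hD0 : D ≠ 0) (hφ : aeval φ D = 0) : IsIntegralTenNodalSextic D := by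
  have hmem : ∀ p : ℙ ℂ (Fin 3 → ℂ), p ∈ singularPoints D ↔
      eval p.rep D = 0 ∧ grad D p.rep = 0 := fun p => by
    rw [funext_iff]
    rfl
  have hex : ∀ p : ℙ ℂ (Fin 3 → ℂ), p ∈ singularPoints D →
      ∃ k, crossProduct p.rep (pt φ (u k)) = 0 := by
    intro p hp
    rw [hmem] at hp
    by_contra! hno
    have := h.order_add_card_le hD hD0 hφ p.rep_nonzero (k := 2)
      (fun w => X_sq_dvd_restrictLine hp.1 hp.2 w) Finset.univ (fun i _ => hno i)
    simp at this
  have hinj : Function.Injective fun k => Projectivization.mk ℂ _ (h.pt_ne_zero (u k)) := by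
    intro i j hij
    by_contra hne
    exact h.cross_ne_zero i j hne
      ((Projectivization.mk_eq_mk_iff_crossProduct_eq_zero _ _).mp hij)
  have hset : singularPoints D =
      Set.range fun k => Projectivization.mk ℂ _ (h.pt_ne_zero (u k)) := by
    ext p
    constructor
    · intro hp
      obtain ⟨k, hk⟩ := hex p hp
      refine ⟨k, ?_⟩
      rw [← p.mk_rep]
      exact (Projectivization.mk_eq_mk_iff_crossProduct_eq_zero _ _).mpr (cross_eq_zero_symm hk)
    · rintro ⟨k, rfl⟩
      set p := Projectivization.mk ℂ _ (h.pt_ne_zero (u k)) with hp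
      have hk : crossProduct p.rep (pt φ (u k)) = 0 := by
        rw [← Projectivization.mk_eq_mk_iff_crossProduct_eq_zero p.rep_nonzero
          (h.pt_ne_zero (u k)), p.mk_rep]
      have h0 := (h.eval_eq_zero_iff hD hD0 hφ p.rep_nonzero).mpr (Or.inl ⟨_, hk⟩)
      exact (hmem p).mpr ⟨h0, h.grad_eq_zero hD hφ k p.rep_nonzero hk h0⟩
  refine ⟨hD, h.irreducible hD hD0 hφ, ?_, fun p hp => ⟨hp, ?_⟩⟩
  · rw [hset, ← Set.image_univ, hinj.encard_image, Set.encard_univ]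
    simp
  · obtain ⟨k, hk⟩ := hex p hp
    exact h.rank_hess hD hD0 hφ k p.rep_nonzero hk hp.1

end IsTenNodalParam

/-! ### Specialization of one-parameter families -/

/-- If the members of a finite family of polynomials over `ℂ[t]` become linearly dependent for
infinitely many values of `t`, then they satisfy a linear relation over `ℂ[t]` none of whose
specializations is trivial. -/
theorem exists_primitive_relation {ι : Type*} [Fintype ι] (g : ι → Polynomial (Polynomial ℂ))
    (hinf : {t : ℂ | ∃ c : ι → ℂ, c ≠ 0 ∧
      ∑ i, c i • (g i).map (Polynomial.evalRingHom t) = 0}.Infinite) :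
    ∃ x : ι → Polynomial ℂ, (∀ t, (fun i => (x i).eval t) ≠ 0) ∧
      ∑ i, Polynomial.C (x i) * g i = 0 := by
  classical
  -- if the family were independent, its matrix of coefficients would have a left inverse over
  -- `ℂ(t)`, and the specializations would be independent off the zeros of a common denominator
  have hdep : ¬ LinearIndependent (Polynomial ℂ) g := by
    intro hli
    let N := Finset.univ.sup (fun i => (g i).natDegree) + 1
    let K := FractionRing (Polynomial ℂ)
    let A : Matrix (Fin N) ι (Polynomial ℂ) := Matrix.of fun n i => (g i).coeff n
    have hcoeff : ∀ x : ι → Polynomial ℂ, A.mulVec x = 0 → x = 0 := by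
      intro x hx
      rw [Fintype.linearIndependent_iff] at hli
      refine funext (hli x ?_)
      ext1 n
      rw [Polynomial.finsetSum_coeff, Polynomial.coeff_zero]
      by_cases hn : n < N
      · have := congrFun hx ⟨n, hn⟩
        simp only [A, Matrix.mulVec, dotProduct, Matrix.of_apply, Pi.zero_apply] at this
        rw [← this]
        exact Finset.sum_congr rfl fun i _ => by rw [Polynomial.coeff_smul, smul_eq_mul, mul_comm]
      · refine Finset.sum_eq_zero fun i _ => ?_
        rw [Polynomial.coeff_smul, Polynomial.coeff_eq_zero_of_natDegree_lt, smul_zero]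
        have : (g i).natDegree ≤ Finset.univ.sup (fun i => (g i).natDegree) :=
          Finset.le_sup (f := fun i => (g i).natDegree) (Finset.mem_univ i)
        omega
    have hinj : Function.Injective (A.map (algebraMap _ K)).mulVecLin := by
      rw [injective_iff_map_eq_zero]
      intro y hy
      obtain ⟨b, hb⟩ := IsLocalization.exist_integer_multiples_of_finset
        (nonZeroDivisors (Polynomial ℂ)) (Finset.univ.image y)
      have hb' : ∀ i, ∃ z, algebraMap (Polynomial ℂ) K z = (b : Polynomial ℂ) • y i := fun i =>
        hb (y i) (Finset.mem_image_of_mem _ (Finset.mem_univ i))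
      choose z hz using hb'
      have hz0 : z = 0 := by
        refine hcoeff z (funext fun n => IsFractionRing.injective (Polynomial ℂ) K ?_)
        have := congrFun hy n
        simp only [Matrix.mulVecLin_apply, Matrix.mulVec, dotProduct, Matrix.map_apply,
          Pi.zero_apply] at this ⊢
        rw [map_sum, map_zero]
        calc _ = ∑ i, (b : Polynomial ℂ) • (algebraMap _ K (A n i) * y i) :=
              Finset.sum_congr rfl fun i _ => by rw [map_mul, hz, mul_smul_comm]
          _ = 0 := by rw [← Finset.smul_sum, this, smul_zero]
      funext i
      have h1 := hz i
      rw [hz0, Pi.zero_apply, map_zero, eq_comm, Algebra.smul_def, mul_eq_zero] at h1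
      refine h1.resolve_left fun h2 => nonZeroDivisors.coe_ne_zero b ?_
      exact (map_eq_zero_iff _ (IsFractionRing.injective (Polynomial ℂ) K)).mp h2
    obtain ⟨L, hL⟩ := LinearMap.exists_leftInverse_of_injective _ (LinearMap.ker_eq_bot.mpr hinj)
    let B := LinearMap.toMatrix' L
    have hBA : B * A.map (algebraMap _ K) = 1 := by
      have := congrArg LinearMap.toMatrix' hL
      have hA : LinearMap.toMatrix' (A.map (algebraMap (Polynomial ℂ) K)).mulVecLin =
          A.map (algebraMap (Polynomial ℂ) K) := LinearMap.toMatrix'_toLin' _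
      rwa [LinearMap.toMatrix'_comp, hA, LinearMap.toMatrix'_id] at this
    obtain ⟨d, hd⟩ := IsLocalization.exist_integer_multiples_of_finset
      (nonZeroDivisors (Polynomial ℂ)) (Finset.univ.image fun p : ι × Fin N => B p.1 p.2)
    have hd' : ∀ i n, ∃ z, algebraMap (Polynomial ℂ) K z = (d : Polynomial ℂ) • B i n :=
      fun i n => hd (B i n) (Finset.mem_image_of_mem (fun p : ι × Fin N => B p.1 p.2)
        (Finset.mem_univ (i, n)))
    choose B' hB' using hd'
    have hB'A : ∀ i j, ∑ n, B' i n * A n j = if i = j then (d : Polynomial ℂ) else 0 := by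
      intro i j
      apply IsFractionRing.injective (Polynomial ℂ) K
      have := congrFun (congrFun hBA i) j
      rw [Matrix.mul_apply, Matrix.one_apply] at this
      simp only [Matrix.map_apply] at this
      rw [map_sum]
      calc _ = ∑ n, (d : Polynomial ℂ) • (B i n * algebraMap _ K (A n j)) :=
            Finset.sum_congr rfl fun i _ => by rw [map_mul, hB', smul_mul_assoc]
        _ = _ := by
          rw [← Finset.smul_sum, this]
          split_ifs <;> simp [Algebra.smul_def]
    refine hinf ((Polynomial.finite_setOfPred_isRoot (nonZeroDivisors.coe_ne_zero d)).subset ?_)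
    rintro t ⟨c, hc, hsum⟩
    by_contra hroot
    refine hc (funext fun i => ?_)
    have h1 : ∀ n, ∑ j, c j * ((g j).coeff n).eval t = 0 := by
      intro n
      have := congrArg (fun p => Polynomial.coeff p n) hsum
      simpa [Polynomial.finsetSum_coeff] using this
    have h2 : ∑ j, c j * (∑ n, B' i n * A n j).eval t = 0 := by
      have : ∀ j, c j * (∑ n, B' i n * A n j).eval t
          = ∑ n, (B' i n).eval t * (c j * (A n j).eval t) := by
        intro j
        rw [Polynomial.eval_finsetSum, Finset.mul_sum]
        exact Finset.sum_congr rfl fun n _ => by rw [Polynomial.eval_mul]; ring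
      simp_rw [this]
      rw [Finset.sum_comm]
      refine Finset.sum_eq_zero fun n _ => ?_
      rw [← Finset.mul_sum]
      simp only [A, Matrix.of_apply]
      rw [h1, mul_zero]
    simp_rw [hB'A] at h2
    have h3 : c i * (d : Polynomial ℂ).eval t = 0 := by
      rw [← h2, Finset.sum_eq_single i]
      · simp
      · intro j _ hj
        simp [Ne.symm hj]
      · simp
    exact (mul_eq_zero.mp h3).resolve_right hroot
  rw [Fintype.not_linearIndependent_iff] at hdep
  obtain ⟨x, hx, i₀, hi₀⟩ := hdep
  -- divide the relation by the greatest common divisor of its coefficients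
  let I := Ideal.span (Set.range x)
  obtain ⟨d, hd⟩ : ∃ d, I = Ideal.span {d} :=
    ⟨_, (Ideal.span_singleton_generator I).symm⟩
  have hdvd : ∀ i, ∃ y, x i = d * y := fun i => by
    have : x i ∈ I := Ideal.subset_span ⟨i, rfl⟩
    rwa [hd, Ideal.mem_span_singleton] at this
  choose y hy using hdvd
  have hd0 : d ≠ 0 := fun h => hi₀ (by rw [hy, h, zero_mul])
  have hdI : d ∈ I := hd ▸ Ideal.mem_span_singleton_self d
  obtain ⟨a, ha⟩ := Ideal.mem_span_range_iff_exists_fun.mp hdI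
  have hbez : ∑ i, a i * y i = 1 := by
    apply mul_left_cancel₀ hd0
    rw [mul_one, Finset.mul_sum]
    conv_rhs => rw [← ha]
    exact Finset.sum_congr rfl fun i _ => by rw [hy]; ring
  refine ⟨y, fun t ht => ?_, ?_⟩
  · have := congrArg (Polynomial.eval t) hbez
    rw [Polynomial.eval_finsetSum, Polynomial.eval_one] at this
    refine zero_ne_one (this ▸ (Finset.sum_eq_zero fun i _ => ?_).symm)
    rw [Polynomial.eval_mul]
    have := congrFun ht i
    simp only [Pi.zero_apply] at this
    rw [this, mul_zero]
  · have h0 : Polynomial.C d * ∑ i, Polynomial.C (y i) * g i = 0 := by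
      rw [← hx, Finset.mul_sum]
      refine Finset.sum_congr rfl fun i _ => ?_
      rw [hy, Polynomial.smul_eq_C_mul, Polynomial.C_mul, mul_assoc]
    exact (mul_eq_zero.mp h0).resolve_left (by simpa using hd0)

/-- The specialization of a family of polynomials over `ℂ[t]` at a value of `t`. -/
def specialize {σ : Type*} (t : ℂ) (p : MvPolynomial σ (Polynomial ℂ)) : MvPolynomial σ ℂ :=
  map (Polynomial.evalRingHom t) p

/-- A family of equations over `ℂ[t]` has a common zero at `t` exactly if its zero locus has a point
over `t`, by the Nullstellensatz for the fibre. -/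
theorem exists_common_zero_iff {σ : Type*} [Finite σ] (S : Set (MvPolynomial σ (Polynomial ℂ)))
    (t : ℂ) : (∃ z : σ → ℂ, ∀ p ∈ S, eval z (specialize t p) = 0) ↔
      ∃ q ∈ PrimeSpectrum.zeroLocus S, (PrimeSpectrum.comap C q).asIdeal =
        RingHom.ker (Polynomial.evalRingHom t) := by
  constructor
  · rintro ⟨z, hz⟩
    let f : MvPolynomial σ (Polynomial ℂ) →+* ℂ := (eval z).comp (map (Polynomial.evalRingHom t))
    refine ⟨⟨RingHom.ker f, RingHom.ker_isPrime f⟩, fun p hp => hz p hp, ?_⟩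
    ext r
    simp [f]
  · rintro ⟨q, hq, hqt⟩
    let f : MvPolynomial σ (Polynomial ℂ) →+* MvPolynomial σ ℂ := map (Polynomial.evalRingHom t)
    have hf : Function.Surjective f := map_surjective _ fun a => ⟨Polynomial.C a, by simp⟩
    have hker : RingHom.ker f ≤ q.asIdeal := by
      intro p hp
      rw [p.as_sum]
      refine Ideal.sum_mem _ fun m _ => ?_
      rw [← mul_one (coeff m p), ← C_mul_monomial]
      refine Ideal.mul_mem_right _ _ ?_
      have h1 : coeff m p ∈ (PrimeSpectrum.comap C q).asIdeal := by
        rw [hqt, RingHom.mem_ker, ← coeff_map]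
        change coeff m (f p) = 0
        rw [RingHom.mem_ker.mp hp, coeff_zero]
      exact h1
    have hne : Ideal.map f q.asIdeal ≠ ⊤ := by
      have := Ideal.map_isPrime_of_surjective hf hker
      exact this.ne_top
    by_contra! hno
    have hempty : zeroLocus ℂ (Ideal.map f q.asIdeal) = ∅ := by
      refine Set.eq_empty_of_forall_notMem fun z hz => ?_
      obtain ⟨p, hp, hpz⟩ := hno z
      exact hpz (hz (f p) (Ideal.mem_map_of_mem f (hq hp)))
    have h1 := vanishingIdeal_zeroLocus_eq_radical (k := ℂ) (K := ℂ) (Ideal.map f q.asIdeal)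
    rw [hempty, vanishingIdeal_empty, eq_comm, Ideal.radical_eq_top] at h1
    exact hne h1

/-- A system of polynomial equations over `ℂ[t]` with a solution for infinitely many values of
`t` has one outside the zeros of a nonzero polynomial: the set of values is constructible. -/
theorem exists_forall_common_zero {σ : Type*} [Finite σ]
    (S : Set (MvPolynomial σ (Polynomial ℂ))) (hS : S.Finite)
    (hinf : {t : ℂ | ∃ z : σ → ℂ, ∀ p ∈ S, eval z (specialize t p) = 0}.Infinite) :
    ∃ f : Polynomial ℂ, f ≠ 0 ∧
      ∀ t, f.eval t ≠ 0 → ∃ z : σ → ℂ, ∀ p ∈ S, eval z (specialize t p) = 0 := by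
  have hfp : (C : Polynomial ℂ →+* MvPolynomial σ (Polynomial ℂ)).FinitePresentation :=
    RingHom.finitePresentation_algebraMap.mpr inferInstance
  have hcl : Topology.IsConstructible (PrimeSpectrum.zeroLocus S) := by
    rw [← Topology.isConstructible_compl]
    exact (PrimeSpectrum.isRetrocompact_zeroLocus_compl hS).isConstructible
      (PrimeSpectrum.isClosed_zeroLocus _).isOpen_compl
  obtain ⟨D, hD⟩ := PrimeSpectrum.exists_constructibleSetData_iff.mpr
    (PrimeSpectrum.isConstructible_comap_image hfp hcl)
  let pt' : ℂ → PrimeSpectrum (Polynomial ℂ) := fun t =>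
    ⟨RingHom.ker (Polynomial.evalRingHom t), RingHom.ker_isPrime _⟩
  have hiff : ∀ t, (∃ z : σ → ℂ, ∀ p ∈ S, eval z (specialize t p) = 0) ↔ pt' t ∈ D.toSet := by
    intro t
    rw [exists_common_zero_iff, hD]
    constructor
    · rintro ⟨q, hq, h⟩
      exact ⟨q, hq, PrimeSpectrum.ext h⟩
    · rintro ⟨q, hq, h⟩
      exact ⟨q, hq, congrArg PrimeSpectrum.asIdeal h⟩
  have hpt : ∀ t (s : Set (Polynomial ℂ)),
      pt' t ∈ PrimeSpectrum.zeroLocus s ↔ ∀ r ∈ s, r.eval t = 0 := fun t s => Iff.rfl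
  have hex : ∃ B ∈ D, {t | pt' t ∈ B.toSet}.Infinite := by
    by_contra! hfin
    refine hinf ((D.finite_toSet.biUnion hfin).subset fun t ht => ?_)
    have := (hiff t).mp ht
    simp only [PrimeSpectrum.ConstructibleSetData.toSet, Set.mem_iUnion, exists_prop] at this
    obtain ⟨B, hB, hBt⟩ := this
    exact Set.mem_biUnion hB hBt
  obtain ⟨B, hB, hBinf⟩ := hex
  have hg : ∀ i, B.g i = 0 := by
    intro i
    by_contra hne
    refine hBinf ((Polynomial.finite_setOfPred_isRoot hne).subset fun t ht => ?_)
    exact (hpt t _).mp ht.1 _ ⟨i, rfl⟩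
  refine ⟨B.f, fun h0 => ?_, fun t ht => ?_⟩
  · obtain ⟨t, ht⟩ := hBinf.nonempty
    exact ht.2 ((hpt t _).mpr (by rintro r rfl; simp [h0]))
  · rw [hiff]
    simp only [PrimeSpectrum.ConstructibleSetData.toSet, Set.mem_iUnion, exists_prop]
    refine ⟨B, hB, (hpt t _).mpr ?_, fun h => ht ((hpt t _).mp h _ rfl)⟩
    rintro r ⟨i, rfl⟩
    simp [hg]

/-! ### The hexagonal toric surface -/

/-- The equations of the sextic del Pezzo surface in toric coordinates: the coordinates `0, …, 5`
belong to the vertices of a hexagon in cyclic order, the coordinate `6` to its centre. -/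
structure HexEq {R : Type*} [CommRing R] (v : Fin 7 → R) : Prop where
  e0 : v 5 * v 1 = v 0 * v 6
  e1 : v 0 * v 2 = v 1 * v 6
  e2 : v 1 * v 3 = v 2 * v 6
  e3 : v 2 * v 4 = v 3 * v 6
  e4 : v 3 * v 5 = v 4 * v 6
  e5 : v 4 * v 0 = v 5 * v 6
  d0 : v 0 * v 3 = v 6 ^ 2
  d1 : v 1 * v 4 = v 6 ^ 2
  d2 : v 2 * v 5 = v 6 ^ 2

/-- The cone over the toric sextic del Pezzo surface, without its vertex. -/
def hexCone : Set (Fin 7 → ℂ) := {v | v ≠ 0 ∧ HexEq v}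

/-- The seven cubic monomials vanishing at the three coordinate points. -/
def hexCubic {R : Type*} [CommRing R] (z : Fin 3 → R) : Fin 7 → R :=
  ![z 1 ^ 2 * z 2, z 1 * z 2 ^ 2, z 0 * z 2 ^ 2, z 0 ^ 2 * z 2, z 0 ^ 2 * z 1, z 0 * z 1 ^ 2,
    z 0 * z 1 * z 2]

theorem hexEq_hexCubic {R : Type*} [CommRing R] (z : Fin 3 → R) : HexEq (hexCubic z) := by
  constructor <;> simp [hexCubic] <;> ring

theorem map_hexCubic {R S : Type*} [CommRing R] [CommRing S] (f : R →+* S) (z : Fin 3 → R)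
    (i : Fin 7) : f (hexCubic z i) = hexCubic (fun j => f (z j)) i := by
  fin_cases i <;> simp [hexCubic]

theorem HexEq.smul {v : Fin 7 → ℂ} (h : HexEq v) (c : ℂ) : HexEq (c • v) := by
  obtain ⟨e0, e1, e2, e3, e4, e5, d0, d1, d2⟩ := h
  constructor <;> simp only [Pi.smul_apply, smul_eq_mul]
  · linear_combination c ^ 2 * e0
  · linear_combination c ^ 2 * e1
  · linear_combination c ^ 2 * e2
  · linear_combination c ^ 2 * e3
  · linear_combination c ^ 2 * e4
  · linear_combination c ^ 2 * e5
  · linear_combination c ^ 2 * d0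
  · linear_combination c ^ 2 * d1
  · linear_combination c ^ 2 * d2

/-- Points of the open torus orbit are determined by three coordinates. -/
theorem HexEq.ext_of_ne_zero {v w : Fin 7 → ℂ} (hv : HexEq v) (hw : HexEq w) (h6 : v 6 ≠ 0)
    (h3 : v 3 = w 3) (h4 : v 4 = w 4) (h66 : v 6 = w 6) : v = w := by
  have hv3 : v 3 ≠ 0 := fun h => h6 (by simpa [h] using hv.d0.symm)
  have hv4 : v 4 ≠ 0 := fun h => h6 (by simpa [h] using hv.d1.symm)
  have h0 : v 0 = w 0 := by
    apply mul_right_cancel₀ hv3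
    rw [hv.d0, h3, hw.d0, h66]
  have h1 : v 1 = w 1 := by
    apply mul_right_cancel₀ hv4
    rw [hv.d1, h4, hw.d1, h66]
  have h2 : v 2 = w 2 := by
    apply mul_right_cancel₀ hv4
    rw [hv.e3, h4, hw.e3, h66, h3]
  have h5 : v 5 = w 5 := by
    apply mul_left_cancel₀ hv3
    rw [hv.e4, h3, hw.e4, h66, h4]
  funext i
  fin_cases i <;> assumption

/-- The open torus orbit is the image of the points of the plane off the coordinate triangle. -/
theorem HexEq.exists_eq_hexCubic {v : Fin 7 → ℂ} (hv : HexEq v) (h6 : v 6 ≠ 0) :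
    ∃ z : Fin 3 → ℂ, hexCubic z = v := by
  have hv3 : v 3 ≠ 0 := fun h => h6 (by simpa [h] using hv.d0.symm)
  have hv4 : v 4 ≠ 0 := fun h => h6 (by simpa [h] using hv.d1.symm)
  obtain ⟨c, hc⟩ := IsAlgClosed.exists_pow_nat_eq (v 3 * v 4 / v 6) (n := 3) (by norm_num)
  have hc' : c ^ 3 * v 6 = v 3 * v 4 := by rw [hc]; field_simp
  refine ⟨![c, c * v 6 / v 3, c * v 6 / v 4],
    ((hv.ext_of_ne_zero (hexEq_hexCubic _) h6 ?_ ?_ ?_).symm)⟩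
  · simp only [hexCubic, Matrix.cons_val]
    field_simp
    linear_combination -hc'
  · simp only [hexCubic, Matrix.cons_val]
    field_simp
    linear_combination -hc'
  · simp only [hexCubic, Matrix.cons_val]
    field_simp
    linear_combination -hc'

theorem aeval_hexCubic_X_eval (G : MvPolynomial (Fin 7) ℂ) (z : Fin 3 → ℂ) :
    eval z (aeval (hexCubic (X : Fin 3 → MvPolynomial (Fin 3) ℂ)) G) = eval (hexCubic z) G := by
  have h : (eval z).comp (aeval (hexCubic (X : Fin 3 → MvPolynomial (Fin 3) ℂ)) :
      MvPolynomial (Fin 7) ℂ →ₐ[ℂ] _).toRingHom = eval (hexCubic z) := by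
    refine ringHom_ext (fun r => by simp) fun i => ?_
    rw [RingHom.comp_apply]
    change eval z (aeval _ (X i)) = _
    rw [aeval_X, map_hexCubic, eval_X]
    simp
  exact congrArg (fun f => f G) h

/-- A point of an affine chart of the toric surface is a limit of points of the open orbit. -/
theorem eval_eq_zero_of_chart {G : MvPolynomial (Fin 7) ℂ}
    (hG : ∀ v : Fin 7 → ℂ, HexEq v → v 6 ≠ 0 → eval v G = 0) (c : ℂ → ℂ → Fin 7 → ℂ)
    (hc : Continuous fun r : ℂ × ℂ => c r.1 r.2) (hhex : ∀ a b, HexEq (c a b))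
    (h6 : ∀ a b, a ≠ 0 → b ≠ 0 → c a b 6 ≠ 0) (a b : ℂ) : eval (c a b) G = 0 := by
  have hcont : Continuous fun ε : ℂ => eval (c (a + ε) (b + ε)) G :=
    (MvPolynomial.continuous_eval G).comp
      (hc.comp ((continuous_const.add continuous_id).prodMk (continuous_const.add continuous_id)))
  have hd : Dense ({-a, -b} : Set ℂ)ᶜ := (Set.toFinite {-a, -b}).countable.dense_compl ℂ
  have := congrFun (hcont.ext_on hd (continuous_const (y := (0 : ℂ))) fun ε hε => ?_) 0
  · simpa using this
  · simp only [Set.mem_compl_iff, Set.mem_insert_iff, Set.mem_singleton_iff, not_or] at hε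
    refine hG _ (hhex _ _) (h6 _ _ (fun h => hε.1 ?_) fun h => hε.2 ?_) <;>
      linear_combination h

/-- The symmetry of the hexagon turning it by one step. -/
def hexRotation : Equiv.Perm (Fin 7) where
  toFun := ![1, 2, 3, 4, 5, 0, 6]
  invFun := ![5, 0, 1, 2, 3, 4, 6]
  left_inv := by decide
  right_inv := by decide

theorem HexEq.rotate {v : Fin 7 → ℂ} (h : HexEq v) : HexEq (v ∘ hexRotation) where
  e0 := h.e1
  e1 := h.e2
  e2 := h.e3
  e3 := h.e4
  e4 := h.e5
  e5 := h.e0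
  d0 := h.d1
  d1 := h.d2
  d2 := (mul_comm _ _).trans h.d0

theorem HexEq.rotate_symm {v : Fin 7 → ℂ} (h : HexEq v) : HexEq (v ∘ hexRotation.symm) where
  e0 := h.e5
  e1 := h.e0
  e2 := h.e1
  e3 := h.e2
  e4 := h.e3
  e5 := h.e4
  d0 := (mul_comm _ _).trans h.d2
  d1 := h.d0
  d2 := h.d1

/-- The toric surface is covered by the six affine charts at the vertices of the hexagon, so that
every polynomial vanishing on the open orbit vanishes on it. -/
theorem HexEq.eval_eq_zero {G : MvPolynomial (Fin 7) ℂ}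
    (hG : ∀ v : Fin 7 → ℂ, HexEq v → v 6 ≠ 0 → eval v G = 0) {v : Fin 7 → ℂ} (hv : HexEq v)
    (hv0 : v ≠ 0) : eval v G = 0 := by
  let Vanishes (k : Fin 7) : Prop := ∀ G : MvPolynomial (Fin 7) ℂ,
    (∀ v : Fin 7 → ℂ, HexEq v → v 6 ≠ 0 → eval v G = 0) →
    ∀ v : Fin 7 → ℂ, HexEq v → v k ≠ 0 → eval v G = 0
  have hrot : ∀ k, Vanishes k → Vanishes (hexRotation k) := by
    intro k hk G hG v hv hvk
    have := hk (rename hexRotation.symm G) (fun u hu hu6 => ?_) _ hv.rotate hvk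
    · rw [eval_rename, Function.comp_assoc] at this
      simpa using this
    · rw [eval_rename]
      exact hG _ hu.rotate_symm hu6
  have h0 : Vanishes 0 := by
    intro G hG v hv hi
    by_cases h6 : v 6 ≠ 0
    · exact hG v hv h6
    rw [not_not] at h6
    obtain ⟨e0, e1, e2, e3, e4, e5, d0, d1, d2⟩ := hv
    let c : ℂ → ℂ → Fin 7 → ℂ := fun a b => v 0 •
      ![1, a, a ^ 2 * b, a ^ 2 * b ^ 2, a * b ^ 2, b, a * b]
    have : c (v 1 / v 0) (v 5 / v 0) = v := by
      funext j
      fin_cases j <;> simp [c] <;> field_simp <;> grind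
    rw [← this]
    refine eval_eq_zero_of_chart hG c (by fun_prop) (fun a b => ?_) (fun a b ha hb => ?_) _ _
    · constructor <;> simp [c] <;> ring
    · simpa [c, ha, hb] using hi
  have h1 : Vanishes 1 := hrot 0 h0
  have h2 : Vanishes 2 := hrot 1 h1
  have h3 : Vanishes 3 := hrot 2 h2
  have h4 : Vanishes 4 := hrot 3 h3
  have h5 : Vanishes 5 := hrot 4 h4
  obtain ⟨i, hi⟩ := Function.ne_iff.mp hv0
  fin_cases i
  · exact h0 G hG v hv hi
  · exact h1 G hG v hv hi
  · exact h2 G hG v hv hi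
  · exact h3 G hG v hv hi
  · exact h4 G hG v hv hi
  · exact h5 G hG v hv hi
  · exact hG v hv hi

/-- The equations of the toric surface define the closure of the image of the plane under the cubics
through the three coordinate points. -/
theorem mem_hexCone_iff {v : Fin 7 → ℂ} : v ∈ hexCone ↔ v ≠ 0 ∧ ∀ G : MvPolynomial (Fin 7) ℂ,
    aeval (hexCubic (X : Fin 3 → MvPolynomial (Fin 3) ℂ)) G = 0 → eval v G = 0 := by
  refine and_congr_right fun hv0 => ⟨fun hv G hG => hv.eval_eq_zero (fun u hu hu6 => ?_) hv0,
    fun h => ?_⟩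
  · obtain ⟨z, rfl⟩ := hu.exists_eq_hexCubic hu6
    rw [← aeval_hexCubic_X_eval, hG, map_zero]
  · have hX := hexEq_hexCubic (X : Fin 3 → MvPolynomial (Fin 3) ℂ)
    have key : ∀ a b c d : Fin 7, hexCubic (X : Fin 3 → MvPolynomial (Fin 3) ℂ) a * hexCubic X b =
        hexCubic X c * hexCubic X d → v a * v b = v c * v d := by
      intro a b c d habcd
      have := h (X a * X b - X c * X d)
        (by rw [map_sub, map_mul, map_mul, aeval_X, aeval_X, aeval_X, aeval_X, habcd, sub_self])
      rw [map_sub, map_mul, map_mul, eval_X, eval_X, eval_X, eval_X] at this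
      exact sub_eq_zero.mp this
    have key2 : ∀ a b : Fin 7, hexCubic (X : Fin 3 → MvPolynomial (Fin 3) ℂ) a * hexCubic X b =
        hexCubic X 6 ^ 2 → v a * v b = v 6 ^ 2 := by
      intro a b hab
      rw [sq] at hab ⊢
      exact key _ _ _ _ hab
    exact ⟨key _ _ _ _ hX.e0, key _ _ _ _ hX.e1, key _ _ _ _ hX.e2, key _ _ _ _ hX.e3,
      key _ _ _ _ hX.e4, key _ _ _ _ hX.e5, key2 _ _ hX.d0, key2 _ _ hX.d1, key2 _ _ hX.d2⟩

theorem IsHomogeneous.eval_cubic {E : MvPolynomial (Fin 3) ℂ} (hE : E.IsHomogeneous 3) :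
    ∃ c : Fin 10 → ℂ, ∀ z : Fin 3 → ℂ, eval z E = c 0 * z 0 ^ 3 + c 1 * z 1 ^ 3 + c 2 * z 2 ^ 3 +
      (c 3 * (z 1 ^ 2 * z 2) + c 4 * (z 1 * z 2 ^ 2) + c 5 * (z 0 * z 2 ^ 2) +
      c 6 * (z 0 ^ 2 * z 2) + c 7 * (z 0 ^ 2 * z 1) + c 8 * (z 0 * z 1 ^ 2) +
      c 9 * (z 0 * z 1 * z 2)) := by
  let k : (Fin 3 → ℕ) → ℂ := fun m => coeff (Finsupp.equivFunOnFinite.symm m) E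
  refine ⟨![k ![3, 0, 0], k ![0, 3, 0], k ![0, 0, 3], k ![0, 2, 1], k ![0, 1, 2], k ![1, 0, 2],
    k ![2, 0, 1], k ![2, 1, 0], k ![1, 2, 0], k ![1, 1, 1]], fun z => ?_⟩
  have h1 : eval z E = ∑ m ∈ Finset.Nat.antidiagonalTuple 3 3,
      k m * (z 0 ^ m 0 * z 1 ^ m 1 * z 2 ^ m 2) := by
    conv_lhs => rw [IsHomogeneous.eq_formOfCoeffs hE]
    rw [formOfCoeffs, map_sum,
      ← Finset.sum_coe_sort (Finset.Nat.antidiagonalTuple 3 3)]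
    refine Finset.sum_congr rfl fun m _ => ?_
    rw [eval_monomial, Finsupp.prod_fintype _ _ (by simp), Fin.prod_univ_three]
    simp [k]
  have h2 : Finset.Nat.antidiagonalTuple 3 3 = {![3, 0, 0], ![0, 3, 0], ![0, 0, 3], ![0, 2, 1],
    ![0, 1, 2], ![1, 0, 2], ![2, 0, 1], ![2, 1, 0], ![1, 2, 0], ![1, 1, 1]} := by decide
  rw [h1, h2]
  repeat rw [Finset.sum_insert (by decide)]
  rw [Finset.sum_singleton]
  simp
  ring

/-- The cubics through the coordinate points are the combinations of the seven monomials. -/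
theorem IsHomogeneous.eval_eq_sum_hexCubic {E : MvPolynomial (Fin 3) ℂ} (hE : E.IsHomogeneous 3)
    (h0 : ∀ j, eval (Pi.single j 1 : Fin 3 → ℂ) E = 0) :
    ∃ c : Fin 7 → ℂ, ∀ z, eval z E = ∑ j, c j * hexCubic z j := by
  obtain ⟨c, hc⟩ := IsHomogeneous.eval_cubic hE
  have h00 := h0 0
  have h01 := h0 1
  have h02 := h0 2
  rw [hc] at h00 h01 h02
  simp at h00 h01 h02
  refine ⟨![c 3, c 4, c 5, c 6, c 7, c 8, c 9], fun z => ?_⟩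
  rw [hc, h00, h01, h02]
  simp [hexCubic, Fin.sum_univ_seven]

theorem exists_eval_comp (M : Matrix (Fin 7) (Fin 7) ℂ) (G : MvPolynomial (Fin 7) ℂ) :
    ∃ G' : MvPolynomial (Fin 7) ℂ, ∀ v, eval v G' = eval (M.mulVec v) G := by
  refine ⟨bind₁ (fun i => ∑ j, C (M i j) * X j) G, fun v => ?_⟩
  change (eval₂Hom (RingHom.id ℂ) v) _ = _
  rw [eval₂Hom_bind₁]
  change eval _ G = _
  congr 2
  funext i
  simp [Matrix.mulVec, dotProduct, map_sum]

theorem eval_aeval_mvPolynomial {σ : Type*} (b : σ → MvPolynomial (Fin 3) ℂ)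
    (G : MvPolynomial σ ℂ)
    (z : Fin 3 → ℂ) : eval z (aeval b G) = eval (fun i => eval z (b i)) G := by
  induction G using MvPolynomial.induction_on with
  | C a => rw [aeval_C, algebraMap_eq, eval_C, eval_C]
  | add p q hp hq => rw [map_add, map_add, map_add, hp, hq]
  | mul_X p i hp => rw [map_mul, map_mul, map_mul, hp, aeval_X, eval_X]

/-- All smooth sextic del Pezzo surfaces are projectively equivalent to the toric one. -/
theorem IsSexticDelPezzo.exists_linearEquiv {S : Set (Fin 7 → ℂ)} (hS : IsSexticDelPezzo S) :
    ∃ M : (Fin 7 → ℂ) ≃ₗ[ℂ] (Fin 7 → ℂ), S = M '' hexCone := by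
  obtain ⟨e, b, he, hb, hcub, rfl⟩ := hS
  let B := basisOfLinearIndependentOfCardEqFinrank he (by simp)
  have hB : ∀ j, B j = e j := fun j => by simp [B]
  let g : (Fin 3 → ℂ) ≃ₗ[ℂ] (Fin 3 → ℂ) := B.equivFun.symm
  have hg : ∀ j, g (Pi.single j 1) = e j := fun j => by
    rw [← hB]
    simp [g, Module.Basis.equivFun_symm_apply, Pi.single_apply]
  have hc : ∀ i, ∃ c : Fin 7 → ℂ, ∀ z, eval (g z) (b i) = ∑ j, c j * hexCubic z j := by
    intro i
    obtain ⟨c, hc⟩ := IsHomogeneous.eval_eq_sum_hexCubic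
      (isHomogeneous_subst g.toLinearMap (hcub i).1) fun j => by
        rw [eval_subst, LinearEquiv.coe_coe, hg, (hcub i).2]
    exact ⟨c, fun z => by rw [← hc z, eval_subst, LinearEquiv.coe_coe]⟩
  choose m hm using hc
  let M : Matrix (Fin 7) (Fin 7) ℂ := Matrix.of m
  have hmul : ∀ z, (fun i => eval (g z) (b i)) = M.mulVec (hexCubic z) := fun z =>
    funext fun i => hm i z
  have hunit : IsUnit M := by
    rw [← Matrix.vecMul_injective_iff_isUnit]
    change Function.Injective M.vecMulLinear
    rw [injective_iff_map_eq_zero]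
    intro a ha
    rw [Fintype.linearIndependent_iff] at hb
    refine funext (hb a (MvPolynomial.funext fun z => ?_))
    have h1 := hmul (g.symm z)
    rw [LinearEquiv.apply_symm_apply] at h1
    have h2 : dotProduct a (fun i => eval z (b i)) = 0 := by
      rw [h1, Matrix.dotProduct_mulVec]
      change dotProduct (M.vecMulLinear a) _ = 0
      rw [ha, zero_dotProduct]
    rw [map_sum, map_zero, ← h2]
    exact Finset.sum_congr rfl fun i _ => by rw [smul_eval]
  have hiff : ∀ G, aeval b G = 0 ↔ ∀ z, eval (M.mulVec (hexCubic z)) G = 0 := by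
    intro G
    constructor
    · intro h z
      rw [← hmul, ← eval_aeval_mvPolynomial, h, map_zero]
    · intro h
      refine MvPolynomial.funext fun z => ?_
      have h1 := h (g.symm z)
      rw [← hmul, ← eval_aeval_mvPolynomial, LinearEquiv.apply_symm_apply] at h1
      rw [h1, map_zero]
  have hiff' : ∀ G, aeval (hexCubic (X : Fin 3 → MvPolynomial (Fin 3) ℂ)) G = 0 ↔
      ∀ z : Fin 3 → ℂ, eval (hexCubic z) G = 0 := by
    intro G
    constructor
    · intro h z
      rw [← aeval_hexCubic_X_eval, h, map_zero]
    · intro h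
      refine MvPolynomial.funext fun z => ?_
      rw [aeval_hexCubic_X_eval, h, map_zero]
  have hdet : IsUnit M.det := (Matrix.isUnit_iff_isUnit_det M).mp hunit
  have hinv : ∀ v, M.mulVec (M⁻¹.mulVec v) = v := fun v => by
    rw [Matrix.mulVec_mulVec, Matrix.mul_nonsing_inv _ hdet, Matrix.one_mulVec]
  have hinv' : ∀ v, M⁻¹.mulVec (M.mulVec v) = v := fun v => by
    rw [Matrix.mulVec_mulVec, Matrix.nonsing_inv_mul _ hdet, Matrix.one_mulVec]
  let L : (Fin 7 → ℂ) ≃ₗ[ℂ] (Fin 7 → ℂ) :=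
    { M.mulVecLin with
      invFun := M⁻¹.mulVec
      left_inv := hinv'
      right_inv := hinv }
  have hL : ∀ v, L v = M.mulVec v := fun v => rfl
  refine ⟨L, ?_⟩
  have hmem : ∀ v, L v ∈ {v | v ≠ 0 ∧ ∀ G : MvPolynomial (Fin 7) ℂ,
      aeval b G = 0 → eval v G = 0} ↔ v ∈ hexCone := by
    intro v
    rw [mem_hexCone_iff]
    refine and_congr (by simp) ⟨fun h G hG => ?_, fun h G hG => ?_⟩
    · obtain ⟨G', hG'⟩ := exists_eval_comp M⁻¹ G
      have := h G' ((hiff G').mpr fun z => by rw [hG', hinv']; exact (hiff' G).mp hG z)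
      rwa [hL, hG', hinv'] at this
    · obtain ⟨G', hG'⟩ := exists_eval_comp M G
      have := h G' ((hiff' G').mpr fun z => by rw [hG']; exact (hiff G).mp hG z)
      rwa [hG'] at this
  ext v
  obtain ⟨w, rfl⟩ := L.surjective v
  rw [hmem, L.injective.mem_set_image]

/-! ### Projections of the toric surface -/

/-- The linear map with the given values on the coordinate vectors. -/
def proj7 (p : Fin 7 → Fin 3 → ℂ) : (Fin 7 → ℂ) →ₗ[ℂ] (Fin 3 → ℂ) := Fintype.linearCombination ℂ p

theorem proj7_apply (p : Fin 7 → Fin 3 → ℂ) (v : Fin 7 → ℂ) : proj7 p v = ∑ j, v j • p j :=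
  Fintype.linearCombination_apply ℂ p v

/-- The centre of projection misses the open orbit of the toric surface for a suitable image `q` of
the last coordinate vector: the points `q` to be avoided are the values `-∑ (v j / v 6) • p j` at
points `v` of the orbit, and since the orbit has dimension two, they satisfy an algebraic
equation. -/
theorem exists_center (p : Fin 6 → Fin 3 → ℂ) : ∃ q : Fin 3 → ℂ, ∀ v : Fin 7 → ℂ, HexEq v →
    v 6 ≠ 0 → proj7 (Fin.snoc p q : Fin 7 → Fin 3 → ℂ) v ≠ 0 := by
  let Y : Fin 3 → MvPolynomial (Fin 3) ℂ := X
  let F : Fin 4 → MvPolynomial (Fin 3) ℂ := Fin.snoc (n := 3)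
    (fun i => ∑ j : Fin 6, C (p j i) * hexCubic Y j.castSucc) (hexCubic Y 6)
  have hF : ¬ AlgebraicIndependent ℂ F := by
    intro h
    have := h.cardinalMk_le_trdeg
    rw [MvPolynomial.trdeg_of_isDomain] at this
    simp at this
    norm_num at this
  rw [algebraicIndependent_iff] at hF
  push Not at hF
  obtain ⟨G, hG, hG0⟩ := hF
  by_contra! H
  -- every point off the hyperplane where the last coordinate vanishes is a zero of the relation
  have hzero : ∀ y : Fin 4 → ℂ, y 3 ≠ 0 → eval y G = 0 := by
    intro y hy
    obtain ⟨v, hv, hv6, hpv⟩ := H fun i => -(y i.castSucc / y 3)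
    obtain ⟨z, hz⟩ := (hv.smul (y 3 / v 6)).exists_eq_hexCubic (by simp [hv6, hy])
    have hFz : (fun i => eval z (F i)) = y := by
      have hY : ∀ j, eval z (hexCubic Y j) = y 3 / v 6 * v j := fun j => by
        rw [map_hexCubic]
        simpa [Y] using congrFun hz j
      have h6 := hY 6
      rw [div_mul_cancel₀ _ hv6] at h6
      funext i
      refine Fin.lastCases ?_ (fun i => ?_) i
      · simp only [F, Fin.snoc_last]
        exact h6
      · have h1 := congrFun hpv i
        rw [proj7_apply, Fin.sum_univ_castSucc] at h1
        simp only [Fin.snoc_castSucc, Fin.snoc_last, Pi.add_apply, Finset.sum_apply, Pi.smul_apply,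
          smul_eq_mul, Pi.zero_apply] at h1
        change _ + v 6 * _ = 0 at h1
        simp only [F, Fin.snoc_castSucc, map_sum, map_mul, eval_C, hY]
        have h2 : ∑ j : Fin 6, p j i * (y 3 / v 6 * v j.castSucc) =
            y 3 / v 6 * ∑ j : Fin 6, v j.castSucc * p j i := by
          rw [Finset.mul_sum]
          exact Finset.sum_congr rfl fun j _ => by ring
        rw [h2, eq_neg_of_add_eq_zero_left h1]
        field_simp
    rw [← hFz, ← eval_aeval_mvPolynomial]
    rw [hG, map_zero]
  refine hG0 ?_
  have h3 : G * X 3 = 0 := MvPolynomial.funext fun y => by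
    rw [map_mul, eval_X, map_zero]
    by_cases hy : y 3 = 0
    · rw [hy, mul_zero]
    · rw [hzero y hy, zero_mul]
  exact (mul_eq_zero.mp h3).resolve_right (X_ne_zero _)

/-! ### A family of rational sextics on the toric surface -/

section Psi
variable {R : Type*} [CommRing R]

/-- Six binary linear forms, whose roots have different orders in `t`. -/
def ell (t x y : R) : Fin 6 → R :=
  ![x - t ^ 5 * y, x - y, x - t * y, x - t ^ 2 * y, x - t ^ 3 * y, y - t ^ 2 * x]

/-- The indices of the linear factors of the coordinates of `psi`: the forms `0, …, 5` belong to
the edges of the hexagon, the coordinates `0, …, 5` to its vertices. -/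
def psiIndex : Fin 7 → Fin 6 → Fin 6 :=
  ![![2, 3, 3, 4, 4, 5], ![0, 3, 4, 4, 5, 5], ![0, 0, 1, 4, 5, 5], ![0, 0, 1, 1, 2, 5],
    ![0, 1, 1, 2, 2, 3], ![1, 2, 2, 3, 3, 4], ![0, 1, 2, 3, 4, 5]]

/-- The powers of `t` in the coordinates of `psi`. -/
def psiExp : Fin 7 → ℕ := ![0, 0, 1, 2, 2, 1, 1]

/-- The rational sextic curve on the toric surface meeting each of the six lines of the surface in
one point, with parameters the roots of the forms `ell`. -/
def psi (t x y : R) (i : Fin 7) : R := t ^ psiExp i * ∏ j, ell t x y (psiIndex i j)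

/-- The coefficients of a hyperplane containing the curve `psi t`. -/
def psiHyperplane (t : R) : Fin 7 → R :=
  ![-t * (1 - t ^ 4) * (1 - t ^ 5), t * (1 - t) * (1 - t ^ 4), t * (1 - t) * (1 - t ^ 2),
    -(t * (1 - t) * (1 - t ^ 4)), t * (1 - t ^ 4) * (1 - t ^ 5),
    -t ^ 2 * (1 - t ^ 2) * (1 - t ^ 7),
    1 + 3 * t ^ 2 - t ^ 3 - 3 * t ^ 4 - 3 * t ^ 5 - t ^ 6 + 3 * t ^ 7 + t ^ 9]

theorem psi_eq (t x y : R) : psi t x y = let l := ell t x y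
    ![l 2 * l 3 ^ 2 * l 4 ^ 2 * l 5, l 0 * l 3 * l 4 ^ 2 * l 5 ^ 2,
      t * (l 0 ^ 2 * l 1 * l 4 * l 5 ^ 2), t ^ 2 * (l 0 ^ 2 * l 1 ^ 2 * l 2 * l 5),
      t ^ 2 * (l 0 * l 1 ^ 2 * l 2 ^ 2 * l 3), t * (l 1 * l 2 ^ 2 * l 3 ^ 2 * l 4),
      t * (l 0 * l 1 * l 2 * l 3 * l 4 * l 5)] := by
  funext i
  fin_cases i <;> simp [psi, psiExp, psiIndex, Fin.prod_univ_six] <;> ring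

theorem hexEq_psi (t x y : R) : HexEq (psi t x y) := by
  rw [psi_eq]
  constructor <;> simp only [Matrix.cons_val] <;> ring

theorem map_ell {S : Type*} [CommRing S] (f : R →+* S) (t x y : R) (j : Fin 6) :
    f (ell t x y j) = ell (f t) (f x) (f y) j := by
  fin_cases j <;> simp [ell]

theorem map_psi {S : Type*} [CommRing S] (f : R →+* S) (t x y : R) (i : Fin 7) :
    f (psi t x y i) = psi (f t) (f x) (f y) i := by
  simp only [psi, map_mul, map_pow, map_prod, map_ell]

theorem map_psiHyperplane {S : Type*} [CommRing S] (f : R →+* S) (t : R) (i : Fin 7) :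
    f (psiHyperplane t i) = psiHyperplane (f t) i := by
  have h3 : f 3 = 3 := map_ofNat f 3
  fin_cases i <;> simp [psiHyperplane, h3]

theorem ell_smul (c t x y : R) (j : Fin 6) : ell t (c * x) (c * y) j = c * ell t x y j := by
  fin_cases j <;> simp [ell] <;> ring

theorem psi_smul (c t x y : R) : psi t (c * x) (c * y) = c ^ 6 • psi t x y := by
  funext i
  simp only [psi, ell_smul, Finset.prod_mul_distrib, Pi.smul_apply, smul_eq_mul]
  rw [Finset.prod_const, Finset.card_univ, Fintype.card_fin]
  ring

theorem sum_psiHyperplane_mul_psi (t x y : R) : ∑ i, psiHyperplane t i * psi t x y i = 0 := by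
  rw [psi_eq, Fin.sum_univ_seven]
  simp only [psiHyperplane, ell, Matrix.cons_val]
  ring

/-- Two different parameters give the same point of the surface, so that the curve `psi t` has a
double point already before the projection. -/
theorem psi_zero_one (t : R) : psi t 0 1 = t ^ 9 • psi t 1 0 := by
  rw [psi_eq, psi_eq]
  funext i
  fin_cases i <;> simp [ell] <;> ring

/-! ### The degeneration of the family to the hexagon -/

/-- The forms `ell` have roots `t ^ (rootExp j - 1)`, apart from the last one. -/
def rootExp : Fin 6 → ℕ := ![6, 1, 2, 3, 4, 0]

/-- The power of `t` dividing `ell t (t ^ k * s) t`. -/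
def ellExp (k j : Fin 6) : ℕ := if j = 5 then 1 else min k (rootExp j)

/-- The quotient of `ell t (t ^ k * s) t` by the highest power of `t` dividing it. -/
def ellChart (k : Fin 6) (s t : R) (j : Fin 6) : R :=
  if j = 5 then 1 - t ^ ((k : ℕ) + 1) * s
  else t ^ (k - min (k : ℕ) (rootExp j)) * s - t ^ (rootExp j - min (k : ℕ) (rootExp j))

theorem ell_chart (k : Fin 6) (s t : R) (j : Fin 6) :
    ell t (t ^ (k : ℕ) * s) t j = t ^ ellExp k j * ellChart k s t j := by
  by_cases hj : j = 5
  · subst hj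
    simp [ellExp, ellChart, ell]
    ring
  · have h1 : ell t (t ^ (k : ℕ) * s) t j = t ^ (k : ℕ) * s - t ^ rootExp j := by
      fin_cases j <;> simp [ell, rootExp] <;> first | exact absurd rfl hj | ring
    rw [h1, ellExp, ellChart, if_neg hj, if_neg hj, mul_sub, ← mul_assoc, ← pow_add, ← pow_add,
      Nat.add_sub_cancel' (min_le_left _ _), Nat.add_sub_cancel' (min_le_right _ _)]

/-- The power of `t` dividing `psi t (t ^ k * s) t`. -/
def chartExp : Fin 6 → ℕ := ![1, 6, 10, 13, 15, 16]

/-- The rescaled limit of the family near the edge `k` of the hexagon: the quotient of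
`psi t (t ^ k * s) t` by the highest power of `t` dividing it. -/
def psiChart (k : Fin 6) (s t : R) (i : Fin 7) : R :=
  t ^ (psiExp i + ∑ j, ellExp k (psiIndex i j) - chartExp k) *
    ∏ j, ellChart k s t (psiIndex i j)

theorem psi_chart (k : Fin 6) (s t : R) :
    psi t (t ^ (k : ℕ) * s) t = t ^ chartExp k • psiChart k s t := by
  have h : ∀ (k : Fin 6) (i : Fin 7),
      chartExp k ≤ psiExp i + ∑ j, ellExp k (psiIndex i j) := by decide
  funext i
  rw [Pi.smul_apply, smul_eq_mul, psiChart, ← mul_assoc, ← pow_add, Nat.add_sub_cancel' (h k i),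
    psi, pow_add, mul_assoc]
  congr 1
  rw [← Finset.prod_pow_eq_pow_sum, ← Finset.prod_mul_distrib]
  exact Finset.prod_congr rfl fun j _ => ell_chart _ _ _ _

theorem ellChart_zero (k : Fin 6) (s : R) : ellChart k s 0 =
    (![![s, s, s, s, s, 1], ![s, s - 1, s, s, s, 1], ![s, -1, s - 1, s, s, 1],
      ![s, -1, -1, s - 1, s, 1], ![s, -1, -1, -1, s - 1, 1], ![s, -1, -1, -1, -1, 1]] :
      Fin 6 → Fin 6 → R) k := by
  funext j
  fin_cases k <;> fin_cases j <;> simp [ellChart, rootExp]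

/-- The limit of the rescaled family parametrizes the edge `k` of the hexagon. -/
theorem psiChart_zero (k : Fin 6) (s : R) : psiChart k s 0 = s ^ (5 - (k : ℕ)) •
    (((![1, 1, 1, -1, -1, -1] : Fin 6 → R) k * s) • Pi.single (k - 1).castSucc 1 +
      (![1, 1, -1, -1, -1, 1] : Fin 6 → R) k • Pi.single k.castSucc (1 : R)) := by
  have hexp : ∀ (k : Fin 6) (i : Fin 7), psiExp i + ∑ j, ellExp k (psiIndex i j) - chartExp k =
      (![![0, 1, 2, 2, 1, 0, 1], ![0, 0, 1, 2, 2, 1, 1], ![1, 0, 0, 1, 2, 2, 1],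
        ![2, 1, 0, 0, 1, 2, 1], ![2, 2, 1, 0, 0, 1, 1], ![1, 2, 2, 1, 0, 0, 1]] :
        Fin 6 → Fin 7 → ℕ) k i := by decide
  have hneg : (-1 : Fin 6).castSucc = (5 : Fin 7) := rfl
  funext i
  simp only [psiChart, ellChart_zero, hexp]
  fin_cases k <;> fin_cases i <;>
    simp [psiIndex, Fin.prod_univ_six, hneg] <;> try ring

end Psi

/-! ### The hyperplane sections of the toric surface -/

theorem exists_factors_binary_quadric (q : Fin 3 → ℂ) : ∃ α β γ δ : ℂ,
    q 0 = α * γ ∧ q 1 = -(α * δ + β * γ) ∧ q 2 = β * δ := by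
  by_cases h : q 0 = 0
  · exact ⟨0, -1, q 1, -q 2, by simp [h], by ring, by ring⟩
  · obtain ⟨s, hs⟩ := IsAlgClosed.exists_pow_nat_eq (q 1 ^ 2 - 4 * q 0 * q 2) (n := 2) (by norm_num)
    refine ⟨q 0, (-q 1 - s) / 2, 1, (-q 1 + s) / (2 * q 0), by ring, ?_, ?_⟩
    · field_simp
      ring
    · field_simp
      linear_combination hs

theorem exists_root_binary_quadric (q : Fin 3 → ℂ) : ∃ x y : ℂ, (x ≠ 0 ∨ y ≠ 0) ∧
    q 0 * x ^ 2 + q 1 * (x * y) + q 2 * y ^ 2 = 0 := by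
  obtain ⟨α, β, γ, δ, h0, h1, h2⟩ := exists_factors_binary_quadric q
  by_cases h : β ≠ 0 ∨ α ≠ 0
  · exact ⟨β, α, h, by rw [h0, h1, h2]; ring⟩
  · push Not at h
    exact ⟨1, 0, by simp, by rw [h0, h1, h2, h.1, h.2]; ring⟩

/-- Two binary quadratic forms with resultant zero have a common root. -/
theorem exists_common_root_binary_quadric (q r : Fin 3 → ℂ)
    (h : (q 0 * r 2 - q 2 * r 0) ^ 2 = (q 0 * r 1 - q 1 * r 0) * (q 1 * r 2 - q 2 * r 1)) :
    ∃ x y : ℂ, (x ≠ 0 ∨ y ≠ 0) ∧ q 0 * x ^ 2 + q 1 * (x * y) + q 2 * y ^ 2 = 0 ∧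
      r 0 * x ^ 2 + r 1 * (x * y) + r 2 * y ^ 2 = 0 := by
  by_cases hq : q = 0
  · obtain ⟨x, y, hxy, hr⟩ := exists_root_binary_quadric r
    exact ⟨x, y, hxy, by simp [hq], hr⟩
  obtain ⟨α, β, γ, δ, h0, h1, h2⟩ := exists_factors_binary_quadric q
  have hαβ : β ≠ 0 ∨ α ≠ 0 := by
    by_contra! h'
    exact hq (funext fun i => by fin_cases i <;> simp [h0, h1, h2, h'.1, h'.2])
  have hγδ : δ ≠ 0 ∨ γ ≠ 0 := by
    by_contra! h'
    exact hq (funext fun i => by fin_cases i <;> simp [h0, h1, h2, h'.1, h'.2])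
  -- the resultant is the product of the values at the two roots of the first form
  have hprod : (r 0 * β ^ 2 + r 1 * (β * α) + r 2 * α ^ 2) *
      (r 0 * δ ^ 2 + r 1 * (δ * γ) + r 2 * γ ^ 2) = 0 := by
    rw [h0, h1, h2] at h
    linear_combination h
  rcases mul_eq_zero.mp hprod with hr | hr
  · exact ⟨β, α, hαβ, by rw [h0, h1, h2]; ring, hr⟩
  · exact ⟨δ, γ, hγδ, by rw [h0, h1, h2]; ring, hr⟩

/-- The parameters for which the six lines meet the curve `psi t` in different points. -/
structure IsGenericParameter (t : ℂ) : Prop where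
  ne_zero : t ≠ 0
  pow_ne_one : ∀ k : ℕ, 1 ≤ k → k ≤ 7 → t ^ k ≠ 1

theorem IsGenericParameter.pow_ne_pow {t : ℂ} (ht : IsGenericParameter t) {a b : ℕ} (hab : a < b)
    (hb : b ≤ a + 7) : t ^ a - t ^ b ≠ 0 := by
  obtain ⟨k, rfl⟩ := Nat.exists_eq_add_of_lt hab
  intro h
  have h1 : t ^ a * (1 - t ^ (k + 1)) = 0 := by linear_combination h
  rcases mul_eq_zero.mp h1 with h2 | h2
  · exact pow_ne_zero _ ht.ne_zero h2
  · exact ht.pow_ne_one (k + 1) (by omega) (by omega) (sub_eq_zero.mp h2).symm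

theorem IsGenericParameter.one_sub_pow_ne_zero {t : ℂ} (ht : IsGenericParameter t) {k : ℕ}
    (h1 : 1 ≤ k) (h7 : k ≤ 7) : 1 - t ^ k ≠ 0 :=
  sub_ne_zero.mpr (ht.pow_ne_one k h1 h7).symm

theorem IsGenericParameter.ell_ne_zero {t : ℂ} (ht : IsGenericParameter t) {x y : ℂ}
    (hxy : x ≠ 0 ∨ y ≠ 0) {i j : Fin 6} (hij : i ≠ j) (hi : ell t x y i = 0) :
    ell t x y j ≠ 0 := by
  intro hj
  have h5 : ∀ a : ℕ, a ≤ 5 → x - t ^ a * y = 0 → y - t ^ 2 * x = 0 → False := by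
    intro a ha h1 h2
    have h3 : y * (1 - t ^ (a + 2)) = 0 := by linear_combination t ^ 2 * h1 + h2
    have hy := (mul_eq_zero.mp h3).resolve_right (ht.one_sub_pow_ne_zero (by omega) (by omega))
    have hx : x = 0 := by linear_combination h1 + t ^ a * hy
    exact hxy.elim (fun h => h hx) fun h => h hy
  have hab : ∀ a b : ℕ, a ≠ b → a ≤ 5 → b ≤ 5 → x - t ^ a * y = 0 → x - t ^ b * y = 0 →
      False := by
    intro a b hne ha hb h1 h2
    have hy : y = 0 := by
      have h3 : (t ^ a - t ^ b) * y = 0 := by linear_combination h2 - h1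
      refine (mul_eq_zero.mp h3).resolve_left ?_
      rcases lt_or_gt_of_ne hne with h | h
      · exact ht.pow_ne_pow h (by omega)
      · have := ht.pow_ne_pow h (by omega)
        rwa [← neg_ne_zero, neg_sub] at this
    have hx : x = 0 := by linear_combination h1 + t ^ a * hy
    exact hxy.elim (fun h => h hx) fun h => h hy
  let r : Fin 6 → ℕ := ![5, 0, 1, 2, 3, 0]
  have hr : ∀ i : Fin 6, i ≠ 5 → ell t x y i = x - t ^ r i * y := by
    intro i hi
    fin_cases i <;> first | exact absurd rfl hi | simp [ell, r]
  have hrr : ∀ i j : Fin 6, i ≠ 5 → j ≠ 5 → i ≠ j → r i ≠ r j := by decide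
  have hr5 : ∀ i, r i ≤ 5 := by decide
  by_cases h5i : i = 5
  · subst h5i
    rw [hr j (Ne.symm hij)] at hj
    exact h5 _ (hr5 j) hj hi
  by_cases h5j : j = 5
  · subst h5j
    rw [hr i hij] at hi
    exact h5 _ (hr5 i) hi hj
  rw [hr i h5i] at hi
  rw [hr j h5j] at hj
  exact hab _ _ (hrr i j h5i h5j hij) (hr5 i) (hr5 j) hi hj

theorem IsGenericParameter.psi_castSucc_ne_zero {t : ℂ} (ht : IsGenericParameter t) {x y : ℂ}
    (hxy : x ≠ 0 ∨ y ≠ 0) {j : Fin 6} (hj : ell t x y j = 0) : psi t x y j.castSucc ≠ 0 := by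
  have h : ∀ j m, psiIndex (Fin.castSucc j) m ≠ j := by decide
  refine mul_ne_zero (pow_ne_zero _ ht.ne_zero) (Finset.prod_ne_zero_iff.mpr fun m _ => ?_)
  exact ht.ell_ne_zero hxy (h j m).symm hj

theorem IsGenericParameter.psi_ne_zero {t : ℂ} (ht : IsGenericParameter t) {x y : ℂ}
    (hxy : x ≠ 0 ∨ y ≠ 0) : psi t x y ≠ 0 := by
  by_cases h : ∃ j, ell t x y j = 0
  · obtain ⟨j, hj⟩ := h
    exact fun h0 => ht.psi_castSucc_ne_zero hxy hj (congrFun h0 _)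
  · push Not at h
    intro h0
    refine mul_ne_zero (pow_ne_zero _ ht.ne_zero) (Finset.prod_ne_zero_iff.mpr fun m _ => ?_)
      (congrFun h0 6)
    exact h _

theorem psi_eq_zero_of_ell {t x y : ℂ} {j : Fin 6} (hj : ell t x y j = 0) (i : Fin 7)
    (h1 : i ≠ (j - 1).castSucc) (h2 : i ≠ j.castSucc) : psi t x y i = 0 := by
  have h : ∀ (j : Fin 6) (i : Fin 7), i ≠ (j - 1).castSucc → i ≠ j.castSucc →
      ∃ m, psiIndex i m = j := by decide
  obtain ⟨m, hm⟩ := h j i h1 h2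
  exact mul_eq_zero_of_right _ (Finset.prod_eq_zero (Finset.mem_univ m) (by rw [hm, hj]))

theorem exists_ell_eq_zero (t : ℂ) (j : Fin 6) : ∃ x y : ℂ, (x ≠ 0 ∨ y ≠ 0) ∧ ell t x y j = 0 := by
  fin_cases j
  · exact ⟨t ^ 5, 1, by simp, by simp [ell]⟩
  · exact ⟨1, 1, by simp, by simp [ell]⟩
  · exact ⟨t, 1, by simp, by simp [ell]⟩
  · exact ⟨t ^ 2, 1, by simp, by simp [ell]⟩
  · exact ⟨t ^ 3, 1, by simp, by simp [ell]⟩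
  · exact ⟨1, t ^ 2, by simp, by simp [ell]⟩

/-- The boundary of the toric surface is the hexagon of lines joining adjacent vertices. -/
theorem HexEq.exists_edge {v : Fin 7 → ℂ} (hv : HexEq v) (h6 : v 6 = 0) :
    ∃ j : Fin 6, ∀ i : Fin 7, i ≠ (j - 1).castSucc → i ≠ j.castSucc → v i = 0 := by
  obtain ⟨e0, e1, e2, e3, e4, e5, d0, d1, d2⟩ := hv
  let f : Fin 6 → ℂ := fun i => v i.castSucc
  have h2 : ∀ k, f k * f (k + 2) = 0 := by
    rw [h6] at *
    simp only [mul_zero] at *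
    intro k
    fin_cases k <;> assumption
  have h3 : ∀ k, f k * f (k + 3) = 0 := by
    rw [h6] at *
    simp only [ne_eq, OfNat.ofNat_ne_zero, not_false_eq_true, zero_pow] at *
    intro k
    fin_cases k
    · exact d0
    · exact d1
    · exact d2
    · exact (mul_comm _ _).trans d0
    · exact (mul_comm _ _).trans d1
    · exact (mul_comm _ _).trans d2
  by_cases h0 : ∀ k, f k = 0
  · exact ⟨0, fun i _ _ => Fin.lastCases h6 (fun k => h0 k) i⟩
  push Not at h0
  obtain ⟨k, hk⟩ := h0
  have hk2 : f (k + 2) = 0 := (mul_eq_zero.mp (h2 k)).resolve_left hk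
  have hk3 : f (k + 3) = 0 := (mul_eq_zero.mp (h3 k)).resolve_left hk
  have hk4 : f (k + 4) = 0 := by
    have h := h2 (k + 4)
    have e : k + 4 + 2 = k := (by decide : ∀ k : Fin 6, k + 4 + 2 = k) k
    rw [e] at h
    exact (mul_eq_zero.mp h).resolve_right hk
  have hk5 : f (k + 1) = 0 ∨ f (k + 5) = 0 := by
    have h := h2 (k + 5)
    have e : k + 5 + 2 = k + 1 := (by decide : ∀ k : Fin 6, k + 5 + 2 = k + 1) k
    rw [e] at h
    exact (mul_eq_zero.mp h).symm
  have hall : ∀ i k : Fin 6, i = k ∨ i = k + 1 ∨ i = k + 2 ∨ i = k + 3 ∨ i = k + 4 ∨ i = k + 5 := by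
    decide
  rcases hk5 with hk1 | hk5
  · refine ⟨k, fun i => Fin.lastCases (fun _ _ => h6) (fun i hi1 hi2 => ?_) i⟩
    have e : k - 1 = k + 5 := (by decide : ∀ k : Fin 6, k - 1 = k + 5) k
    rw [e] at hi1
    rcases hall i k with rfl | rfl | rfl | rfl | rfl | rfl <;> first | assumption | contradiction
  · refine ⟨k + 1, fun i => Fin.lastCases (fun _ _ => h6) (fun i hi1 hi2 => ?_) i⟩
    rw [add_sub_cancel_right] at hi1
    rcases hall i k with rfl | rfl | rfl | rfl | rfl | rfl <;> first | assumption | contradiction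

theorem IsGenericParameter.psiHyperplane_ne_zero {t : ℂ} (ht : IsGenericParameter t) (k : Fin 6) :
    psiHyperplane t k.castSucc ≠ 0 := by
  have h0 := ht.ne_zero
  have h1 : 1 - t ≠ 0 := by simpa using ht.one_sub_pow_ne_zero (k := 1) le_rfl (by norm_num)
  have h2 : 1 - t ^ 2 ≠ 0 := ht.one_sub_pow_ne_zero (by norm_num) (by norm_num)
  have h4 : 1 - t ^ 4 ≠ 0 := ht.one_sub_pow_ne_zero (by norm_num) (by norm_num)
  have h5 : 1 - t ^ 5 ≠ 0 := ht.one_sub_pow_ne_zero (by norm_num) (by norm_num)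
  have h7 : 1 - t ^ 7 ≠ 0 := ht.one_sub_pow_ne_zero (by norm_num) (by norm_num)
  fin_cases k <;> simp [psiHyperplane, h0, h1, h2, h4, h5, h7]

/-- A point of the open orbit in the hyperplane lies on the curve `psi t`: the parameter is the
common root of two quadratic forms whose resultant is the equation of the hyperplane. -/
theorem IsGenericParameter.exists_psi_of_ne_zero {t : ℂ} (ht : IsGenericParameter t)
    {v : Fin 7 → ℂ} (hv : HexEq v) (h6 : v 6 ≠ 0) (hh : ∑ i, psiHyperplane t i * v i = 0) :
    ∃ x y : ℂ, (x ≠ 0 ∨ y ≠ 0) ∧ ∃ c : ℂ, v = c • psi t x y := by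
  have h0 := ht.ne_zero
  obtain ⟨a, ha⟩ : ∃ a, v 3 = a * v 6 := ⟨v 3 / v 6, by field_simp⟩
  obtain ⟨b, hb⟩ : ∃ b, v 4 = b * v 6 := ⟨v 4 / v 6, by field_simp⟩
  have hab : psiHyperplane t 0 * b + psiHyperplane t 1 * a + psiHyperplane t 2 * a ^ 2 +
      psiHyperplane t 3 * (a ^ 2 * b) + psiHyperplane t 4 * (a * b ^ 2) +
      psiHyperplane t 5 * b ^ 2 + psiHyperplane t 6 * (a * b) = 0 := by
    have e0 : v 0 * a = v 6 := mul_right_cancel₀ h6 (by linear_combination hv.d0 - v 0 * ha)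
    have e1 : v 1 * b = v 6 := mul_right_cancel₀ h6 (by linear_combination hv.d1 - v 1 * hb)
    have e2 : v 2 * b = a * v 6 :=
      mul_right_cancel₀ h6 (by linear_combination hv.e3 - v 2 * hb + v 6 * ha)
    have e5 : v 5 * a = b * v 6 :=
      mul_right_cancel₀ h6 (by linear_combination hv.e4 - v 5 * ha + v 6 * hb)
    rw [Fin.sum_univ_seven] at hh
    refine mul_right_cancel₀ h6 ?_
    linear_combination a * b * hh - psiHyperplane t 0 * b * e0 - psiHyperplane t 1 * a * e1
      - psiHyperplane t 2 * a * e2 - psiHyperplane t 5 * b * e5 - psiHyperplane t 3 * a * b * ha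
      - psiHyperplane t 4 * a * b * hb
  obtain ⟨x, y, hxy, hq, hr⟩ := exists_common_root_binary_quadric
    ![a - t, -a * (t ^ 2 + t ^ 3) + t * (1 + t ^ 5), t ^ 5 * (a - t)]
    ![-(b * t ^ 2 + t), b * (1 + t ^ 5) + t * (1 + t), -(t * (b * t ^ 2 + t))]
    (by
      simp only [psiHyperplane, Matrix.cons_val] at hab ⊢
      linear_combination t ^ 3 * (1 - t ^ 2) * (1 - t ^ 3) * hab)
  simp only [Matrix.cons_val] at hq hr
  -- the two quadratic forms are `a * l 3 * l 4 - t * l 0 * l 1` and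
  -- `b * l 4 * l 5 - t * l 1 * l 2`; their common root is the parameter at which `psi t` has the
  -- coordinate ratios `a` and `b`
  let l := ell t x y
  have hq' : a * (l 3 * l 4) = t * (l 0 * l 1) := by
    simp only [l, ell, Matrix.cons_val]
    linear_combination hq
  have hr' : b * (l 4 * l 5) = t * (l 1 * l 2) := by
    simp only [l, ell, Matrix.cons_val]
    linear_combination hr
  have hne : ∀ i j, i ≠ j → l i = 0 → l j ≠ 0 := fun i j hij => ht.ell_ne_zero hxy hij
  have ha0 : a ≠ 0 := fun h => h6 (by
    have := hv.d0
    rw [ha, h] at this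
    simpa using this.symm)
  have hb0 : b ≠ 0 := fun h => h6 (by
    have := hv.d1
    rw [hb, h] at this
    simpa using this.symm)
  have hl3 : l 3 ≠ 0 := fun h => by
    rw [h, zero_mul, mul_zero] at hq'
    exact mul_ne_zero h0 (mul_ne_zero (hne 3 0 (by decide) h) (hne 3 1 (by decide) h)) hq'.symm
  have hl4 : l 4 ≠ 0 := fun h => by
    rw [h, mul_zero, mul_zero] at hq'
    exact mul_ne_zero h0 (mul_ne_zero (hne 4 0 (by decide) h) (hne 4 1 (by decide) h)) hq'.symm
  have hl5 : l 5 ≠ 0 := fun h => by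
    rw [h, mul_zero, mul_zero] at hr'
    exact mul_ne_zero h0 (mul_ne_zero (hne 5 1 (by decide) h) (hne 5 2 (by decide) h)) hr'.symm
  have hl01 : l 0 * l 1 ≠ 0 := fun h => by
    rw [h, mul_zero] at hq'
    exact mul_ne_zero ha0 (mul_ne_zero hl3 hl4) hq'
  have hl12 : l 1 * l 2 ≠ 0 := fun h => by
    rw [h, mul_zero] at hr'
    exact mul_ne_zero hb0 (mul_ne_zero hl4 hl5) hr'
  have hl0 := left_ne_zero_of_mul hl01
  have hl1 := left_ne_zero_of_mul hl12
  have hl2 := right_ne_zero_of_mul hl12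
  have hP6 : psi t x y 6 = t * (l 0 * l 1 * l 2 * l 3 * l 4 * l 5) := by rw [psi_eq]; rfl
  have hP3 : psi t x y 3 = t ^ 2 * (l 0 ^ 2 * l 1 ^ 2 * l 2 * l 5) := by rw [psi_eq]; rfl
  have hP4 : psi t x y 4 = t ^ 2 * (l 0 * l 1 ^ 2 * l 2 ^ 2 * l 3) := by rw [psi_eq]; rfl
  have hP60 : psi t x y 6 ≠ 0 := by
    rw [hP6]
    simp [h0, hl0, hl1, hl2, hl3, hl4, hl5]
  refine ⟨x, y, hxy, v 6 / psi t x y 6, hv.ext_of_ne_zero ((hexEq_psi t x y).smul _) h6 ?_ ?_ ?_⟩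
  · rw [Pi.smul_apply, smul_eq_mul, div_mul_eq_mul_div, eq_div_iff hP60, ha, hP6, hP3]
    linear_combination v 6 * t * l 0 * l 1 * l 2 * l 5 * hq'
  · rw [Pi.smul_apply, smul_eq_mul, div_mul_eq_mul_div, eq_div_iff hP60, hb, hP6, hP4]
    linear_combination v 6 * t * l 0 * l 1 * l 2 * l 3 * hr'
  · rw [Pi.smul_apply, smul_eq_mul, div_mul_cancel₀ _ hP60]

/-- The hyperplane section of the toric surface is the curve `psi t`. -/
theorem IsGenericParameter.mem_hyperplane_iff {t : ℂ} (ht : IsGenericParameter t)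
    {v : Fin 7 → ℂ} : (v ∈ hexCone ∧ ∑ i, psiHyperplane t i * v i = 0) ↔
      ∃ x y c : ℂ, (x ≠ 0 ∨ y ≠ 0) ∧ c ≠ 0 ∧ v = c • psi t x y := by
  constructor
  · rintro ⟨⟨hv0, hv⟩, hh⟩
    suffices h : ∃ x y : ℂ, (x ≠ 0 ∨ y ≠ 0) ∧ ∃ c : ℂ, v = c • psi t x y by
      obtain ⟨x, y, hxy, c, rfl⟩ := h
      exact ⟨x, y, c, hxy, fun hc => hv0 (by rw [hc, zero_smul]), rfl⟩
    by_cases h6 : v 6 ≠ 0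
    · exact ht.exists_psi_of_ne_zero hv h6 hh
    rw [not_not] at h6
    obtain ⟨j, hj⟩ := hv.exists_edge h6
    obtain ⟨x, y, hxy, hl⟩ := exists_ell_eq_zero t j
    refine ⟨x, y, hxy, v j.castSucc / psi t x y j.castSucc, ?_⟩
    have hw := psi_eq_zero_of_ell hl
    have hwj := ht.psi_castSucc_ne_zero hxy hl
    have hhw := sum_psiHyperplane_mul_psi t x y
    have hne : (j - 1).castSucc ≠ j.castSucc :=
      (by decide : ∀ j : Fin 6, (j - 1).castSucc ≠ j.castSucc) j
    have hsum : ∀ u : Fin 7 → ℂ, (∀ i, i ≠ (j - 1).castSucc → i ≠ j.castSucc → u i = 0) →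
        ∑ i, psiHyperplane t i * u i = psiHyperplane t (j - 1).castSucc * u (j - 1).castSucc +
          psiHyperplane t j.castSucc * u j.castSucc := fun u hu =>
      Fintype.sum_eq_add _ _ hne fun i hi => by rw [hu i hi.1 hi.2, mul_zero]
    rw [hsum _ hj] at hh
    rw [hsum _ hw] at hhw
    funext i
    rw [Pi.smul_apply, smul_eq_mul, div_mul_eq_mul_div, eq_div_iff hwj]
    by_cases hi : i = j.castSucc
    · rw [hi]
    by_cases hi' : i = (j - 1).castSucc
    · rw [hi']
      refine mul_left_cancel₀ (ht.psiHyperplane_ne_zero (j - 1)) ?_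
      linear_combination psi t x y j.castSucc * hh - v j.castSucc * hhw
    · rw [hj i hi' hi, hw i hi' hi, zero_mul, mul_zero]
  · rintro ⟨x, y, c, hxy, hc, rfl⟩
    refine ⟨⟨smul_ne_zero hc (ht.psi_ne_zero hxy), (hexEq_psi t x y).smul c⟩, ?_⟩
    have := sum_psiHyperplane_mul_psi t x y
    calc _ = c * ∑ i, psiHyperplane t i * psi t x y i := by
          rw [Finset.mul_sum]
          exact Finset.sum_congr rfl fun i _ => by rw [Pi.smul_apply, smul_eq_mul]; ring
      _ = 0 := by rw [this, mul_zero]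

/-! ### Six lines and the projection of the hexagon onto them -/

/-- No three of the six lines have a common point. -/
def IsGeneralPosition (l : Fin 6 → Fin 3 → ℂ) : Prop :=
  ∀ s : Fin 3 ↪ Fin 6, LinearIndependent ℂ fun j => l (s j)

theorem IsGeneralPosition.dot_cross_ne_zero {l : Fin 6 → Fin 3 → ℂ} (hl : IsGeneralPosition l)
    {i j k : Fin 6} (hij : i ≠ j) (hik : i ≠ k) (hjk : j ≠ k) :
    l i ⬝ᵥ crossProduct (l j) (l k) ≠ 0 := by
  have hinj : Function.Injective ![i, j, k] := by
    intro a b hab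
    fin_cases a <;> fin_cases b <;> simp_all
  have h := hl ⟨_, hinj⟩
  rw [triple_product_eq_det]
  have h2 : (fun m => l (![i, j, k] m)) = ![l i, l j, l k] := by
    funext m
    fin_cases m <;> rfl
  change LinearIndependent ℂ (fun m => l (![i, j, k] m)) at h
  rw [h2] at h
  have h3 : IsUnit (Matrix.of ![l i, l j, l k]) :=
    Matrix.linearIndependent_rows_iff_isUnit.mp h
  exact ((Matrix.isUnit_iff_isUnit_det _).mp h3).ne_zero

/-- The vertices of the hexagon: the intersections of consecutive lines. -/
def vertex (l : Fin 6 → Fin 3 → ℂ) (k : Fin 6) : Fin 3 → ℂ := crossProduct (l k) (l (k + 1))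

/-- The linear map carrying the hexagon of the toric surface to the hexagon formed by the six
lines, with a prescribed value at the centre. -/
def hexProj (l : Fin 6 → Fin 3 → ℂ) (q : Fin 3 → ℂ) : (Fin 7 → ℂ) →ₗ[ℂ] (Fin 3 → ℂ) :=
  proj7 (Fin.snoc (vertex l) q : Fin 7 → Fin 3 → ℂ)

theorem hexProj_apply (l : Fin 6 → Fin 3 → ℂ) (q : Fin 3 → ℂ) (v : Fin 7 → ℂ) :
    hexProj l q v = ∑ k : Fin 6, v k.castSucc • vertex l k + v 6 • q := by
  rw [hexProj, proj7_apply, Fin.sum_univ_castSucc]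
  simp only [Fin.snoc_castSucc, Fin.snoc_last]
  rfl

theorem hexProj_single (l : Fin 6 → Fin 3 → ℂ) (q : Fin 3 → ℂ) (k : Fin 6) :
    hexProj l q (Pi.single k.castSucc 1) = vertex l k := by
  rw [hexProj, proj7, Fintype.linearCombination_apply_single, one_smul, Fin.snoc_castSucc]

theorem dot_vertex_self (l : Fin 6 → Fin 3 → ℂ) (k : Fin 6) : l k ⬝ᵥ vertex l k = 0 := by
  rw [vertex, dot_self_cross]

theorem dot_vertex_pred (l : Fin 6 → Fin 3 → ℂ) (k : Fin 6) : l k ⬝ᵥ vertex l (k - 1) = 0 := by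
  rw [vertex, sub_add_cancel, dot_cross_self]

theorem IsGeneralPosition.dot_vertex_ne_zero {l : Fin 6 → Fin 3 → ℂ} (hl : IsGeneralPosition l)
    {j k : Fin 6} (h1 : j ≠ k) (h2 : j ≠ k + 1) : l j ⬝ᵥ vertex l k ≠ 0 :=
  hl.dot_cross_ne_zero h1 h2 ((by decide : ∀ k : Fin 6, k ≠ k + 1) k)

/-- The limit of the family near the edge `k`, projected to the line `k`. -/
theorem hexProj_psiChart_zero (l : Fin 6 → Fin 3 → ℂ) (q : Fin 3 → ℂ) (k : Fin 6) (s : ℂ) :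
    hexProj l q (psiChart k s 0) = s ^ (5 - (k : ℕ)) •
      (((![1, 1, 1, -1, -1, -1] : Fin 6 → ℂ) k * s) • vertex l (k - 1) +
        (![1, 1, -1, -1, -1, 1] : Fin 6 → ℂ) k • vertex l k) := by
  rw [psiChart_zero, map_smul, map_add, map_smul, map_smul, hexProj_single, hexProj_single]

/-- The projection of the toric surface is defined everywhere if it is so on the open orbit. -/
theorem IsGeneralPosition.hexProj_ne_zero {l : Fin 6 → Fin 3 → ℂ} (hl : IsGeneralPosition l)
    {q : Fin 3 → ℂ} (hq : ∀ v : Fin 7 → ℂ, HexEq v → v 6 ≠ 0 → hexProj l q v ≠ 0)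
    {v : Fin 7 → ℂ} (hv : v ∈ hexCone) : hexProj l q v ≠ 0 := by
  by_cases h6 : v 6 ≠ 0
  · exact hq v hv.2 h6
  rw [not_not] at h6
  obtain ⟨j, hj⟩ := hv.2.exists_edge h6
  intro h0
  have hne : j - 1 ≠ j := (by decide : ∀ j : Fin 6, j - 1 ≠ j) j
  have h1 : v (j - 1).castSucc • vertex l (j - 1) + v j.castSucc • vertex l j = 0 := by
    rw [hexProj_apply, h6, zero_smul, add_zero, Fintype.sum_eq_add _ _ hne fun i hi => ?_] at h0
    · exact h0
    · rw [hj _ (fun h => hi.1 (Fin.castSucc_injective _ h))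
        (fun h => hi.2 (Fin.castSucc_injective _ h)), zero_smul]
  have ha : v (j - 1).castSucc = 0 := by
    have h2 := congrArg (fun w => l (j + 1) ⬝ᵥ w) h1
    simp only [dotProduct_add, dotProduct_smul, dotProduct_zero, smul_eq_mul] at h2
    have h3 : l (j + 1) ⬝ᵥ vertex l j = 0 := by rw [vertex, dot_cross_self]
    rw [h3, mul_zero, add_zero] at h2
    refine (mul_eq_zero.mp h2).resolve_right (hl.dot_vertex_ne_zero ?_ ?_)
    · exact (by decide : ∀ j : Fin 6, j + 1 ≠ j - 1) j
    · exact (by decide : ∀ j : Fin 6, j + 1 ≠ j - 1 + 1) j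
  have hb : v j.castSucc = 0 := by
    have h2 := congrArg (fun w => l (j - 1) ⬝ᵥ w) h1
    simp only [dotProduct_add, dotProduct_smul, dotProduct_zero, smul_eq_mul, dot_vertex_self,
      mul_zero, zero_add] at h2
    refine (mul_eq_zero.mp h2).resolve_right (hl.dot_vertex_ne_zero hne ?_)
    exact (by decide : ∀ j : Fin 6, j - 1 ≠ j + 1) j
  refine hv.1 (funext fun i => ?_)
  by_cases hi : i = (j - 1).castSucc
  · rw [hi, ha, Pi.zero_apply]
  by_cases hi' : i = j.castSucc
  · rw [hi', hb, Pi.zero_apply]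
  · exact hj i hi hi'

theorem exists_hexProj (l : Fin 6 → Fin 3 → ℂ) : ∃ q : Fin 3 → ℂ, ∀ v : Fin 7 → ℂ, HexEq v →
    v 6 ≠ 0 → hexProj l q v ≠ 0 :=
  exists_center (vertex l)

theorem cross_cross_eq (a b w : Fin 3 → ℂ) :
    crossProduct (crossProduct a b) w = (a ⬝ᵥ w) • b - (b ⬝ᵥ w) • a := by
  funext i
  fin_cases i <;> simp [cross_apply, dotProduct, Fin.sum_univ_three] <;> ring

theorem dot_hexProj_psiChart_zero (l : Fin 6 → Fin 3 → ℂ) (q : Fin 3 → ℂ) (k : Fin 6) (s : ℂ) :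
    l k ⬝ᵥ hexProj l q (psiChart k s 0) = 0 := by
  rw [hexProj_psiChart_zero, dotProduct_smul, dotProduct_add, dotProduct_smul, dotProduct_smul,
    dot_vertex_self, dot_vertex_pred]
  simp

/-- The limit curve passes transversally through the intersection of two non-adjacent lines. -/
theorem IsGeneralPosition.exists_chart_point {l : Fin 6 → Fin 3 → ℂ} (hl : IsGeneralPosition l)
    (q : Fin 3 → ℂ) {k j : Fin 6} (h0 : j ≠ k) (h1 : j ≠ k + 1) (h2 : j ≠ k - 1) :
    ∃ a κ A : ℂ, a ≠ 0 ∧ κ ≠ 0 ∧ A ≠ 0 ∧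
      hexProj l q (psiChart k a 0) = κ • crossProduct (l k) (l j) ∧
      HasDerivAt (fun s => l j ⬝ᵥ hexProj l q (psiChart k s 0)) A a := by
  obtain ⟨c, hc, hc0⟩ : ∃ c, c = (![1, 1, 1, -1, -1, -1] : Fin 6 → ℂ) k ∧ c ≠ 0 :=
    ⟨_, rfl, by fin_cases k <;> simp⟩
  obtain ⟨d, hd, hd0⟩ : ∃ d, d = (![1, 1, -1, -1, -1, 1] : Fin 6 → ℂ) k ∧ d ≠ 0 :=
    ⟨_, rfl, by fin_cases k <;> simp⟩
  have hA : l j ⬝ᵥ vertex l (k - 1) ≠ 0 := hl.dot_vertex_ne_zero h2 (by rwa [sub_add_cancel])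
  have hB : l j ⬝ᵥ vertex l k ≠ 0 := hl.dot_vertex_ne_zero h0 h1
  have hform : ∀ s, hexProj l q (psiChart k s 0) = s ^ (5 - (k : ℕ)) •
      ((c * s) • vertex l (k - 1) + d • vertex l k) := fun s => by
    rw [hexProj_psiChart_zero, hc, hd]
  have hdot : ∀ s, l j ⬝ᵥ hexProj l q (psiChart k s 0) = s ^ (5 - (k : ℕ)) *
      (c * (l j ⬝ᵥ vertex l (k - 1)) * s + d * (l j ⬝ᵥ vertex l k)) := fun s => by
    rw [hform, dotProduct_smul, dotProduct_add, dotProduct_smul, dotProduct_smul]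
    simp only [smul_eq_mul]
    ring
  have hcA := mul_ne_zero hc0 hA
  let a := -(d * (l j ⬝ᵥ vertex l k)) / (c * (l j ⬝ᵥ vertex l (k - 1)))
  have ha0 : a ≠ 0 := div_ne_zero (neg_ne_zero.mpr (mul_ne_zero hd0 hB)) hcA
  have haz : c * (l j ⬝ᵥ vertex l (k - 1)) * a + d * (l j ⬝ᵥ vertex l k) = 0 := by
    rw [mul_div_cancel₀ _ hcA, neg_add_cancel]
  have hlj : l j ⬝ᵥ hexProj l q (psiChart k a 0) = 0 := by rw [hdot, haz, mul_zero]
  have hlk := dot_hexProj_psiChart_zero l q k a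
  have hne : hexProj l q (psiChart k a 0) ≠ 0 := by
    intro h
    have h3 := congrArg (fun w => l (k + 1) ⬝ᵥ w) h
    have h4 : l (k + 1) ⬝ᵥ vertex l k = 0 := by rw [vertex, dot_cross_self]
    simp only [hform, dotProduct_smul, dotProduct_add, dotProduct_zero, smul_eq_mul, h4, mul_zero,
      add_zero] at h3
    refine mul_ne_zero (pow_ne_zero _ ha0) (mul_ne_zero (mul_ne_zero hc0 ha0) ?_) h3
    refine hl.dot_vertex_ne_zero ?_ ?_
    · exact (by decide : ∀ j : Fin 6, j + 1 ≠ j - 1) k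
    · exact (by decide : ∀ j : Fin 6, j + 1 ≠ j - 1 + 1) k
  have hjk : crossProduct (l k) (l j) ≠ 0 := fun h => by
    have h3 := hl.dot_cross_ne_zero (i := k + 1) (j := k) (k := j)
      ((by decide : ∀ j : Fin 6, j + 1 ≠ j) k) h1.symm h0.symm
    rw [h, dotProduct_zero] at h3
    exact h3 rfl
  obtain ⟨κ, hκ⟩ := exists_smul_of_cross_eq_zero hjk
    (by rw [cross_cross_eq, hlk, hlj, zero_smul, zero_smul, sub_zero] :
      crossProduct (crossProduct (l k) (l j)) (hexProj l q (psiChart k a 0)) = 0)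
  refine ⟨a, κ, a ^ (5 - (k : ℕ)) * (c * (l j ⬝ᵥ vertex l (k - 1))), ha0, ?_,
    mul_ne_zero (pow_ne_zero _ ha0) hcA, hκ, ?_⟩
  · rintro rfl
    rw [zero_smul] at hκ
    exact hne hκ
  · simp only [hdot]
    have h5 := ((hasDerivAt_id a).pow (5 - (k : ℕ))).mul
      (((hasDerivAt_id a).const_mul (c * (l j ⬝ᵥ vertex l (k - 1)))).add_const
        (d * (l j ⬝ᵥ vertex l k)))
    convert! h5 using 1
    simp only [id, mul_one]
    rw [haz, mul_zero, zero_add]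
    rfl

/-! ### Nodes near the vertices of the arrangement -/

/-- Two equations in three unknowns define a curve over the last coordinate where the Jacobian is
antidiagonal and invertible. -/
theorem exists_tendsto_of_hasDerivAt {F G : ℂ × ℂ × ℂ → ℂ} (hF : ContDiff ℂ 1 F)
    (hG : ContDiff ℂ 1 G) {a b A B : ℂ} (hF0 : F (a, b, 0) = 0) (hG0 : G (a, b, 0) = 0)
    (hFa : HasDerivAt (fun s => F (s, b, 0)) 0 a) (hFb : HasDerivAt (fun s => F (a, s, 0)) B b)
    (hGa : HasDerivAt (fun s => G (s, b, 0)) A a) (hGb : HasDerivAt (fun s => G (a, s, 0)) 0 b)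
    (hA : A ≠ 0) (hB : B ≠ 0) :
    ∃ σ τ : ℂ → ℂ, Filter.Tendsto σ (𝓝 0) (𝓝 a) ∧ Filter.Tendsto τ (𝓝 0) (𝓝 b) ∧
      ∀ᶠ t in 𝓝 0, F (σ t, τ t, t) = 0 ∧ G (σ t, τ t, t) = 0 := by
  let H : ℂ × ℂ × ℂ → ℂ × ℂ × ℂ := fun x => (F x, G x, x.2.2)
  have hH : ContDiff ℂ 1 H := hF.prodMk (hG.prodMk (contDiff_snd.comp contDiff_snd))
  have hstrict := (hH.contDiffAt (x := (a, b, 0))).hasStrictFDerivAt one_ne_zero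
  set H' := fderiv ℂ H (a, b, 0) with hH'
  have h1 : H' (1, 0, 0) = (0, A, 0) := by
    have e1 : HasDerivAt (fun s : ℂ => ((s, b, 0) : ℂ × ℂ × ℂ)) (1, 0, 0) a :=
      (hasDerivAt_id a).prodMk (hasDerivAt_const a (b, (0 : ℂ)))
    have e2 := hstrict.hasFDerivAt.comp_hasDerivAt_of_eq a e1 rfl
    exact e2.unique (hFa.prodMk (hGa.prodMk (hasDerivAt_const a (0 : ℂ))))
  have h2 : H' (0, 1, 0) = (B, 0, 0) := by
    have e1 : HasDerivAt (fun s : ℂ => ((a, s, 0) : ℂ × ℂ × ℂ)) (0, 1, 0) b :=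
      (hasDerivAt_const b a).prodMk ((hasDerivAt_id b).prodMk (hasDerivAt_const b (0 : ℂ)))
    have e2 := hstrict.hasFDerivAt.comp_hasDerivAt_of_eq b e1 rfl
    exact e2.unique (hFb.prodMk (hGb.prodMk (hasDerivAt_const b (0 : ℂ))))
  have h3 : ∀ w, (H' w).2.2 = w.2.2 := by
    intro w
    have e1 := hstrict.hasFDerivAt.snd.snd
    have e2 := (hasFDerivAt_id (𝕜 := ℂ) ((a, b, 0) : ℂ × ℂ × ℂ)).snd.snd
    exact DFunLike.congr_fun (e1.unique e2) w
  have hinj : Function.Injective H' := by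
    rw [injective_iff_map_eq_zero]
    rintro ⟨x, y, z⟩ hw
    have hz : z = 0 := by
      have := h3 (x, y, z)
      rw [hw] at this
      exact this.symm
    subst hz
    have e : ((x, y, 0) : ℂ × ℂ × ℂ) = x • (1, 0, 0) + y • (0, 1, 0) := by simp
    rw [e, map_add, map_smul, map_smul, h1, h2] at hw
    simp [hA, hB] at hw
    rw [hw.1, hw.2]
    rfl
  let e : (ℂ × ℂ × ℂ) ≃L[ℂ] (ℂ × ℂ × ℂ) :=
    (LinearEquiv.ofInjectiveEndo H'.toLinearMap hinj).toContinuousLinearEquiv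
  have he : (e : (ℂ × ℂ × ℂ) →L[ℂ] (ℂ × ℂ × ℂ)) = H' :=
    ContinuousLinearMap.ext fun w => rfl
  rw [← he] at hstrict
  have hHa : H (a, b, 0) = (0, 0, 0) := by simp [H, hF0, hG0]
  let g := hstrict.localInverse H e (a, b, 0)
  have hg1 : ∀ᶠ y in 𝓝 (0, 0, 0), H (g y) = y := by
    rw [← hHa]
    exact hstrict.eventually_right_inverse
  have hg2 : Filter.Tendsto g (𝓝 (0, 0, 0)) (𝓝 (a, b, 0)) := by
    rw [← hHa]
    exact hstrict.localInverse_tendsto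
  have hι : Filter.Tendsto (fun t : ℂ => ((0, 0, t) : ℂ × ℂ × ℂ)) (𝓝 0) (𝓝 (0, 0, 0)) :=
    (Continuous.prodMk continuous_const (continuous_const.prodMk continuous_id)).tendsto' _ _ rfl
  have hgι := hg2.comp hι
  refine ⟨fun t => (g (0, 0, t)).1, fun t => (g (0, 0, t)).2.1,
    (continuous_fst.tendsto _).comp hgι,
    ((continuous_fst.comp continuous_snd).tendsto _).comp hgι, ?_⟩
  filter_upwards [hι.eventually hg1] with t ht
  have h22 : (g (0, 0, t)).2.2 = t := congrArg (fun w => w.2.2) ht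
  have h4 : ((g (0, 0, t)).1, (g (0, 0, t)).2.1, t) = g (0, 0, t) :=
    Prod.ext rfl (Prod.ext rfl h22.symm)
  rw [h4]
  exact ⟨congrArg (fun w => w.1) ht, congrArg (fun w => w.2.1) ht⟩

theorem contDiff_ellChart (k j : Fin 6) : ContDiff ℂ 1 fun x : ℂ × ℂ => ellChart k x.1 x.2 j := by
  unfold ellChart
  split_ifs <;> fun_prop

theorem contDiff_hexProj_psiChart (l : Fin 6 → Fin 3 → ℂ) (q : Fin 3 → ℂ) (k : Fin 6) :
    ContDiff ℂ 1 fun x : ℂ × ℂ => hexProj l q (psiChart k x.1 x.2) := by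
  refine (hexProj l q).toContinuousLinearMap.contDiff.comp (contDiff_pi.mpr fun i => ?_)
  unfold psiChart
  exact (contDiff_snd.pow _).mul (contDiff_prod fun j _ => contDiff_ellChart k _)

/-- Near the intersection of two non-adjacent lines two branches of the curve cross. -/
theorem IsGeneralPosition.exists_crossing {l : Fin 6 → Fin 3 → ℂ} (hl : IsGeneralPosition l)
    (q : Fin 3 → ℂ) {k j : Fin 6} (h0 : j ≠ k) (h1 : j ≠ k + 1) (h2 : j ≠ k - 1) :
    ∃ (a b κ : ℂ) (σ τ : ℂ → ℂ), a ≠ 0 ∧ b ≠ 0 ∧ κ ≠ 0 ∧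
      Filter.Tendsto σ (𝓝 0) (𝓝 a) ∧ Filter.Tendsto τ (𝓝 0) (𝓝 b) ∧
      hexProj l q (psiChart k a 0) = κ • crossProduct (l k) (l j) ∧
      ∀ᶠ t in 𝓝 0, crossProduct (hexProj l q (psiChart k (σ t) t))
        (hexProj l q (psiChart j (τ t) t)) = 0 := by
  obtain ⟨a, κ, A, ha, hκ, hA, hP, hdA⟩ := hl.exists_chart_point q h0 h1 h2
  obtain ⟨b, μ, B, hb, hμ, hB, hQ, hdB⟩ := hl.exists_chart_point q (k := j) (j := k) h0.symm
    (fun h => h2 (by rw [h, add_sub_cancel_right])) (fun h => h1 (by rw [h, sub_add_cancel]))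
  let f : Fin 3 → ℂ × ℂ × ℂ → ℂ := fun i x => hexProj l q (psiChart k x.1 x.2.2) i
  let g : Fin 3 → ℂ × ℂ × ℂ → ℂ := fun i x => hexProj l q (psiChart j x.2.1 x.2.2) i
  have hf : ∀ i, ContDiff ℂ 1 (f i) := fun i => contDiff_pi.mp
    ((contDiff_hexProj_psiChart l q k).comp
      (contDiff_fst.prodMk (contDiff_snd.comp contDiff_snd) :
        ContDiff ℂ 1 fun x : ℂ × ℂ × ℂ => (x.1, x.2.2))) i
  have hg : ∀ i, ContDiff ℂ 1 (g i) := fun i => contDiff_pi.mp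
    ((contDiff_hexProj_psiChart l q j).comp contDiff_snd) i
  have hjk : crossProduct (l k) (l j) ≠ 0 := fun h => by
    have h3 := hl.dot_cross_ne_zero (i := k + 1) (j := k) (k := j)
      ((by decide : ∀ j : Fin 6, j + 1 ≠ j) k) h1.symm h0.symm
    rw [h, dotProduct_zero] at h3
    exact h3 rfl
  obtain ⟨i, hi⟩ := Function.ne_iff.mp hjk
  rw [Pi.zero_apply] at hi
  have hfi : f i (a, b, 0) ≠ 0 := by
    simp only [f, hP, Pi.smul_apply, smul_eq_mul]
    exact mul_ne_zero hκ hi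
  have hgi : g i (a, b, 0) ≠ 0 := by
    simp only [g, hQ, Pi.smul_apply, smul_eq_mul]
    rw [← cross_anticomm, Pi.neg_apply]
    exact mul_ne_zero hμ (neg_ne_zero.mpr hi)
  have hlg : l k ⬝ᵥ hexProj l q (psiChart j b 0) = 0 := by
    rw [hQ, dotProduct_smul, dot_cross_self, smul_zero]
  have hlf : l j ⬝ᵥ hexProj l q (psiChart k a 0) = 0 := by
    rw [hP, dotProduct_smul, dot_cross_self, smul_zero]
  -- proportionality of the two points, in terms of the functionals `l k`, `l j` and a coordinate
  let F : Fin 6 → ℂ × ℂ × ℂ → ℂ := fun m x =>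
    (∑ r, l m r * f r x) * g i x - f i x * ∑ r, l m r * g r x
  have hF : ∀ m, ContDiff ℂ 1 (F m) := fun m =>
    ((ContDiff.sum fun r _ => contDiff_const.mul (hf r)).mul (hg i)).sub
      ((hf i).mul (ContDiff.sum fun r _ => contDiff_const.mul (hg r)))
  have hFs : ∀ m s t, F m (s, t, 0) =
      (l m ⬝ᵥ hexProj l q (psiChart k s 0)) * g i (s, t, 0) -
        f i (s, t, 0) * (l m ⬝ᵥ hexProj l q (psiChart j t 0)) := fun m s t => rfl
  obtain ⟨σ, τ, hσ, hτ, hev⟩ := exists_tendsto_of_hasDerivAt (F := F k) (G := F j) (hF k) (hF j)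
    (a := a) (b := b) (A := A * g i (a, b, 0)) (B := -(f i (a, b, 0) * B))
    (by rw [hFs, dot_hexProj_psiChart_zero, hlg]; ring)
    (by rw [hFs, dot_hexProj_psiChart_zero, hlf]; ring)
    (by
      simp only [hFs, dot_hexProj_psiChart_zero, hlg, zero_mul, mul_zero, sub_zero]
      exact hasDerivAt_const _ _)
    (by
      simp only [hFs, dot_hexProj_psiChart_zero, zero_mul, zero_sub]
      exact (hdB.const_mul (f i (a, b, 0))).neg)
    (by
      simp only [hFs, dot_hexProj_psiChart_zero, mul_zero, sub_zero]
      exact hdA.mul_const (g i (a, b, 0)))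
    (by
      simp only [hFs, dot_hexProj_psiChart_zero, hlf, zero_mul, mul_zero, sub_zero]
      exact hasDerivAt_const _ _)
    (mul_ne_zero hA hgi) (neg_ne_zero.mpr (mul_ne_zero hfi hB))
  refine ⟨a, b, κ, σ, τ, ha, hb, hκ, hσ, hτ, hP, ?_⟩
  have hlim : Filter.Tendsto (fun t => f i (σ t, τ t, t)) (𝓝 0) (𝓝 (f i (a, b, 0))) :=
    ((hf i).continuous.tendsto _).comp (hσ.prodMk_nhds (hτ.prodMk_nhds Filter.tendsto_id))
  filter_upwards [hev, hlim.eventually_ne hfi] with t ht hft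
  set u := hexProj l q (psiChart k (σ t) t) with hu
  set v := hexProj l q (psiChart j (τ t) t) with hv
  have hFu : ∀ m, F m (σ t, τ t, t) = (l m ⬝ᵥ u) * v i - u i * (l m ⬝ᵥ v) := fun m => rfl
  have hdot : ∀ m, F m (σ t, τ t, t) = 0 → l m ⬝ᵥ (v i • u - u i • v) = 0 := fun m hm => by
    rw [dotProduct_sub, dotProduct_smul, dotProduct_smul, smul_eq_mul, smul_eq_mul]
    rw [hFu] at hm
    linear_combination hm
  obtain ⟨c, hc⟩ := exists_smul_of_cross_eq_zero hjk
    (by rw [cross_cross_eq, hdot k ht.1, hdot j ht.2, zero_smul, zero_smul, sub_zero] :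
      crossProduct (crossProduct (l k) (l j)) (v i • u - u i • v) = 0)
  have hci := congrFun hc i
  simp only [Pi.sub_apply, Pi.smul_apply, smul_eq_mul] at hci
  rw [mul_comm (v i), sub_self, eq_comm] at hci
  rw [(mul_eq_zero.mp hci).resolve_right hi, zero_smul, sub_eq_zero] at hc
  have h5 : u i • crossProduct u v = 0 := by
    rw [← map_smul, ← hc, map_smul, cross_self, smul_zero]
  exact (smul_eq_zero.mp h5).resolve_left hft

/-! ### The projected family of plane sextics and its nodes -/

/-- The projection of the family `psi` to the plane, in the affine parameter `x` on the line
`y + t ^ 2 * x = 1`. -/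
def family (l : Fin 6 → Fin 3 → ℂ) (q : Fin 3 → ℂ) : Fin 3 → Polynomial (Polynomial ℂ) := fun i =>
  ∑ j : Fin 7, Polynomial.C (Polynomial.C ((Fin.snoc (vertex l) q : Fin 7 → Fin 3 → ℂ) j i)) *
    psi (Polynomial.C Polynomial.X : Polynomial (Polynomial ℂ)) Polynomial.X
      (1 - Polynomial.C Polynomial.X ^ 2 * Polynomial.X) j

/-- The member with parameter `t` of the projected family. -/
def member (l : Fin 6 → Fin 3 → ℂ) (q : Fin 3 → ℂ) (t : ℂ) : Fin 3 → Polynomial ℂ := fun i =>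
  (family l q i).map (Polynomial.evalRingHom t)

theorem member_apply (l : Fin 6 → Fin 3 → ℂ) (q : Fin 3 → ℂ) (t : ℂ) (i : Fin 3) :
    member l q t i = ∑ j : Fin 7, Polynomial.C ((Fin.snoc (vertex l) q : Fin 7 → Fin 3 → ℂ) j i) *
      psi (Polynomial.C t) Polynomial.X (1 - Polynomial.C t ^ 2 * Polynomial.X) j := by
  rw [member, family, Polynomial.map_sum]
  refine Finset.sum_congr rfl fun j _ => ?_
  rw [Polynomial.map_mul, ← Polynomial.coe_mapRingHom, map_psi]
  simp

theorem pt_member (l : Fin 6 → Fin 3 → ℂ) (q : Fin 3 → ℂ) (t z : ℂ) :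
    pt (member l q t) z = hexProj l q (psi t z (1 - t ^ 2 * z)) := by
  funext i
  rw [pt, member_apply, hexProj, proj7_apply, Finset.sum_apply, Polynomial.eval_finsetSum]
  refine Finset.sum_congr rfl fun j _ => ?_
  rw [Polynomial.eval_mul, ← Polynomial.coe_evalRingHom, map_psi]
  simp [mul_comm]

theorem ell_polynomial (t a b c d : ℂ) (j : Fin 6) :
    ell (Polynomial.C t) (Polynomial.C a * Polynomial.X + Polynomial.C b)
      (Polynomial.C c * Polynomial.X + Polynomial.C d) j =
        Polynomial.C (ell t a c j) * Polynomial.X + Polynomial.C (ell t b d j) := by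
  fin_cases j <;> simp [ell] <;> ring

theorem psi_polynomial (t : ℂ) (i : Fin 7) :
    psi (Polynomial.C t) Polynomial.X (1 - Polynomial.C t ^ 2 * Polynomial.X) i =
      Polynomial.C (t ^ psiExp i) * ∏ j, (Polynomial.C (ell t 1 (-t ^ 2) (psiIndex i j)) *
        Polynomial.X + Polynomial.C (ell t 0 1 (psiIndex i j))) := by
  have hx : (Polynomial.X : Polynomial ℂ) = Polynomial.C 1 * Polynomial.X + Polynomial.C 0 := by
    simp
  have hy : (1 - Polynomial.C t ^ 2 * Polynomial.X : Polynomial ℂ) =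
      Polynomial.C (-t ^ 2) * Polynomial.X + Polynomial.C 1 := by
    simp
    ring
  rw [psi, hy]
  conv_lhs =>
    enter [2, 2, j]
    rw [show ell (Polynomial.C t) Polynomial.X _ _ = _ from
      congrArg (fun p => ell (Polynomial.C t) p _ _) hx, ell_polynomial]
  rw [Polynomial.C_pow]

theorem natDegree_psi_le (t : ℂ) (i : Fin 7) :
    (psi (Polynomial.C t) Polynomial.X (1 - Polynomial.C t ^ 2 * Polynomial.X) i).natDegree ≤
      6 := by
  rw [psi_polynomial]
  refine (Polynomial.natDegree_C_mul_le _ _).trans ((Polynomial.natDegree_prod_le _ _).trans ?_)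
  exact (Finset.sum_le_card_nsmul _ _ 1 fun j _ => Polynomial.natDegree_linear_le).trans (by simp)

theorem coeff_psi (t : ℂ) (i : Fin 7) :
    (psi (Polynomial.C t) Polynomial.X (1 - Polynomial.C t ^ 2 * Polynomial.X) i).coeff 6 =
      psi t 1 (-t ^ 2) i := by
  rw [psi_polynomial, Polynomial.coeff_C_mul, psi]
  congr 1
  have := Polynomial.coeff_prod_of_natDegree_le Finset.univ
    (fun j => Polynomial.C (ell t 1 (-t ^ 2) (psiIndex i j)) * Polynomial.X +
      Polynomial.C (ell t 0 1 (psiIndex i j))) 1 fun j _ => Polynomial.natDegree_linear_le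
  simpa using this

theorem natDegree_member_le (l : Fin 6 → Fin 3 → ℂ) (q : Fin 3 → ℂ) (t : ℂ) (i : Fin 3) :
    (member l q t i).natDegree ≤ 6 := by
  rw [member_apply]
  exact Polynomial.natDegree_sum_le_of_forall_le _ _ fun j _ =>
    (Polynomial.natDegree_C_mul_le _ _).trans (natDegree_psi_le t j)

theorem coeff_member (l : Fin 6 → Fin 3 → ℂ) (q : Fin 3 → ℂ) (t : ℂ) :
    (fun i => (member l q t i).coeff 6) = hexProj l q (psi t 1 (-t ^ 2)) := by
  funext i
  rw [member_apply, hexProj, proj7_apply, Finset.sum_apply, Polynomial.finsetSum_coeff]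
  refine Finset.sum_congr rfl fun j _ => ?_
  rw [Polynomial.coeff_C_mul, coeff_psi, Pi.smul_apply, smul_eq_mul, mul_comm]

/-- The affine parameter of the point with coordinate `s` in the chart `k`. -/
def chartParam (k : Fin 6) (s t : ℂ) : ℂ := t ^ (k : ℕ) * s / (t * (1 + t ^ ((k : ℕ) + 1) * s))

theorem pt_member_chartParam (l : Fin 6 → Fin 3 → ℂ) (q : Fin 3 → ℂ) (k : Fin 6) {s t : ℂ}
    (ht : t ≠ 0) (hs : 1 + t ^ ((k : ℕ) + 1) * s ≠ 0) :
    ∃ c : ℂ, c ≠ 0 ∧ pt (member l q t) (chartParam k s t) = c • hexProj l q (psiChart k s t) := by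
  let D := t * (1 + t ^ ((k : ℕ) + 1) * s)
  have hD : D ≠ 0 := mul_ne_zero ht hs
  refine ⟨D⁻¹ ^ 6 * t ^ chartExp k,
    mul_ne_zero (pow_ne_zero _ (inv_ne_zero hD)) (pow_ne_zero _ ht), ?_⟩
  have h1 : chartParam k s t = D⁻¹ * (t ^ (k : ℕ) * s) := by rw [chartParam, div_eq_inv_mul]
  have h2 : 1 - t ^ 2 * chartParam k s t = D⁻¹ * t := by
    rw [h1]
    apply mul_left_cancel₀ hD
    rw [mul_inv_cancel_left₀ hD, mul_sub, mul_left_comm, mul_inv_cancel_left₀ hD]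
    simp only [D]
    ring
  rw [pt_member, h2, h1, psi_smul, psi_chart, smul_smul, map_smul]

/-- The pairs of lines, one for each of the ten nodes, in whose intersection the node has its limit:
the nine pairs of non-adjacent lines and one pair of adjacent ones. -/
def nodePair : Fin 10 → Fin 6 × Fin 6 :=
  ![(0, 2), (0, 3), (0, 4), (1, 3), (1, 4), (1, 5), (2, 4), (2, 5), (3, 5), (5, 0)]

/-- Ten pairs of parameters having ten different points as their common images. -/
structure HasTenNodes (φ : Fin 3 → Polynomial ℂ) (u v : Fin 10 → ℂ) : Prop where
  ne : ∀ i, u i ≠ v i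
  cross_eq_zero : ∀ i, crossProduct (pt φ (u i)) (pt φ (v i)) = 0
  cross_ne_zero : ∀ i j, i ≠ j → crossProduct (pt φ (u i)) (pt φ (u j)) ≠ 0

theorem eventually_one_add_ne_zero (k : Fin 6) {σ : ℂ → ℂ} {a : ℂ}
    (hσ : Filter.Tendsto σ (𝓝 0) (𝓝 a)) : ∀ᶠ t in 𝓝 0, 1 + t ^ ((k : ℕ) + 1) * σ t ≠ 0 := by
  have h : Filter.Tendsto (fun t : ℂ => 1 + t ^ ((k : ℕ) + 1) * σ t) (𝓝 0) (𝓝 (1 + 0 * a)) := by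
    refine Filter.Tendsto.add tendsto_const_nhds (Filter.Tendsto.mul ?_ hσ)
    exact (continuous_pow _).tendsto' _ _ (by simp)
  exact h.eventually_ne (by simp)

theorem tendsto_hexProj_psiChart (l : Fin 6 → Fin 3 → ℂ) (q : Fin 3 → ℂ) (k : Fin 6) {σ : ℂ → ℂ}
    {a : ℂ} (hσ : Filter.Tendsto σ (𝓝 0) (𝓝 a)) :
    Filter.Tendsto (fun t => hexProj l q (psiChart k (σ t) t)) (𝓝 0)
      (𝓝 (hexProj l q (psiChart k a 0))) := by
  have h := (contDiff_hexProj_psiChart l q k).continuous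
  obtain ⟨f, hf⟩ : ∃ f : ℂ × ℂ → Fin 3 → ℂ, f = fun x => hexProj l q (psiChart k x.1 x.2) :=
    ⟨_, rfl⟩
  have e : ∀ s t, hexProj l q (psiChart k s t) = f (s, t) := fun s t => by rw [hf]
  rw [← hf] at h
  simp only [e]
  have h1 : Filter.Tendsto (fun t : ℂ => (σ t, t)) (𝓝 0) (𝓝 (a, 0)) :=
    hσ.prodMk_nhds Filter.tendsto_id
  exact (h.tendsto (a, 0)).comp h1

/-- The crossing of two branches near the intersection of two non-adjacent lines is a node. -/
theorem IsGeneralPosition.eventually_exists_node {l : Fin 6 → Fin 3 → ℂ} (hl : IsGeneralPosition l)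
    (q : Fin 3 → ℂ) (i : Fin 10) : ∃ (a κ : ℂ) (σ : ℂ → ℂ), κ ≠ 0 ∧
      Filter.Tendsto σ (𝓝 0) (𝓝 a) ∧ hexProj l q (psiChart (nodePair i).1 a 0) =
        κ • crossProduct (l (nodePair i).1) (l (nodePair i).2) ∧
      ∀ᶠ t in 𝓝[≠] 0, ∃ v, chartParam (nodePair i).1 (σ t) t ≠ v ∧
        crossProduct (pt (member l q t) (chartParam (nodePair i).1 (σ t) t))
          (pt (member l q t) v) = 0 := by
  by_cases hi : i = 9
  · subst hi
    -- the node already present on the surface, with the parameters `0` and `(t ^ 2)⁻¹`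
    refine ⟨0, 1, fun _ => 0, one_ne_zero, tendsto_const_nhds, ?_, ?_⟩
    · change hexProj l q (psiChart 5 0 0) = _
      rw [hexProj_psiChart_zero]
      simp [nodePair, vertex]
    · filter_upwards [self_mem_nhdsWithin] with t ht
      have h0 : chartParam (nodePair 9).1 0 t = 0 := by simp [chartParam]
      have ht2 : t ^ 2 ≠ 0 := pow_ne_zero _ ht
      refine ⟨(t ^ 2)⁻¹, by rw [h0]; exact (inv_ne_zero ht2).symm, ?_⟩
      have h1 : psi t (t ^ 2)⁻¹ 0 = (t ^ 2)⁻¹ ^ 6 • psi t 1 0 := by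
        rw [← psi_smul, mul_one, mul_zero]
      rw [h0, pt_member, pt_member, mul_zero, sub_zero, mul_inv_cancel₀ ht2, sub_self,
        psi_zero_one, h1, map_smul, map_smul, map_smul, map_smul, LinearMap.smul_apply, cross_self,
        smul_zero, smul_zero]
  · have hadj : ∀ i : Fin 10, i ≠ 9 → (nodePair i).2 ≠ (nodePair i).1 ∧
        (nodePair i).2 ≠ (nodePair i).1 + 1 ∧ (nodePair i).2 ≠ (nodePair i).1 - 1 ∧
        (nodePair i).1 < (nodePair i).2 := by decide
    obtain ⟨h0, h1, h2, hlt⟩ := hadj i hi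
    obtain ⟨a, b, κ, σ, τ, ha, -, hκ, hσ, hτ, hP, hev⟩ := hl.exists_crossing q h0 h1 h2
    generalize (nodePair i).1 = k at *
    generalize (nodePair i).2 = j at *
    refine ⟨a, κ, σ, hκ, hσ, hP, ?_⟩
    have hne : ∀ᶠ t in 𝓝 0, σ t - t ^ ((j : ℕ) - k) * τ t ≠ 0 := by
      have h : Filter.Tendsto (fun t : ℂ => σ t - t ^ ((j : ℕ) - k) * τ t) (𝓝 0)
          (𝓝 (a - 0 * b)) := by
        refine hσ.sub (Filter.Tendsto.mul ?_ hτ)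
        refine (continuous_pow _).tendsto' _ _ (zero_pow ?_)
        have : (k : ℕ) < j := hlt
        omega
      exact h.eventually_ne (by simpa using ha)
    filter_upwards [self_mem_nhdsWithin, nhdsWithin_le_nhds hev, nhdsWithin_le_nhds hne,
      nhdsWithin_le_nhds (eventually_one_add_ne_zero k hσ),
      nhdsWithin_le_nhds (eventually_one_add_ne_zero j hτ)] with t ht hcr hst hs1 hs2
    obtain ⟨c, -, hc⟩ := pt_member_chartParam l q k ht hs1
    obtain ⟨d, -, hd⟩ := pt_member_chartParam l q j ht hs2
    refine ⟨chartParam j (τ t) t, fun h => hst ?_, ?_⟩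
    · rw [chartParam, chartParam, div_eq_div_iff (mul_ne_zero ht hs1) (mul_ne_zero ht hs2)] at h
      have hj : t ^ (j : ℕ) = t ^ (k : ℕ) * t ^ ((j : ℕ) - k) := by
        rw [← pow_add, Nat.add_sub_cancel' (le_of_lt hlt)]
      have h3 : t ^ (k : ℕ) * t * (σ t - t ^ ((j : ℕ) - k) * τ t) = 0 := by
        rw [pow_succ, pow_succ] at h
        rw [hj] at h
        linear_combination h
      exact (mul_eq_zero.mp h3).resolve_left (mul_ne_zero (pow_ne_zero _ ht) ht)
    · rw [hc, hd, map_smul, map_smul, LinearMap.smul_apply, hcr, smul_zero, smul_zero]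

theorem IsGeneralPosition.cross_nodePair_ne_zero {l : Fin 6 → Fin 3 → ℂ} (hl : IsGeneralPosition l)
    {i j : Fin 10} (hij : i ≠ j) :
    crossProduct (crossProduct (l (nodePair i).1) (l (nodePair i).2))
      (crossProduct (l (nodePair j).1) (l (nodePair j).2)) ≠ 0 := by
  have hdec : ∀ i j : Fin 10, i ≠ j → (nodePair i).1 ≠ (nodePair i).2 ∧
      (nodePair j).1 ≠ (nodePair j).2 ∧
      (((nodePair i).1 ≠ (nodePair j).1 ∧ (nodePair i).1 ≠ (nodePair j).2) ∨
      ((nodePair i).2 ≠ (nodePair j).1 ∧ (nodePair i).2 ≠ (nodePair j).2)) := by decide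
  obtain ⟨hi, hj, h⟩ := hdec i j hij
  generalize nodePair i = p at *
  generalize nodePair j = r at *
  have key : ∀ m, m ≠ r.1 → m ≠ r.2 → l m ⬝ᵥ crossProduct (l p.1) (l p.2) = 0 →
      crossProduct (crossProduct (l p.1) (l p.2)) (crossProduct (l r.1) (l r.2)) ≠ 0 := by
    intro m h1 h2 h0 hc
    have hp : crossProduct (l p.1) (l p.2) ≠ 0 := by
      obtain ⟨m', h1', h2'⟩ := (by decide : ∀ a b : Fin 6, ∃ m, m ≠ a ∧ m ≠ b) p.1 p.2
      intro h0'
      have := hl.dot_cross_ne_zero h1' h2' hi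
      rw [h0', dotProduct_zero] at this
      exact this rfl
    obtain ⟨c, hc⟩ := exists_smul_of_cross_eq_zero hp hc
    refine hl.dot_cross_ne_zero h1 h2 hj ?_
    rw [hc, dotProduct_smul, h0, smul_zero]
  rcases h with ⟨h1, h2⟩ | ⟨h1, h2⟩
  · exact key _ h1 h2 (dot_self_cross _ _)
  · exact key _ h1 h2 (dot_cross_self _ _)

/-- The double points of a projected curve are different for small `t ≠ 0`, since their limits are
different intersection points of the six lines. -/
theorem IsGeneralPosition.eventually_exists_hasTenNodes {l : Fin 6 → Fin 3 → ℂ}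
    (hl : IsGeneralPosition l) (q : Fin 3 → ℂ) :
    ∀ᶠ t in 𝓝[≠] 0, ∃ u v, HasTenNodes (member l q t) u v := by
  choose a κ σ hκ hσ hP hev using hl.eventually_exists_node q
  have hcont : ∀ i, Filter.Tendsto
      (fun t => hexProj l q (psiChart (nodePair i).1 (σ i t) t)) (𝓝 0)
      (𝓝 (κ i • crossProduct (l (nodePair i).1) (l (nodePair i).2))) := fun i => by
    have h := tendsto_hexProj_psiChart l q (nodePair i).1 (hσ i)
    rwa [hP i] at h
  have hcc : Continuous fun p : (Fin 3 → ℂ) × (Fin 3 → ℂ) => crossProduct p.1 p.2 := by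
    simp only [cross_apply]
    refine continuous_pi fun i => ?_
    fin_cases i <;> simp <;> fun_prop
  have hne : ∀ i j, i ≠ j → ∀ᶠ t in 𝓝 0,
      crossProduct (hexProj l q (psiChart (nodePair i).1 (σ i t) t))
        (hexProj l q (psiChart (nodePair j).1 (σ j t) t)) ≠ 0 := by
    intro i j hij
    refine ((hcc.tendsto _).comp ((hcont i).prodMk_nhds (hcont j))).eventually_ne ?_
    simp only [map_smul, LinearMap.smul_apply]
    exact smul_ne_zero (hκ j) (smul_ne_zero (hκ i) (hl.cross_nodePair_ne_zero hij))
  have hne' : ∀ᶠ t in 𝓝 0, ∀ i j, i ≠ j →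
      crossProduct (hexProj l q (psiChart (nodePair i).1 (σ i t) t))
        (hexProj l q (psiChart (nodePair j).1 (σ j t) t)) ≠ 0 := by
    rw [Filter.eventually_all]
    intro i
    rw [Filter.eventually_all]
    intro j
    by_cases hij : i = j
    · exact Filter.Eventually.of_forall fun t h => absurd hij h
    · exact (hne i j hij).mono fun t h _ => h
  have hone : ∀ᶠ t in 𝓝 0, ∀ i, 1 + t ^ (((nodePair i).1 : ℕ) + 1) * σ i t ≠ 0 :=
    Filter.eventually_all.mpr fun i => eventually_one_add_ne_zero _ (hσ i)
  filter_upwards [self_mem_nhdsWithin, Filter.eventually_all.mpr hev, nhdsWithin_le_nhds hne',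
    nhdsWithin_le_nhds hone] with t ht h1 h2 h3
  choose v hv hcr using h1
  refine ⟨fun i => chartParam (nodePair i).1 (σ i t) t, v, hv, hcr, fun i j hij => ?_⟩
  obtain ⟨c, hc0, hc⟩ := pt_member_chartParam l q (nodePair i).1 ht (h3 i)
  obtain ⟨d, hd0, hd⟩ := pt_member_chartParam l q (nodePair j).1 ht (h3 j)
  rw [hc, hd, map_smul, map_smul, LinearMap.smul_apply]
  exact smul_ne_zero hd0 (smul_ne_zero hc0 (h2 i j hij))

theorem infinite_of_eventually_nhdsNE {p : ℂ → Prop} (h : ∀ᶠ t in 𝓝[≠] 0, p t) :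
    {t | p t}.Infinite := by
  intro hfin
  have h1 : insert 0 {t | p t} ∈ 𝓝 (0 : ℂ) := by
    rw [eventually_nhdsWithin_iff] at h
    filter_upwards [h] with t ht
    by_cases h0 : t = 0
    · exact Or.inl h0
    · exact Or.inr (ht h0)
  exact infinite_of_mem_nhds 0 h1 (hfin.insert 0)

/-! ### Nodes of almost all members of the family -/

theorem eval_specialize_aeval_X {σ : Type*} (t : ℂ) (z : σ → ℂ) (s : σ)
    (p : Polynomial (Polynomial ℂ)) :
    eval z (specialize t (Polynomial.aeval (X s : MvPolynomial σ (Polynomial ℂ)) p)) =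
      (p.map (Polynomial.evalRingHom t)).eval (z s) := by
  let g : MvPolynomial σ (Polynomial ℂ) →+* ℂ := (eval z).comp (map (Polynomial.evalRingHom t))
  change g _ = _
  rw [Polynomial.aeval_def, Polynomial.hom_eval₂, Polynomial.eval_map]
  congr 1
  · ext r <;> simp [g]
  · simp [g]

theorem map_cross {R S : Type*} [CommRing R] [CommRing S] (g : R →+* S) (a b : Fin 3 → R)
    (m : Fin 3) :
    g (crossProduct a b m) = crossProduct (fun i => g (a i)) (fun i => g (b i)) m := by
  rw [cross_apply, cross_apply]
  fin_cases m <;> simp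

theorem exists_sum_mul_eq_one_iff {w : Fin 3 → ℂ} : (∃ a : Fin 3 → ℂ, ∑ m, a m * w m = 1) ↔
    w ≠ 0 := by
  constructor
  · rintro ⟨a, ha⟩ rfl
    simp at ha
  · intro hw
    obtain ⟨i, hi⟩ := Function.ne_iff.mp hw
    refine ⟨Pi.single i (w i)⁻¹, ?_⟩
    rw [Finset.sum_eq_single i]
    · simpa using inv_mul_cancel₀ hi
    · intro j _ hj
      simp [hj]
    · simp

/-- The curve with parameter `t` in a family of parametrized plane curves. -/
def curveAt (Φ : Fin 3 → Polynomial (Polynomial ℂ)) (t : ℂ) : Fin 3 → Polynomial ℂ :=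
  fun i => (Φ i).map (Polynomial.evalRingHom t)

/-- The unknowns of the system expressing the existence of ten nodes: the parameters of their
branches, the inverses of the differences of these, and for each pair of nodes a functional with
value one on the cross product. -/
abbrev NodeVar : Type := Fin 3 × Fin 10 ⊕ (Fin 10 × Fin 10) × Fin 3

/-- The point of a family of curves whose parameter is an unknown. -/
def unknownPoint (Φ : Fin 3 → Polynomial (Polynomial ℂ)) (s : NodeVar) (i : Fin 3) :
    MvPolynomial NodeVar (Polynomial ℂ) :=
  Polynomial.aeval (X s : MvPolynomial NodeVar (Polynomial ℂ)) (Φ i)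

/-- The two branches of a node have the same image. -/
def nodeEqImage (Φ : Fin 3 → Polynomial (Polynomial ℂ)) (p : Fin 10 × Fin 3) :
    MvPolynomial NodeVar (Polynomial ℂ) :=
  crossProduct (unknownPoint Φ (.inl (0, p.1))) (unknownPoint Φ (.inl (1, p.1))) p.2

/-- The two branches of a node have different parameters. -/
def nodeEqParam (i : Fin 10) : MvPolynomial NodeVar (Polynomial ℂ) :=
  X (.inl (2, i)) * (X (.inl (0, i)) - X (.inl (1, i))) - 1

/-- Different nodes have different images. -/
def nodeEqDistinct (Φ : Fin 3 → Polynomial (Polynomial ℂ)) (p : Fin 10 × Fin 10) :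
    MvPolynomial NodeVar (Polynomial ℂ) :=
  ∑ m, X (.inr (p, m)) *
    crossProduct (unknownPoint Φ (.inl (0, p.1))) (unknownPoint Φ (.inl (0, p.2))) m - 1

theorem eval_unknownPoint (Φ : Fin 3 → Polynomial (Polynomial ℂ)) (t : ℂ) (z : NodeVar → ℂ)
    (s : NodeVar) :
    (fun i => eval z (specialize t (unknownPoint Φ s i))) = pt (curveAt Φ t) (z s) := by
  funext i
  rw [unknownPoint, eval_specialize_aeval_X, pt, curveAt]

theorem eval_cross_unknownPoint (Φ : Fin 3 → Polynomial (Polynomial ℂ)) (t : ℂ)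
    (z : NodeVar → ℂ) (s s' : NodeVar) (m : Fin 3) :
    eval z (specialize t (crossProduct (unknownPoint Φ s) (unknownPoint Φ s') m)) =
      crossProduct (pt (curveAt Φ t) (z s)) (pt (curveAt Φ t) (z s')) m := by
  rw [← eval_unknownPoint, ← eval_unknownPoint]
  exact map_cross ((eval z).comp (map (Polynomial.evalRingHom t))) _ _ _

theorem eval_nodeEqParam (t : ℂ) (z : NodeVar → ℂ) (i : Fin 10) :
    eval z (specialize t (nodeEqParam i)) =
      z (.inl (2, i)) * (z (.inl (0, i)) - z (.inl (1, i))) - 1 := by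
  simp only [nodeEqParam, specialize, map_sub, map_mul, map_X, eval_X, map_one]

theorem eval_nodeEqDistinct (Φ : Fin 3 → Polynomial (Polynomial ℂ)) (t : ℂ) (z : NodeVar → ℂ)
    (p : Fin 10 × Fin 10) : eval z (specialize t (nodeEqDistinct Φ p)) =
      ∑ m, z (.inr (p, m)) * crossProduct (pt (curveAt Φ t) (z (.inl (0, p.1))))
        (pt (curveAt Φ t) (z (.inl (0, p.2)))) m - 1 := by
  simp only [← eval_cross_unknownPoint]
  simp only [nodeEqDistinct, specialize, map_sub, map_sum, map_mul, map_X, eval_X, map_one]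

/-- The equations expressing the existence of ten nodes. -/
def nodeSystem (Φ : Fin 3 → Polynomial (Polynomial ℂ)) :
    Set (MvPolynomial NodeVar (Polynomial ℂ)) :=
  Set.range (nodeEqImage Φ) ∪ Set.range nodeEqParam ∪
    nodeEqDistinct Φ '' {p | p.1 ≠ p.2}

theorem exists_zero_nodeSystem_iff (Φ : Fin 3 → Polynomial (Polynomial ℂ)) (t : ℂ) :
    (∃ z : NodeVar → ℂ, ∀ p ∈ nodeSystem Φ, eval z (specialize t p) = 0) ↔
      ∃ u v, HasTenNodes (curveAt Φ t) u v := by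
  constructor
  · rintro ⟨z, hz⟩
    refine ⟨fun i => z (.inl (0, i)), fun i => z (.inl (1, i)), fun i h => ?_, fun i => ?_,
      fun i j hij => ?_⟩
    · have h2 := hz (nodeEqParam i) (Or.inl (Or.inr ⟨i, rfl⟩))
      rw [eval_nodeEqParam, h] at h2
      simp at h2
    · funext m
      rw [← eval_cross_unknownPoint]
      exact hz _ (Or.inl (Or.inl ⟨(i, m), rfl⟩))
    · have h3 := hz (nodeEqDistinct Φ (i, j)) (Or.inr ⟨_, hij, rfl⟩)
      rw [eval_nodeEqDistinct] at h3
      exact exists_sum_mul_eq_one_iff.mp ⟨_, sub_eq_zero.mp h3⟩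
  · rintro ⟨u, v, h⟩
    have h3 : ∀ p : Fin 10 × Fin 10, ∃ a : Fin 3 → ℂ, p.1 ≠ p.2 → ∑ m, a m *
        crossProduct (pt (curveAt Φ t) (u p.1)) (pt (curveAt Φ t) (u p.2)) m = 1 := by
      intro p
      by_cases hp : p.1 = p.2
      · exact ⟨0, fun h => absurd hp h⟩
      · obtain ⟨a, ha⟩ := exists_sum_mul_eq_one_iff.mpr (h.cross_ne_zero _ _ hp)
        exact ⟨a, fun _ => ha⟩
    choose a ha using h3
    refine ⟨Sum.elim (fun p => (![u p.2, v p.2, (u p.2 - v p.2)⁻¹] : Fin 3 → ℂ) p.1)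
      fun p => a p.1 p.2, ?_⟩
    rintro p ((⟨p, rfl⟩ | ⟨i, rfl⟩) | ⟨p, hp, rfl⟩)
    · rw [nodeEqImage, eval_cross_unknownPoint]
      exact congrFun (h.cross_eq_zero p.1) p.2
    · rw [eval_nodeEqParam]
      exact sub_eq_zero.mpr (inv_mul_cancel₀ (sub_ne_zero.mpr (h.ne i)))
    · rw [eval_nodeEqDistinct]
      exact sub_eq_zero.mpr (ha p hp)

/-- A family of parametrized plane curves with ten nodes for infinitely many values of the
parameter has ten nodes for almost all of them. -/
theorem exists_forall_hasTenNodes (Φ : Fin 3 → Polynomial (Polynomial ℂ))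
    (hinf : {t : ℂ | ∃ u v, HasTenNodes (curveAt Φ t) u v}.Infinite) :
    ∃ f : Polynomial ℂ, f ≠ 0 ∧ ∀ t, f.eval t ≠ 0 → ∃ u v, HasTenNodes (curveAt Φ t) u v := by
  have hS : (nodeSystem Φ).Finite :=
    ((Set.finite_range _).union (Set.finite_range _)).union ((Set.toFinite _).image _)
  obtain ⟨f, hf0, hf⟩ := exists_forall_common_zero (nodeSystem Φ) hS
    (by simpa only [exists_zero_nodeSystem_iff] using hinf)
  exact ⟨f, hf0, fun t ht => (exists_zero_nodeSystem_iff Φ t).mp (hf t ht)⟩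

/-! ### The equations of the members -/

/-- A rational sextic with ten nodes lies on a sextic curve: there are `28` coefficients, and by the
`10` coincidences `27` conditions suffice for the vanishing at `37` parameters. -/
theorem HasTenNodes.exists_sextic {φ : Fin 3 → Polynomial ℂ} {u v : Fin 10 → ℂ}
    (h : HasTenNodes φ u v) (hdeg : ∀ i, (φ i).natDegree ≤ 6) (hpt : ∀ z, pt φ z ≠ 0) :
    ∃ D : MvPolynomial (Fin 3) ℂ, D.IsHomogeneous 6 ∧ D ≠ 0 ∧ aeval φ D = 0 := by
  classical
  have huv : ∀ i j, u i ≠ v j := by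
    intro i j hij
    by_cases hne : i = j
    · exact h.ne i (by rw [hij, hne])
    · have h1 := h.cross_eq_zero j
      rw [← hij] at h1
      exact h.cross_ne_zero j i (Ne.symm hne) h1
  have hv : Function.Injective v := by
    intro i j hij
    by_contra hne
    have h1 := h.cross_eq_zero i
    have h2 := h.cross_eq_zero j
    rw [← hij] at h2
    exact h.cross_ne_zero i j hne (cross_eq_zero_trans (hpt (v i)) h1 (cross_eq_zero_symm h2))
  have hV : (Finset.univ.image v).card = 10 := by
    rw [Finset.card_image_of_injective _ hv, Finset.card_univ, Fintype.card_fin]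
  obtain ⟨Z, hZ, hZcard⟩ := Infinite.exists_superset_card_eq
    (Finset.univ.image u ∪ Finset.univ.image v) 37
    ((Finset.card_union_le _ _).trans (by
      have := Finset.card_image_le (s := Finset.univ) (f := u)
      rw [hV]
      simp at this
      omega))
  have hVZ : Finset.univ.image v ⊆ Z := Finset.subset_union_right.trans hZ
  let Y : Finset ℂ := Z \ Finset.univ.image v
  -- the equation along the curve has degree at most `36`, so that `37` zeros suffice; the zeros at
  -- the ten parameters `v i` follow from those at the `u i`, and `27` conditions remain
  have hY : Fintype.card Y < Fintype.card (Exponents 6) := by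
    rw [Fintype.card_coe, Finset.card_sdiff_of_subset hVZ, hV, hZcard, card_exponents_six]
    norm_num
  obtain ⟨D, hD, hD0, hL⟩ := exists_form_of_conditions hY fun z =>
    (aeval (pt φ z) : MvPolynomial (Fin 3) ℂ →ₐ[ℂ] ℂ).toLinearMap
  have hL' : ∀ z ∈ Z, z ∉ Finset.univ.image v → eval (pt φ z) D = 0 := fun z hz hzv => by
    have := hL ⟨z, Finset.mem_sdiff.mpr ⟨hz, hzv⟩⟩
    rwa [AlgHom.toLinearMap_apply, aeval_eq_eval] at this
  refine ⟨D, hD, hD0, Polynomial.eq_zero_of_natDegree_lt_card_of_eval_eq_zero' _ Z ?_ ?_⟩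
  · intro z hz
    rw [eval_aeval_polynomial]
    change eval (pt φ z) D = 0
    by_cases hzv : z ∈ Finset.univ.image v
    · obtain ⟨i, -, rfl⟩ := Finset.mem_image.mp hzv
      obtain ⟨a, ha⟩ := exists_smul_of_cross_eq_zero (hpt (u i)) (h.cross_eq_zero i)
      have hu := hL' (u i) (hZ (Finset.mem_union_left _ (Finset.mem_image_of_mem _ (by simp)))) (by
        simp only [Finset.mem_image, Finset.mem_univ, true_and, not_exists]
        exact fun j hj => huv i j hj.symm)
      rw [ha, IsHomogeneous.eval_smul hD, hu, mul_zero]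
    · exact hL' z hz hzv
  · rw [hZcard]
    exact (IsHomogeneous.natDegree_aeval_le hD hdeg).trans_lt (by norm_num)

theorem aeval_formOfCoeffs {n : ℕ} {R A : Type*} [CommRing R] [CommRing A] [Algebra R A]
    (φ : Fin 3 → A) (c : Exponents n → R) :
    aeval φ (formOfCoeffs n c) = ∑ m, c m • ∏ i, φ i ^ m.1 i := by
  rw [formOfCoeffs, map_sum]
  refine Finset.sum_congr rfl fun m _ => ?_
  rw [aeval_monomial, Algebra.smul_def, Finsupp.prod_fintype _ _ (by simp)]
  rfl

/-- If infinitely many members of a family of parametrized curves lie on curves of degree `n`, then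
all of them do, and the equations can be chosen to depend polynomially on the parameter. -/
theorem exists_family_of_forms (n : ℕ) (Φ : Fin 3 → Polynomial (Polynomial ℂ))
    (hinf : {t : ℂ | ∃ E : MvPolynomial (Fin 3) ℂ, E.IsHomogeneous n ∧ E ≠ 0 ∧
      aeval (curveAt Φ t) E = 0}.Infinite) :
    ∃ P : MvPolynomial (Fin 3) (Polynomial ℂ), P.IsHomogeneous n ∧ (∀ t, specialize t P ≠ 0) ∧
      aeval Φ P = 0 := by
  have hdep : {t : ℂ | ∃ c : Exponents n → ℂ, c ≠ 0 ∧
      ∑ m, c m • (∏ i, Φ i ^ m.1 i).map (Polynomial.evalRingHom t) = 0}.Infinite := by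
    refine hinf.mono ?_
    rintro t ⟨E, hE, hE0, hφ⟩
    refine ⟨fun m => coeff (Finsupp.equivFunOnFinite.symm m.1) E, fun h => hE0 ?_, ?_⟩
    · rw [IsHomogeneous.eq_formOfCoeffs hE, h]
      simp [formOfCoeffs]
    · rw [IsHomogeneous.eq_formOfCoeffs hE, aeval_formOfCoeffs] at hφ
      rw [← hφ]
      refine Finset.sum_congr rfl fun m _ => ?_
      simp only [curveAt, Polynomial.map_prod, Polynomial.map_pow]
  obtain ⟨x, hx, hsum⟩ := exists_primitive_relation
    (fun m : Exponents n => ∏ i, Φ i ^ m.1 i) hdep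
  refine ⟨formOfCoeffs n x, isHomogeneous_formOfCoeffs n x, fun t h => hx t ?_, ?_⟩
  · rw [specialize, map_formOfCoeffs] at h
    exact formOfCoeffs_eq_zero h
  · rw [aeval_formOfCoeffs, ← hsum]
    exact Finset.sum_congr rfl fun m _ => Polynomial.smul_eq_C_mul _

theorem aeval_specialize {Φ : Fin 3 → Polynomial (Polynomial ℂ)}
    {P : MvPolynomial (Fin 3) (Polynomial ℂ)} (h : aeval Φ P = 0) (t : ℂ) :
    aeval (curveAt Φ t) (specialize t P) = 0 := by
  have key : ∀ P : MvPolynomial (Fin 3) (Polynomial ℂ),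
      aeval (curveAt Φ t) (specialize t P) =
        (aeval Φ P).map (Polynomial.evalRingHom t) := by
    intro P
    induction P using MvPolynomial.induction_on with
    | C a =>
      rw [specialize, map_C, aeval_C, aeval_C]
      change Polynomial.C _ = Polynomial.map _ (Polynomial.C a)
      rw [Polynomial.map_C]
    | add p q hp hq =>
      rw [specialize, map_add, map_add, map_add, Polynomial.map_add, ← hp, ← hq]
      rfl
    | mul_X p i hp =>
      rw [specialize, map_mul, map_mul, map_mul, Polynomial.map_mul, ← hp, map_X, aeval_X, aeval_X]
      rfl
  rw [key, h, Polynomial.map_zero]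

/-! ### Forms vanishing on six general lines -/

/-- The linear form with the given coefficients. -/
def linForm (l : Fin 3 → ℂ) : MvPolynomial (Fin 3) ℂ := ∑ k, C (l k) * X k

theorem eval_linForm (l x : Fin 3 → ℂ) : eval x (linForm l) = l ⬝ᵥ x := by
  simp [linForm, dotProduct, map_sum]

theorem isHomogeneous_linForm (l : Fin 3 → ℂ) : (linForm l).IsHomogeneous 1 :=
  IsHomogeneous.sum _ _ _ fun _ _ => isHomogeneous_C_mul_X (R := ℂ) _ _

theorem coeff_linForm (l : Fin 3 → ℂ) (k : Fin 3) :
    coeff (Finsupp.single k 1) (linForm l) = l k := by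
  classical
  rw [linForm, coeff_sum, Finset.sum_eq_single k]
  · simp
  · intro j _ hj
    rw [coeff_C_mul, coeff_X, if_neg, mul_zero]
    intro h
    exact hj (Finsupp.single_left_injective one_ne_zero h)
  · simp

theorem linForm_ne_zero {l : Fin 3 → ℂ} (hl : l ≠ 0) : linForm l ≠ 0 := by
  intro h
  refine hl (funext fun k => ?_)
  rw [← coeff_linForm l k, h, coeff_zero, Pi.zero_apply]

theorem prime_linForm {l : Fin 3 → ℂ} (hl : l ≠ 0) : Prime (linForm l) := by
  refine (irreducible_of_totalDegree_eq_one
    ((isHomogeneous_linForm l).totalDegree (linForm_ne_zero hl)) fun x hx => ?_).prime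
  obtain ⟨k, hk⟩ := Function.ne_iff.mp hl
  have h := hx (Finsupp.single k 1)
  rw [coeff_linForm] at h
  refine isUnit_iff_ne_zero.mpr ?_
  rintro rfl
  exact hk (zero_dvd_iff.mp h)

theorem linForm_dvd_of_eval_eq_zero {l : Fin 3 → ℂ} (hl : l ≠ 0) {E : MvPolynomial (Fin 3) ℂ}
    (hE : ∀ x, l ⬝ᵥ x = 0 → eval x E = 0) : linForm l ∣ E := by
  have hprime : (Ideal.span {linForm l}).IsPrime :=
    (Ideal.span_singleton_prime (linForm_ne_zero hl)).mpr (prime_linForm hl)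
  rw [← Ideal.mem_span_singleton, ← hprime.radical,
    ← vanishingIdeal_zeroLocus_eq_radical (K := ℂ), mem_vanishingIdeal_iff]
  intro x hx
  rw [zeroLocus_span] at hx
  have h1 := hx (linForm l) rfl
  rw [aeval_eq_eval] at h1 ⊢
  exact hE x (by rw [← eval_linForm]; exact h1)

theorem IsGeneralPosition.ne_zero {l : Fin 6 → Fin 3 → ℂ} (hl : IsGeneralPosition l) (k : Fin 6) :
    l k ≠ 0 := by
  intro h
  refine hl.dot_cross_ne_zero (i := k) (j := k + 1) (k := k + 2)
    ((by decide : ∀ k : Fin 6, k ≠ k + 1) k) ((by decide : ∀ k : Fin 6, k ≠ k + 2) k)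
    ((by decide : ∀ k : Fin 6, k + 1 ≠ k + 2) k) ?_
  rw [h, zero_dotProduct]

theorem IsGeneralPosition.not_dvd {l : Fin 6 → Fin 3 → ℂ} (hl : IsGeneralPosition l) {j k : Fin 6}
    (hjk : j ≠ k) : ¬ linForm (l k) ∣ linForm (l j) := by
  rintro ⟨E, hE⟩
  obtain ⟨m, h1, h2⟩ := (by decide : ∀ a b : Fin 6, ∃ m, m ≠ a ∧ m ≠ b) j k
  refine hl.dot_cross_ne_zero hjk h1.symm h2.symm ?_
  rw [← eval_linForm, hE, map_mul, eval_linForm, dot_self_cross, zero_mul]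

theorem IsGeneralPosition.prod_dvd {l : Fin 6 → Fin 3 → ℂ} (hl : IsGeneralPosition l)
    {E : MvPolynomial (Fin 3) ℂ} (hE : ∀ k, linForm (l k) ∣ E) : ∏ k, linForm (l k) ∣ E := by
  suffices h : ∀ S : Finset (Fin 6), ∏ k ∈ S, linForm (l k) ∣ E from h Finset.univ
  intro S
  induction S using Finset.induction_on with
  | empty => simp
  | insert k S hk ih =>
    obtain ⟨G, hG⟩ := ih
    have hp := prime_linForm (hl.ne_zero k)
    have hkE := hE k
    rw [hG] at hkE
    have hkG := (hp.dvd_or_dvd hkE).resolve_left fun h => by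
      obtain ⟨j, hj, hjk⟩ := (hp.dvd_finsetProd_iff _).mp h
      exact hl.not_dvd (by rintro rfl; exact hk hj) hjk
    rw [Finset.prod_insert hk, hG, mul_comm]
    exact mul_dvd_mul_left _ hkG

theorem isHomogeneous_prod_linForm (l : Fin 6 → Fin 3 → ℂ) :
    (∏ k, linForm (l k)).IsHomogeneous 6 := by
  have := IsHomogeneous.prod Finset.univ (fun k => linForm (l k)) (fun _ => 1)
    fun k _ => isHomogeneous_linForm (l k)
  simpa using this

theorem IsGeneralPosition.prod_linForm_ne_zero {l : Fin 6 → Fin 3 → ℂ}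
    (hl : IsGeneralPosition l) : ∏ k, linForm (l k) ≠ 0 :=
  Finset.prod_ne_zero_iff.mpr fun k _ => linForm_ne_zero (hl.ne_zero k)

/-- A form divisible by the product of the six lines has degree at least six, and is a multiple of
the product if its degree is six. -/
theorem IsGeneralPosition.eq_C_mul_prod {l : Fin 6 → Fin 3 → ℂ} (hl : IsGeneralPosition l) {n : ℕ}
    {E : MvPolynomial (Fin 3) ℂ} (hE : E.IsHomogeneous n) (hE0 : E ≠ 0)
    (hdvd : ∏ k, linForm (l k) ∣ E) : 6 ≤ n ∧ (n = 6 → ∃ c : ℂ, c ≠ 0 ∧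
      E = C c * ∏ k, linForm (l k)) := by
  obtain ⟨G, rfl⟩ := hdvd
  have hG0 : G ≠ 0 := right_ne_zero_of_mul hE0
  have hdeg := hE.totalDegree hE0
  rw [totalDegree_mul_of_isDomain hl.prod_linForm_ne_zero hG0,
    (isHomogeneous_prod_linForm l).totalDegree hl.prod_linForm_ne_zero] at hdeg
  refine ⟨by omega, fun hn => ⟨coeff 0 G, ?_, ?_⟩⟩
  · intro h
    have hG : G = C (coeff 0 G) := totalDegree_eq_zero_iff_eq_C.mp (by omega)
    rw [h, C_0] at hG
    exact hG0 hG
  · have hG : G = C (coeff 0 G) := totalDegree_eq_zero_iff_eq_C.mp (by omega)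
    rw [← hG, mul_comm]

/-- Cramer's rule for the coordinates of a vector in the basis dual to three linear forms. -/
theorem det_smul_eq (a b c x : Fin 3 → ℂ) : (a ⬝ᵥ crossProduct b c) • x =
    (a ⬝ᵥ x) • crossProduct b c + (b ⬝ᵥ x) • crossProduct c a + (c ⬝ᵥ x) • crossProduct a b := by
  funext i
  fin_cases i <;> simp [cross_apply, dotProduct, Fin.sum_univ_three] <;> ring

/-- A form vanishing on the limits of the family near the edge `k` vanishes on the line `k`. -/
theorem IsGeneralPosition.linForm_dvd {l : Fin 6 → Fin 3 → ℂ} (hl : IsGeneralPosition l)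
    (q : Fin 3 → ℂ) {n : ℕ} {E : MvPolynomial (Fin 3) ℂ} (hE : E.IsHomogeneous n) {k : Fin 6}
    (h0 : ∀ s, eval (hexProj l q (psiChart k s 0)) E = 0) : linForm (l k) ∣ E := by
  have hk1 : k ≠ k + 1 := (by decide : ∀ k : Fin 6, k ≠ k + 1) k
  have hk2 : k ≠ k - 1 := (by decide : ∀ k : Fin 6, k ≠ k - 1) k
  have hk3 : k - 1 ≠ k + 1 := (by decide : ∀ k : Fin 6, k - 1 ≠ k + 1) k
  -- the points of the line off the two neighbouring lines are limit points
  have hmul : linForm (l k) ∣ E * linForm (l (k - 1)) * linForm (l (k + 1)) := by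
    refine linForm_dvd_of_eval_eq_zero (hl.ne_zero k) fun x hx => ?_
    rw [map_mul, map_mul, eval_linForm, eval_linForm]
    by_cases ha : l (k - 1) ⬝ᵥ x = 0
    · rw [ha, mul_zero, zero_mul]
    by_cases hb : l (k + 1) ⬝ᵥ x = 0
    · rw [hb, mul_zero]
    have hdet : l (k - 1) ⬝ᵥ crossProduct (l k) (l (k + 1)) ≠ 0 :=
      hl.dot_cross_ne_zero hk2.symm hk3 hk1
    have hx' := det_smul_eq (l (k - 1)) (l k) (l (k + 1)) x
    have hv1 : crossProduct (l k) (l (k + 1)) = vertex l k := rfl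
    have hv2 : crossProduct (l (k - 1)) (l k) = vertex l (k - 1) := by
      rw [vertex, sub_add_cancel]
    rw [hx, zero_smul, add_zero, hv1, hv2] at hx'
    rw [hv1] at hdet
    obtain ⟨c, hc, hc0⟩ : ∃ c, c = (![1, 1, 1, -1, -1, -1] : Fin 6 → ℂ) k ∧ c ≠ 0 :=
      ⟨_, rfl, by fin_cases k <;> simp⟩
    obtain ⟨d, hd, hd0⟩ : ∃ d, d = (![1, 1, -1, -1, -1, 1] : Fin 6 → ℂ) k ∧ d ≠ 0 :=
      ⟨_, rfl, by fin_cases k <;> simp⟩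
    let s := (l (k + 1) ⬝ᵥ x) * d / ((l (k - 1) ⬝ᵥ x) * c)
    have hs0 : s ≠ 0 := div_ne_zero (mul_ne_zero hb hd0) (mul_ne_zero ha hc0)
    have hpoint : hexProj l q (psiChart k s 0) = (s ^ (5 - (k : ℕ)) * (d / (l (k - 1) ⬝ᵥ x)) *
        (l (k - 1) ⬝ᵥ vertex l k)) • x := by
      rw [mul_smul, hx', hexProj_psiChart_zero, ← hc, ← hd, mul_smul (s ^ (5 - (k : ℕ)))]
      congr 1
      have hcs : c * s = d / (l (k - 1) ⬝ᵥ x) * (l (k + 1) ⬝ᵥ x) := by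
        simp only [s]
        field_simp
      rw [hcs, smul_add, smul_smul, smul_smul, div_mul_cancel₀ _ ha, add_comm]
    have h1 := h0 s
    rw [hpoint, IsHomogeneous.eval_smul hE] at h1
    rw [(mul_eq_zero.mp h1).resolve_left (pow_ne_zero _ (mul_ne_zero (mul_ne_zero
      (pow_ne_zero _ hs0) (div_ne_zero hd0 ha)) hdet)), zero_mul, zero_mul]
  have hp := prime_linForm (hl.ne_zero k)
  exact (hp.dvd_or_dvd ((hp.dvd_or_dvd hmul).resolve_right (hl.not_dvd hk1.symm))).resolve_right
    (hl.not_dvd hk2.symm)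

theorem continuous_eval_specialize {w : ℂ → Fin 3 → ℂ} (hw : Continuous w)
    (P : MvPolynomial (Fin 3) (Polynomial ℂ)) :
    Continuous fun t => eval (w t) (specialize t P) := by
  have h : ∀ t, eval (w t) (specialize t P) =
      ∑ m ∈ P.support, (coeff m P).eval t * ∏ i, w t i ^ m i := by
    intro t
    rw [specialize, eval_map, eval₂_eq']
    rfl
  simp only [h]
  refine continuous_finsetSum _ fun m _ => (Polynomial.continuous _).mul
    (continuous_finsetProd _ fun i _ => ((continuous_apply i).comp hw).pow _)

/-- The limit of a family of curves containing the members of the projected family contains the six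
lines. -/
theorem IsGeneralPosition.prod_dvd_specialize_zero {l : Fin 6 → Fin 3 → ℂ}
    (hl : IsGeneralPosition l) (q : Fin 3 → ℂ) {n : ℕ} {P : MvPolynomial (Fin 3) (Polynomial ℂ)}
    (hP : P.IsHomogeneous n) (hφ : aeval (family l q) P = 0) :
    ∏ k, linForm (l k) ∣ specialize 0 P := by
  have hhom : ∀ t, (specialize t P).IsHomogeneous n := fun t => hP.map _
  refine hl.prod_dvd fun k => hl.linForm_dvd q (hhom 0) fun s => ?_
  have hcont : Continuous fun t => eval (hexProj l q (psiChart k s t)) (specialize t P) := by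
    refine continuous_eval_specialize ?_ P
    have h := (contDiff_hexProj_psiChart l q k).continuous
    obtain ⟨f, hf⟩ : ∃ f : ℂ × ℂ → Fin 3 → ℂ, f = fun x => hexProj l q (psiChart k x.1 x.2) :=
      ⟨_, rfl⟩
    have e : ∀ s t, hexProj l q (psiChart k s t) = f (s, t) := fun s t => by rw [hf]
    rw [← hf] at h
    simp only [e]
    exact h.comp (continuous_const.prodMk continuous_id)
  have hev : ∀ᶠ t in 𝓝[≠] (0 : ℂ),
      eval (hexProj l q (psiChart k s t)) (specialize t P) = 0 := by
    filter_upwards [self_mem_nhdsWithin, nhdsWithin_le_nhds (eventually_one_add_ne_zero k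
      (σ := fun _ => s) tendsto_const_nhds)] with t ht hs
    obtain ⟨c, hc0, hc⟩ := pt_member_chartParam l q k ht hs
    have h1 := congrArg (Polynomial.eval (chartParam k s t)) (aeval_specialize hφ t)
    rw [eval_aeval_polynomial, Polynomial.eval_zero] at h1
    change eval (pt (member l q t) (chartParam k s t)) (specialize t P) = 0 at h1
    rw [hc, IsHomogeneous.eval_smul (hhom t)] at h1
    exact (mul_eq_zero.mp h1).resolve_left (pow_ne_zero _ hc0)
  have h2 := (hcont.tendsto 0).mono_left (nhdsWithin_le_nhds (s := {0}ᶜ))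
  exact tendsto_nhds_unique h2 ((Filter.tendsto_congr' hev).mpr tendsto_const_nhds)

/-! ### The degeneration of ten-nodal sextics to the six lines -/

theorem hexEq_edge (k : Fin 6) (a b : ℂ) : HexEq (a • Pi.single (k - 1).castSucc (1 : ℂ) +
    b • Pi.single k.castSucc (1 : ℂ) : Fin 7 → ℂ) := by
  have hneg : (-1 : Fin 6).castSucc = (5 : Fin 7) := rfl
  fin_cases k <;> constructor <;> simp [hneg]

theorem psiHyperplane_zero : psiHyperplane (0 : ℂ) = Pi.single 6 1 := by
  funext i
  fin_cases i <;> simp [psiHyperplane]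

/-- The union of the six lines is the projection of the hexagon. -/
theorem IsGeneralPosition.setOf_prod_eq_image {l : Fin 6 → Fin 3 → ℂ} (hl : IsGeneralPosition l)
    {q : Fin 3 → ℂ} (hq : ∀ v : Fin 7 → ℂ, HexEq v → v 6 ≠ 0 → hexProj l q v ≠ 0) :
    {w | w ≠ 0 ∧ eval w (∏ k, linForm (l k)) = 0} =
      hexProj l q '' {v | v ∈ hexCone ∧ ∑ i, psiHyperplane (0 : ℂ) i * v i = 0} := by
  have hsum : ∀ v : Fin 7 → ℂ, ∑ i, psiHyperplane (0 : ℂ) i * v i = v 6 := fun v => by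
    rw [psiHyperplane_zero, Finset.sum_eq_single 6]
    · simp
    · intro j _ hj
      simp [hj]
    · simp
  ext w
  simp only [Set.mem_ofPred_eq, Set.mem_image, hsum, map_prod, eval_linForm,
    Finset.prod_eq_zero_iff, Finset.mem_univ, true_and]
  constructor
  · rintro ⟨hw, k, hk⟩
    have hdet : l (k - 1) ⬝ᵥ crossProduct (l k) (l (k + 1)) ≠ 0 :=
      hl.dot_cross_ne_zero ((by decide : ∀ k : Fin 6, k - 1 ≠ k) k)
        ((by decide : ∀ k : Fin 6, k - 1 ≠ k + 1) k) ((by decide : ∀ k : Fin 6, k ≠ k + 1) k)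
    have hw' := det_smul_eq (l (k - 1)) (l k) (l (k + 1)) w
    have hv2 : crossProduct (l (k - 1)) (l k) = vertex l (k - 1) := by
      rw [vertex, sub_add_cancel]
    generalize l (k - 1) ⬝ᵥ crossProduct (l k) (l (k + 1)) = δ at hdet hw'
    have hv1 : crossProduct (l k) (l (k + 1)) = vertex l k := rfl
    rw [hk, zero_smul, add_zero, hv1, hv2] at hw'
    let v : Fin 7 → ℂ := (δ⁻¹ * (l (k + 1) ⬝ᵥ w)) • Pi.single (k - 1).castSucc (1 : ℂ) +
      (δ⁻¹ * (l (k - 1) ⬝ᵥ w)) • Pi.single k.castSucc (1 : ℂ)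
    have hv : hexProj l q v = w := by
      rw [map_add, map_smul, map_smul, hexProj_single, hexProj_single, mul_smul, mul_smul,
        ← smul_add, add_comm, ← hw', inv_smul_smul₀ hdet]
    refine ⟨v, ⟨⟨fun h => hw ?_, hexEq_edge k _ _⟩, ?_⟩, hv⟩
    · rw [← hv, h, map_zero]
    · have h6 : ∀ j : Fin 6, (6 : Fin 7) ≠ j.castSucc := by decide
      simp [v, Pi.single_eq_of_ne (h6 _)]
  · rintro ⟨v, ⟨hv, h6⟩, rfl⟩
    refine ⟨hl.hexProj_ne_zero hq hv, ?_⟩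
    obtain ⟨j, hj⟩ := hv.2.exists_edge h6
    refine ⟨j, ?_⟩
    rw [hexProj_apply, h6, zero_smul, add_zero, dotProduct_sum]
    refine Finset.sum_eq_zero fun i _ => ?_
    rw [dotProduct_smul]
    by_cases h1 : i = j - 1
    · rw [h1, dot_vertex_pred, smul_zero]
    by_cases h2 : i = j
    · rw [h2, dot_vertex_self, smul_zero]
    · rw [hj _ (fun h => h1 (Fin.castSucc_injective _ h))
        (fun h => h2 (Fin.castSucc_injective _ h)), zero_smul]

theorem IsGeneralPosition.hexProj_surjective {l : Fin 6 → Fin 3 → ℂ} (hl : IsGeneralPosition l)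
    {q : Fin 3 → ℂ} (hq : ∀ v : Fin 7 → ℂ, HexEq v → v 6 ≠ 0 → hexProj l q v ≠ 0) :
    Function.Surjective (hexProj l q) := by
  have hline : ∀ w, l 0 ⬝ᵥ w = 0 → ∃ v, hexProj l q v = w := by
    intro w hw
    by_cases h0 : w = 0
    · exact ⟨0, by rw [map_zero, h0]⟩
    have hmem : w ∈ {w | w ≠ 0 ∧ eval w (∏ k, linForm (l k)) = 0} := by
      refine ⟨h0, ?_⟩
      rw [map_prod]
      exact Finset.prod_eq_zero (Finset.mem_univ 0) (by rw [eval_linForm, hw])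
    rw [hl.setOf_prod_eq_image hq] at hmem
    obtain ⟨v, -, hv⟩ := hmem
    exact ⟨v, hv⟩
  -- The vertex `2` of the hexagon is projected off the line `0`.
  have hdet : l 0 ⬝ᵥ vertex l 2 ≠ 0 := hl.dot_cross_ne_zero (by decide) (by decide) (by decide)
  intro w
  obtain ⟨v, hv⟩ := hline (w - (l 0 ⬝ᵥ w / l 0 ⬝ᵥ vertex l 2) • vertex l 2) (by
    rw [dotProduct_sub, dotProduct_smul, smul_eq_mul, div_mul_cancel₀ _ hdet, sub_self])
  refine ⟨v + (l 0 ⬝ᵥ w / l 0 ⬝ᵥ vertex l 2) • Pi.single (Fin.castSucc 2) (1 : ℂ), ?_⟩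
  rw [map_add, map_smul, hexProj_single, hv, sub_add_cancel]

theorem finite_not_isGenericParameter : {t : ℂ | ¬ IsGenericParameter t}.Finite := by
  have h : {t : ℂ | ¬ IsGenericParameter t} ⊆
      {0} ∪ ⋃ k ∈ Finset.Icc 1 7, {t : ℂ | (Polynomial.X ^ k - 1 : Polynomial ℂ).IsRoot t} := by
    intro t ht
    by_contra hcon
    simp only [Set.mem_union, Set.mem_singleton_iff, Set.mem_iUnion, not_or, not_exists] at hcon
    refine ht ⟨hcon.1, fun k h1 h7 hk => hcon.2 k (Finset.mem_Icc.mpr ⟨h1, h7⟩) ?_⟩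
    simp [hk]
  refine Set.Finite.subset ((Set.finite_singleton 0).union
    ((Finset.Icc 1 7).finite_toSet.biUnion fun k hk => ?_)) h
  refine Polynomial.finite_setOfPred_isRoot ?_
  have := Polynomial.X_pow_sub_C_ne_zero (R := ℂ) (n := k) (by
    have := (Finset.mem_Icc.mp (Finset.mem_coe.mp hk)).1
    omega) 1
  simpa using this

theorem IsGenericParameter.pt_member_ne_zero {t : ℂ} (ht : IsGenericParameter t)
    {l : Fin 6 → Fin 3 → ℂ} {q : Fin 3 → ℂ} (hpr : ∀ v ∈ hexCone, hexProj l q v ≠ 0) (z : ℂ) :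
    pt (member l q t) z ≠ 0 := by
  rw [pt_member]
  refine hpr _ ⟨ht.psi_ne_zero ?_, hexEq_psi _ _ _⟩
  by_contra! h
  have := h.2
  rw [h.1, mul_zero, sub_zero] at this
  exact one_ne_zero this

/-- The plane curve with parametrization `member l q t` is the projection of the hyperplane section
of the toric surface. -/
theorem IsGenericParameter.setOf_eval_eq_image {t : ℂ} (ht : IsGenericParameter t)
    {l : Fin 6 → Fin 3 → ℂ} {q : Fin 3 → ℂ} (hpr : ∀ v ∈ hexCone, hexProj l q v ≠ 0)
    {u v : Fin 10 → ℂ} (h : IsTenNodalParam (member l q t) u v) {D : MvPolynomial (Fin 3) ℂ}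
    (hD : D.IsHomogeneous 6) (hD0 : D ≠ 0) (hφ : aeval (member l q t) D = 0) :
    {w | w ≠ 0 ∧ eval w D = 0} =
      hexProj l q '' {v | v ∈ hexCone ∧ ∑ i, psiHyperplane t i * v i = 0} := by
  ext w
  simp only [Set.mem_ofPred_eq, Set.mem_image, ht.mem_hyperplane_iff]
  constructor
  · rintro ⟨hw, hwD⟩
    have key : ∀ x y : ℂ, (x ≠ 0 ∨ y ≠ 0) → crossProduct w (hexProj l q (psi t x y)) = 0 →
        ∃ v, (∃ x y c : ℂ, (x ≠ 0 ∨ y ≠ 0) ∧ c ≠ 0 ∧ v = c • psi t x y) ∧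
          hexProj l q v = w := by
      intro x y hxy hc
      have hne := hpr _ ⟨ht.psi_ne_zero hxy, hexEq_psi _ _ _⟩
      obtain ⟨c, hc⟩ := exists_smul_of_cross_eq_zero hne (cross_eq_zero_symm hc)
      refine ⟨c • psi t x y, ⟨x, y, c, hxy, ?_, rfl⟩, by rw [map_smul, hc]⟩
      rintro rfl
      rw [zero_smul] at hc
      exact hw hc
    rcases (h.eval_eq_zero_iff hD hD0 hφ hw).mp hwD with ⟨z, hz⟩ | hz
    · rw [pt_member] at hz
      refine key _ _ ?_ hz
      by_contra! h0
      have := h0.2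
      rw [h0.1, mul_zero, sub_zero] at this
      exact one_ne_zero this
    · rw [coeff_member] at hz
      exact key _ _ (Or.inl one_ne_zero) hz
  · rintro ⟨v, ⟨x, y, c, hxy, hc, rfl⟩, rfl⟩
    have hw : hexProj l q (c • psi t x y) ≠ 0 := by
      rw [map_smul]
      exact smul_ne_zero hc (hpr _ ⟨ht.psi_ne_zero hxy, hexEq_psi _ _ _⟩)
    refine ⟨hw, (h.eval_eq_zero_iff hD hD0 hφ hw).mpr ?_⟩
    by_cases hd : y + t ^ 2 * x = 0
    · right
      have hy : y = x * (-t ^ 2) := by linear_combination hd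
      have hp : psi t x y = x ^ 6 • psi t 1 (-t ^ 2) := by rw [← psi_smul, mul_one, hy]
      rw [coeff_member, hp, map_smul, map_smul, map_smul, map_smul, LinearMap.smul_apply,
        LinearMap.smul_apply, cross_self, smul_zero, smul_zero]
    · left
      refine ⟨x / (y + t ^ 2 * x), ?_⟩
      have hp : psi t x y = (y + t ^ 2 * x) ^ 6 •
          psi t (x / (y + t ^ 2 * x)) (1 - t ^ 2 * (x / (y + t ^ 2 * x))) := by
        rw [← psi_smul, mul_div_cancel₀ _ hd]
        congr 1
        field_simp
        ring
      rw [pt_member, hp, map_smul, map_smul, map_smul, map_smul, LinearMap.smul_apply,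
        LinearMap.smul_apply, cross_self, smul_zero, smul_zero]

/-- Six general lines are the limit of a one-parameter family of sextics that, outside a finite set
of parameters, are integral with ten nodes and projections of hyperplane sections of the toric
surface. -/
theorem IsGeneralPosition.exists_degeneration {l : Fin 6 → Fin 3 → ℂ} (hl : IsGeneralPosition l) :
    ∃ (π : (Fin 7 → ℂ) →ₗ[ℂ] (Fin 3 → ℂ)) (P : MvPolynomial (Fin 3) (Polynomial ℂ)),
      Function.Surjective π ∧ (∀ v ∈ hexCone, π v ≠ 0) ∧ P.IsHomogeneous 6 ∧
      (∀ t, specialize t P ≠ 0) ∧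
      specialize 0 P = ∏ k, linForm (l k) ∧
      {w | w ≠ 0 ∧ eval w (specialize 0 P) = 0} =
        π '' {v | v ∈ hexCone ∧ ∑ i, psiHyperplane (0 : ℂ) i * v i = 0} ∧
      {t | ¬ (psiHyperplane t ≠ 0 ∧ IsIntegralTenNodalSextic (specialize t P) ∧
        {w | w ≠ 0 ∧ eval w (specialize t P) = 0} =
          π '' {v | v ∈ hexCone ∧ ∑ i, psiHyperplane t i * v i = 0})}.Finite := by
  obtain ⟨q, hq⟩ := exists_hexProj l
  have hpr : ∀ v ∈ hexCone, hexProj l q v ≠ 0 := fun v hv => hl.hexProj_ne_zero hq hv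
  obtain ⟨f, hf0, hf⟩ := exists_forall_hasTenNodes (family l q)
    (infinite_of_eventually_nhdsNE (hl.eventually_exists_hasTenNodes q))
  -- off `Bad` the curve has ten double points and the description by a hyperplane holds; off
  -- `Quart` it lies on no quartic
  let Bad : Set ℂ := {t | ¬ IsGenericParameter t} ∪ {t | f.IsRoot t}
  have hBad : Bad.Finite := finite_not_isGenericParameter.union
    (Polynomial.finite_setOfPred_isRoot hf0)
  obtain ⟨P, hP, hP0, hPφ⟩ := exists_family_of_forms 6 (family l q)
    ((hBad.infinite_compl).mono fun t ht => by
      simp only [Bad, Set.mem_compl_iff, Set.mem_union, Set.mem_ofPred_eq, not_or, not_not] at ht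
      obtain ⟨u, v, huv⟩ := hf t ht.2
      exact huv.exists_sextic (natDegree_member_le l q t) (ht.1.pt_member_ne_zero hpr))
  let Quart : Set ℂ := {t | ∃ E : MvPolynomial (Fin 3) ℂ, E.IsHomogeneous 4 ∧ E ≠ 0 ∧
    aeval (curveAt (family l q) t) E = 0}
  -- a family of quartics would have a limit divisible by the product of the six linear forms
  have hQuart : Quart.Finite := by
    by_contra hinf
    obtain ⟨E, hE, hE0, hEφ⟩ := exists_family_of_forms 4 (family l q) hinf
    have := (hl.eq_C_mul_prod (hE.map _) (hE0 0) (hl.prod_dvd_specialize_zero q hE hEφ)).1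
    omega
  -- `P` is divided by the factor `c` by which its value at `0` differs from the product
  obtain ⟨c, hc, hPc⟩ := (hl.eq_C_mul_prod (hP.map _) (hP0 0)
    (hl.prod_dvd_specialize_zero q hP hPφ)).2 rfl
  have hspec : ∀ t, specialize t (C (Polynomial.C c⁻¹) * P) = C c⁻¹ * specialize t P := fun t => by
    rw [specialize, map_mul, map_C, Polynomial.coe_evalRingHom, Polynomial.eval_C]
    rfl
  have hne : ∀ t, specialize t (C (Polynomial.C c⁻¹) * P) ≠ 0 := fun t => by
    rw [hspec]
    exact mul_ne_zero (by simpa using hc) (hP0 t)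
  have h0 : specialize 0 (C (Polynomial.C c⁻¹) * P) = ∏ k, linForm (l k) := by
    have hPc' : specialize 0 P = C c * ∏ k, linForm (l k) := hPc
    rw [hspec, hPc', ← mul_assoc, ← C_mul, inv_mul_cancel₀ hc, C_1, one_mul]
  refine ⟨hexProj l q, C (Polynomial.C c⁻¹) * P, hl.hexProj_surjective hq, hpr, ?_, hne, h0, ?_, ?_⟩
  · have := (isHomogeneous_C (Fin 3) (Polynomial.C c⁻¹)).mul hP
    rwa [zero_add] at this
  · rw [h0]
    exact hl.setOf_prod_eq_image hq
  · refine (hBad.union hQuart).subset fun t ht => ?_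
    by_contra hcon
    simp only [Bad, Set.mem_union, Set.mem_ofPred_eq, not_or, not_not] at hcon
    obtain ⟨⟨hgen, hft⟩, hquart⟩ := hcon
    obtain ⟨u, v, huv⟩ := hf t hft
    have hparam : IsTenNodalParam (member l q t) u v :=
      { natDegree_le := natDegree_member_le l q t
        pt_ne_zero := hgen.pt_member_ne_zero hpr
        lead_ne_zero := by
          rw [coeff_member]
          exact hpr _ ⟨hgen.psi_ne_zero (Or.inl one_ne_zero), hexEq_psi _ _ _⟩
        quartic := fun E hE hEφ => by
          by_contra hE0
          exact hquart ⟨E, hE, hE0, hEφ⟩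
        ne := huv.ne
        cross_eq_zero := huv.cross_eq_zero
        cross_ne_zero := huv.cross_ne_zero }
    have hφ : aeval (member l q t) (specialize t (C (Polynomial.C c⁻¹) * P)) = 0 := by
      rw [hspec, map_mul]
      have : aeval (member l q t) (specialize t P) = 0 := aeval_specialize hPφ t
      rw [this, mul_zero]
    have hhom : (specialize t (C (Polynomial.C c⁻¹) * P)).IsHomogeneous 6 := by
      have := (isHomogeneous_C (Fin 3) c⁻¹).mul (hP.map (Polynomial.evalRingHom t))
      rw [zero_add] at this
      rw [hspec]
      exact this
    exact ht ⟨fun h => hgen.psiHyperplane_ne_zero 0 (congrFun h _),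
      hparam.isIntegralTenNodalSextic hhom (hne t) hφ,
      hgen.setOf_eval_eq_image hpr hparam hhom (hne t) hφ⟩

/-! ### Flat families over open subsets of the affine line -/

theorem isPrincipalIdealRing_of_isLocalization {R : Type*} [CommRing R] [IsPrincipalIdealRing R]
    (M : Submonoid R) (S : Type*) [CommRing S] [Algebra R S] [IsLocalization M S] :
    IsPrincipalIdealRing S := by
  refine ⟨fun J =>
    ⟨algebraMap R S (Submodule.IsPrincipal.generator (J.comap (algebraMap R S))), ?_⟩⟩
  rw [Ideal.submodule_span_eq, ← Set.image_singleton, ← Ideal.map_span,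
    Ideal.span_singleton_generator, IsLocalization.map_under M]

/-- The weak Nullstellensatz for a finitely generated `ℂ`-algebra. -/
theorem exists_algHom_apply_eq_zero {A : Type*} [CommRing A] [Algebra ℂ A]
    [Algebra.FiniteType ℂ A] {a : A} (ha : ¬ IsUnit a) : ∃ φ : A →ₐ[ℂ] ℂ, φ a = 0 := by
  obtain ⟨m, hm, ham⟩ := exists_max_ideal_of_mem_nonunits ha
  let : Field (A ⧸ m) := Ideal.Quotient.field m
  have : Algebra.FiniteType ℂ (A ⧸ m) := inferInstance
  have : Module.Finite ℂ (A ⧸ m) := finite_of_finite_type_of_isJacobsonRing ℂ (A ⧸ m)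
  let e : ℂ ≃ₐ[ℂ] (A ⧸ m) := AlgEquiv.ofBijective (Algebra.ofId ℂ (A ⧸ m))
    (IsAlgClosed.algebraMap_bijective_of_isIntegral (k := ℂ) (K := A ⧸ m))
  refine ⟨(e.symm : (A ⧸ m) →ₐ[ℂ] ℂ).comp (Ideal.Quotient.mkₐ ℂ m), ?_⟩
  simp [Ideal.Quotient.eq_zero_iff_mem.mpr ham]

/-- Over a principal ideal domain, a hypersurface none of whose fibres is the whole space is flat:
a prime `p` of the base is prime in the polynomial ring and does not divide the equation, so the
quotient has no torsion. -/
theorem flat_quotient_of_forall_map_ne_zero {A : Type*} [CommRing A] [IsDomain A]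
    [IsPrincipalIdealRing A] [Algebra ℂ A] [Algebra.FiniteType ℂ A] {σ : Type*}
    {P : MvPolynomial σ A} (hP : ∀ φ : A →ₐ[ℂ] ℂ, map (φ : A →+* ℂ) P ≠ 0) :
    Module.Flat A (MvPolynomial σ A ⧸ Ideal.span {P}) := by
  have key : ∀ a : A, a ≠ 0 → ∀ G : MvPolynomial σ A, P ∣ C a * G → P ∣ G := by
    intro a
    induction a using UniqueFactorizationMonoid.induction_on_prime with
    | h₁ => exact fun h => absurd rfl h
    | h₂ a ha => exact fun _ G h => (ha.map C).dvd_mul_left.mp h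
    | h₃ a p ha hp ih =>
      intro _ G h
      refine ih ha G ?_
      rw [C_mul, mul_assoc] at h
      obtain ⟨K, hK⟩ := h
      have hpC : Prime (C p : MvPolynomial σ A) := (prime_C_iff σ).mpr hp
      have hpP : ¬ C p ∣ P := by
        rintro ⟨R, rfl⟩
        obtain ⟨φ, hφ⟩ := exists_algHom_apply_eq_zero hp.not_isUnit
        refine hP φ ?_
        have : (φ : A →+* ℂ) p = 0 := hφ
        rw [map_mul, map_C, this, C_0, zero_mul]
      obtain ⟨K', rfl⟩ := (hpC.dvd_or_dvd ⟨_, hK.symm⟩).resolve_left hpP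
      refine ⟨K', mul_left_cancel₀ hpC.ne_zero ?_⟩
      rw [hK]
      ring
  rw [IsDedekindDomain.flat_iff_torsion_eq_bot, eq_bot_iff]
  intro x hx
  obtain ⟨⟨a, ha⟩, hax⟩ := hx
  obtain ⟨G, rfl⟩ := Ideal.Quotient.mk_surjective x
  have h1 : Ideal.Quotient.mk (Ideal.span {P}) (C a * G) = 0 := by
    rw [← smul_eq_C_mul]
    exact hax
  rw [Ideal.Quotient.eq_zero_iff_mem, Ideal.mem_span_singleton] at h1
  exact Ideal.Quotient.eq_zero_iff_mem.mpr
    (Ideal.mem_span_singleton.mpr (key a (nonZeroDivisors.ne_zero ha) G h1))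

section AffineLine

variable {f : Polynomial ℂ}

/-- The open subset `f ≠ 0` of the affine line, pointed at the origin. -/
def puncturedLine (f : Polynomial ℂ) (hf : f.eval 0 ≠ 0) : PointedCurve :=
  have hf0 : f ≠ 0 := fun h => hf (by rw [h, Polynomial.eval_zero])
  have hM : Submonoid.powers f ≤ nonZeroDivisors (Polynomial ℂ) :=
    powers_le_nonZeroDivisors_of_noZeroDivisors hf0
  have : IsDomain (Localization.Away f) := IsLocalization.isDomain_localization hM
  { A := Localization.Away f
    finiteType := Algebra.FiniteType.trans (S := Polynomial ℂ) inferInstance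
      (IsLocalization.finiteType_of_monoid_fg (Submonoid.powers f) (Localization.Away f))
    isDedekindDomain := IsLocalization.isDedekindDomain (Polynomial ℂ) hM (Localization.Away f)
    not_isField := fun hfield => by
      let φ : Localization.Away f →+* ℂ := IsLocalization.Away.lift f
        (g := Polynomial.evalRingHom 0) (isUnit_iff_ne_zero.mpr hf)
      have hX : algebraMap (Polynomial ℂ) (Localization.Away f) Polynomial.X ≠ 0 := by
        rw [Ne, IsLocalization.to_map_eq_zero_iff _ hM]
        exact Polynomial.X_ne_zero
      obtain ⟨b, hb⟩ := hfield.mul_inv_cancel hX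
      have := congrArg φ hb
      rw [map_mul, map_one, IsLocalization.Away.lift_eq, Polynomial.coe_evalRingHom,
        Polynomial.eval_X, zero_mul] at this
      exact zero_ne_one this
    o := IsLocalization.Away.liftAlgHom f (f := Polynomial.aeval (0 : ℂ))
      (isUnit_iff_ne_zero.mpr (by rwa [Polynomial.coe_aeval_eq_eval])) }

/-- The restriction of functions from the affine line. -/
def puncturedLine.res (f : Polynomial ℂ) (hf : f.eval 0 ≠ 0) :
    Polynomial ℂ →+* (puncturedLine f hf).A :=
  algebraMap (Polynomial ℂ) (Localization.Away f)

/-- The coordinate of a point of the punctured line. -/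
def puncturedLine.coord {hf : f.eval 0 ≠ 0} (φ : (puncturedLine f hf).A →ₐ[ℂ] ℂ) : ℂ :=
  φ (puncturedLine.res f hf Polynomial.X)

theorem puncturedLine.comp_res {hf : f.eval 0 ≠ 0} (φ : (puncturedLine f hf).A →ₐ[ℂ] ℂ) :
    (φ : (puncturedLine f hf).A →+* ℂ).comp (puncturedLine.res f hf) =
      Polynomial.evalRingHom (puncturedLine.coord φ) := by
  refine Polynomial.ringHom_ext (fun c => ?_) ?_
  · have h : puncturedLine.res f hf (Polynomial.C c) =
        algebraMap ℂ (puncturedLine f hf).A c := by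
      rw [Polynomial.C_eq_algebraMap]
      exact (IsScalarTower.algebraMap_apply ℂ (Polynomial ℂ) (Localization.Away f) c).symm
    rw [RingHom.comp_apply, h, Polynomial.coe_evalRingHom, Polynomial.eval_C]
    exact φ.commutes c
  · rw [Polynomial.coe_evalRingHom, Polynomial.eval_X]
    rfl

theorem puncturedLine.eval_coord_ne_zero {hf : f.eval 0 ≠ 0} (φ : (puncturedLine f hf).A →ₐ[ℂ] ℂ) :
    f.eval (puncturedLine.coord φ) ≠ 0 := by
  have h : IsUnit (puncturedLine.res f hf f) :=
    IsLocalization.Away.algebraMap_isUnit (S := Localization.Away f) f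
  have h2 := (h.map (φ : (puncturedLine f hf).A →+* ℂ)).ne_zero
  rwa [← RingHom.comp_apply, puncturedLine.comp_res] at h2

theorem puncturedLine.coord_base {hf : f.eval 0 ≠ 0} :
    puncturedLine.coord (puncturedLine f hf).o = 0 := by
  have : puncturedLine.coord (puncturedLine f hf).o = Polynomial.aeval (0 : ℂ) Polynomial.X :=
    IsLocalization.Away.lift_eq (S := Localization.Away f) f
      (isUnit_iff_ne_zero.mpr (by simpa [Polynomial.coe_aeval_eq_eval] using hf)) _
  rw [this, Polynomial.aeval_X]

theorem puncturedLine.coord_injective {hf : f.eval 0 ≠ 0} :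
    Function.Injective (puncturedLine.coord (f := f) (hf := hf)) := by
  intro φ ψ h
  have h1 := puncturedLine.comp_res φ
  rw [h, ← puncturedLine.comp_res ψ] at h1
  have h2 : (φ : (puncturedLine f hf).A →+* ℂ) = (ψ : (puncturedLine f hf).A →+* ℂ) :=
    IsLocalization.ringHom_ext (R := Polynomial ℂ) (S := Localization.Away f)
      (Submonoid.powers f) h1
  exact AlgHom.coe_ringHom_injective h2

theorem puncturedLine.fiber_map {hf : f.eval 0 ≠ 0} (P : MvPolynomial (Fin 3) (Polynomial ℂ))
    (φ : (puncturedLine f hf).A →ₐ[ℂ] ℂ) :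
    (puncturedLine f hf).fiber (map (puncturedLine.res f hf) P) φ =
      specialize (puncturedLine.coord φ) P := by
  rw [PointedCurve.fiber, map_map, puncturedLine.comp_res, specialize]

theorem puncturedLine.isFlatFamilyOfSextics {hf : f.eval 0 ≠ 0}
    {P : MvPolynomial (Fin 3) (Polynomial ℂ)} (hP : P.IsHomogeneous 6)
    (hP0 : ∀ t, specialize t P ≠ 0) :
    (puncturedLine f hf).IsFlatFamilyOfSextics (map (puncturedLine.res f hf) P) := by
  have hne : ∀ φ, (puncturedLine f hf).fiber (map (puncturedLine.res f hf) P) φ ≠ 0 := fun φ => by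
    rw [puncturedLine.fiber_map]
    exact hP0 _
  refine ⟨hP.map _, hne, ?_⟩
  have := (puncturedLine f hf).isDedekindDomain
  have := (puncturedLine f hf).finiteType
  have : IsPrincipalIdealRing (puncturedLine f hf).A :=
    isPrincipalIdealRing_of_isLocalization (Submonoid.powers f) (Localization.Away f)
  exact flat_quotient_of_forall_map_ne_zero hne

end AffineLine

/-- Six general lines are the limit of a flat family of integral ten-nodal sextics obtained by
projecting hyperplane sections of any given sextic del Pezzo surface. -/
theorem IsGeneralPosition.exists_flat_family {l : Fin 6 → Fin 3 → ℂ} (hl : IsGeneralPosition l) :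
    ∃ (T : PointedCurve) (P : MvPolynomial (Fin 3) T.A),
      T.IsIntegralTenNodalFamilyWithLimit P (∏ k, linForm (l k)) ∧
      ∀ S, IsSexticDelPezzo S → T.IsProjectionOfHyperplaneSections P S := by
  obtain ⟨π, P, hπ, hπ0, hP, hP0, hlim, himage, hbad⟩ := hl.exists_degeneration
  -- the base of the family is the affine line without the bad parameters other than `0`
  let f : Polynomial ℂ := ∏ b ∈ hbad.toFinset.erase 0, (Polynomial.X - Polynomial.C b)
  have hf : f.eval 0 ≠ 0 := by
    rw [Polynomial.eval_prod, Finset.prod_ne_zero_iff]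
    intro b hb
    simpa using Finset.ne_of_mem_erase hb
  have hgood : ∀ φ : (puncturedLine f hf).A →ₐ[ℂ] ℂ, puncturedLine.coord φ ≠ 0 →
      psiHyperplane (puncturedLine.coord φ) ≠ 0 ∧
      IsIntegralTenNodalSextic (specialize (puncturedLine.coord φ) P) ∧
        {w | w ≠ 0 ∧ eval w (specialize (puncturedLine.coord φ) P) = 0} =
          π '' {v | v ∈ hexCone ∧ ∑ i, psiHyperplane (puncturedLine.coord φ) i * v i = 0} := by
    intro φ h0
    by_contra hcon
    have hmem : puncturedLine.coord φ ∈ hbad.toFinset.erase 0 :=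
      Finset.mem_erase.mpr ⟨h0, hbad.mem_toFinset.mpr hcon⟩
    refine puncturedLine.eval_coord_ne_zero φ ?_
    rw [Polynomial.eval_prod]
    exact Finset.prod_eq_zero hmem (by simp)
  refine ⟨puncturedLine f hf, map (puncturedLine.res f hf) P,
    ⟨puncturedLine.isFlatFamilyOfSextics hP hP0, ?_, fun φ hφ => ?_⟩, fun S hS => ?_⟩
  · rw [puncturedLine.fiber_map, puncturedLine.coord_base, hlim]
  · rw [puncturedLine.fiber_map]
    refine (hgood φ fun h => hφ (puncturedLine.coord_injective ?_)).2.1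
    rw [h, puncturedLine.coord_base]
  obtain ⟨M, rfl⟩ := hS.exists_linearEquiv
  have hall : ∀ φ : (puncturedLine f hf).A →ₐ[ℂ] ℂ, psiHyperplane (puncturedLine.coord φ) ≠ 0 ∧
      {w | w ≠ 0 ∧ eval w (specialize (puncturedLine.coord φ) P) = 0} =
        π '' {v | v ∈ hexCone ∧ ∑ i, psiHyperplane (puncturedLine.coord φ) i * v i = 0} := by
    intro φ
    by_cases h0 : puncturedLine.coord φ = 0
    · rw [h0]
      refine ⟨fun h => ?_, himage⟩
      rw [psiHyperplane_zero] at h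
      simpa using congrFun h 6
    · exact ⟨(hgood φ h0).1, (hgood φ h0).2.2⟩
  -- The equation of the hyperplane is transported by the inverse of `M`.
  let h : Fin 7 → (puncturedLine f hf).A := fun i =>
    ∑ j, puncturedLine.res f hf (psiHyperplane Polynomial.X j) *
      algebraMap ℂ (puncturedLine f hf).A (M.symm (Pi.single i 1) j)
  have hh : ∀ (φ : (puncturedLine f hf).A →ₐ[ℂ] ℂ) i, φ (h i) =
      ∑ j, psiHyperplane (puncturedLine.coord φ) j * M.symm (Pi.single i 1) j := by
    intro φ i
    rw [map_sum]
    refine Finset.sum_congr rfl fun j _ => ?_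
    rw [map_mul, AlgHom.commutes, Algebra.algebraMap_self_apply]
    have h1 : φ (puncturedLine.res f hf (psiHyperplane Polynomial.X j)) =
        Polynomial.evalRingHom (puncturedLine.coord φ) (psiHyperplane Polynomial.X j) := by
      rw [← puncturedLine.comp_res]
      rfl
    rw [h1, map_psiHyperplane, Polynomial.coe_evalRingHom, Polynomial.eval_X]
  have hsum : ∀ (φ : (puncturedLine f hf).A →ₐ[ℂ] ℂ) (v : Fin 7 → ℂ), ∑ i, φ (h i) * (M v) i =
      ∑ j, psiHyperplane (puncturedLine.coord φ) j * v j := by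
    intro φ v
    have hv : v = ∑ i, (M v) i • M.symm (Pi.single i 1) := by
      conv_lhs => rw [← M.symm_apply_apply v, pi_eq_sum_univ' (M v), map_sum]
      refine Finset.sum_congr rfl fun i _ => ?_
      rw [map_smul]
    simp only [hh, Finset.sum_mul]
    rw [Finset.sum_comm]
    refine Finset.sum_congr rfl fun j _ => ?_
    conv_rhs => rw [hv]
    rw [Finset.sum_apply, Finset.mul_sum]
    refine Finset.sum_congr rfl fun i _ => ?_
    rw [Pi.smul_apply, smul_eq_mul]
    ring
  refine ⟨π ∘ₗ M.symm.toLinearMap, h, hπ.comp M.symm.surjective, ?_, fun φ => ⟨?_, ?_⟩⟩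
  · rintro _ ⟨v, hv, rfl⟩
    simpa using hπ0 v hv
  · by_contra! hcon
    refine (hall φ).1 (funext fun j => ?_)
    have := hsum φ (Pi.single j 1)
    simp only [hcon, zero_mul, Finset.sum_const_zero] at this
    rw [Finset.sum_eq_single j (fun i _ hi => by rw [Pi.single_eq_of_ne hi, mul_zero])
      (fun hj => absurd (Finset.mem_univ j) hj), Pi.single_eq_same, mul_one] at this
    exact this.symm
  · rw [puncturedLine.fiber_map, (hall φ).2]
    ext w
    simp only [Set.mem_image, Set.mem_ofPred_eq, LinearMap.comp_apply, LinearEquiv.coe_coe]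
    constructor
    · rintro ⟨v, ⟨hv, hs⟩, rfl⟩
      exact ⟨M v, ⟨⟨v, hv, rfl⟩, by rw [hsum, hs]⟩, by rw [M.symm_apply_apply]⟩
    · rintro ⟨_, ⟨⟨v, hv, rfl⟩, hs⟩, rfl⟩
      exact ⟨v, ⟨hv, by rw [← hsum, hs]⟩, by rw [M.symm_apply_apply]⟩

/-! ### The Zariski topology and polynomial curves -/

theorem isTopologicalBasis_zariski (V : Type*) [AddCommGroup V] [Module ℂ V] :
    @TopologicalSpace.IsTopologicalBasis V (zariskiTopology V)
      {U | ∃ Φ : MvPolynomial (Module.Dual ℂ V) ℂ, U = {v | eval (fun φ => φ v) Φ ≠ 0}} := by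
  let _ := zariskiTopology V
  refine ⟨?_, ?_, rfl⟩
  · rintro _ ⟨Φ, rfl⟩ _ ⟨Ψ, rfl⟩ v ⟨h1, h2⟩
    refine ⟨_, ⟨Φ * Ψ, rfl⟩, ?_, ?_⟩
    · rw [Set.mem_ofPred_eq, map_mul]
      exact mul_ne_zero h1 h2
    · intro w hw
      rw [Set.mem_ofPred_eq, map_mul] at hw
      exact ⟨left_ne_zero_of_mul hw, right_ne_zero_of_mul hw⟩
  · refine Set.eq_univ_of_forall fun v => Set.mem_sUnion.mpr ⟨_, ⟨1, rfl⟩, ?_⟩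
    rw [Set.mem_ofPred_eq, map_one]
    exact one_ne_zero

/-- A polynomial curve that meets a Zariski open set lies in it for all but finitely many values of
the parameter. -/
theorem finite_notMem_of_isOpen_zariski {V : Type*} [AddCommGroup V] [Module ℂ V] {γ : ℂ → V}
    (hγ : ∀ φ : Module.Dual ℂ V, ∃ p : Polynomial ℂ, ∀ t, φ (γ t) = p.eval t) {U : Set V}
    (hU : IsOpen[zariskiTopology V] U) {t₀ : ℂ} (ht₀ : γ t₀ ∈ U) : {t | γ t ∉ U}.Finite := by
  obtain ⟨_, ⟨Φ, rfl⟩, h0, hsub⟩ :=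
    @TopologicalSpace.IsTopologicalBasis.exists_subset_of_mem_open V (zariskiTopology V) _
      (isTopologicalBasis_zariski V) _ _ ht₀ hU
  choose p hp using hγ
  have heval : ∀ t, eval (fun φ => φ (γ t)) Φ = (aeval p Φ).eval t := by
    intro t
    clear h0 hsub
    induction Φ using MvPolynomial.induction_on with
    | C a => simp
    | add a b ha hb => simp only [map_add, Polynomial.eval_add]; rw [ha, hb]
    | mul_X a φ ha => simp only [map_mul, Polynomial.eval_mul, eval_X, aeval_X]; rw [ha, hp]
  have hne : aeval p Φ ≠ 0 := by
    intro h
    rw [Set.mem_ofPred_eq, heval, h, Polynomial.eval_zero] at h0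
    exact h0 rfl
  refine (Polynomial.finite_setOfPred_isRoot hne).subset fun t ht => ?_
  by_contra hr
  refine ht (hsub ?_)
  rw [Set.mem_ofPred_eq, heval]
  exact hr

section Grassmannian

variable {V : Type*} [AddCommGroup V] [Module ℂ V]

theorem Gr3.nonempty_basis (N : Gr3 V) : Nonempty (Module.Basis (Fin 3) ℂ N.1) := by
  have hN : Module.finrank ℂ N.1 = 3 := N.2
  have : Module.Finite ℂ N.1 := Module.finite_of_finrank_eq_succ hN
  exact ⟨Module.finBasisOfFinrankEq ℂ N.1 hN⟩

theorem Gr3.linearIndependent_basis {N : Gr3 V} (B : Module.Basis (Fin 3) ℂ N.1) :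
    LinearIndependent ℂ fun k => (B k : V) :=
  B.linearIndependent.map' N.1.subtype (Submodule.ker_subtype _)

theorem Gr3.span_basis {N : Gr3 V} (B : Module.Basis (Fin 3) ℂ N.1) :
    Submodule.span ℂ (Set.range fun k => (B k : V)) = N.1 := by
  have h := congrArg (Submodule.map N.1.subtype) B.span_eq
  rwa [Submodule.map_span, ← Set.range_comp, Submodule.map_top, Submodule.range_subtype] at h

/-- The planes spanned by the triples in a nonempty open set of frames are dense: a line through
two frames, one over a given nonempty open set and one in the given set of frames, has all but
finitely many of its points in both. -/
theorem Gr3.dense_of_isOpen_frames {G : Set (Fin 3 → V)} (hG : IsOpen[zariskiTopology _] G)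
    (hne : G.Nonempty) (hli : ∀ Q ∈ G, LinearIndependent ℂ Q) {U : Set (Gr3 V)}
    (hU : ∀ Q : {Q : Fin 3 → V // LinearIndependent ℂ Q}, Q.1 ∈ G → Gr3.ofFrame Q ∈ U) :
    Dense U := by
  rw [dense_iff_inter_open]
  rintro O hO ⟨N, hN⟩
  obtain ⟨O', hO', hpre⟩ := (@isOpen_induced_iff _ _ (zariskiTopology _) _ _).mp
    (isOpen_coinduced.mp hO)
  have hmem : ∀ (Q : Fin 3 → V) (h : LinearIndependent ℂ Q),
      Q ∈ O' ↔ Gr3.ofFrame ⟨Q, h⟩ ∈ O := fun Q h =>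
    Set.ext_iff.mp hpre ⟨Q, h⟩
  obtain ⟨B⟩ := N.nonempty_basis
  obtain ⟨R, hR, hRN⟩ : ∃ (R : Fin 3 → V) (h : LinearIndependent ℂ R), Gr3.ofFrame ⟨R, h⟩ = N :=
    ⟨_, Gr3.linearIndependent_basis B, Subtype.ext (Gr3.span_basis B)⟩
  obtain ⟨Q, hQ⟩ := hne
  let γ : ℂ → Fin 3 → V := fun t => R + t • (Q - R)
  have hγ : ∀ φ : Module.Dual ℂ (Fin 3 → V), ∃ p : Polynomial ℂ, ∀ t, φ (γ t) = p.eval t :=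
    fun φ => ⟨Polynomial.C (φ R) + Polynomial.X * Polynomial.C (φ (Q - R)), fun t => by
      simp only [γ, map_add, map_smul, smul_eq_mul, Polynomial.eval_add, Polynomial.eval_C,
        Polynomial.eval_mul, Polynomial.eval_X]⟩
  have h0 : γ 0 ∈ O' := by
    have : γ 0 = R := by simp [γ]
    rw [this, hmem R hR, hRN]
    exact hN
  have h1 : γ 1 ∈ G := by
    have : γ 1 = Q := by simp [γ]
    rwa [this]
  obtain ⟨t, ht⟩ := ((finite_notMem_of_isOpen_zariski hγ hO' h0).union
    (finite_notMem_of_isOpen_zariski hγ hG h1)).infinite_compl.nonempty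
  simp only [Set.mem_compl_iff, Set.mem_union, Set.mem_ofPred_eq, not_or, not_not] at ht
  exact ⟨Gr3.ofFrame ⟨γ t, hli _ ht.2⟩, (hmem _ _).mp ht.1, hU _ ht.2⟩

end Grassmannian

theorem exists_eval_eq_dual_specialize {σ : Type*} (P : MvPolynomial σ (Polynomial ℂ))
    (φ : Module.Dual ℂ (MvPolynomial σ ℂ)) :
    ∃ p : Polynomial ℂ, ∀ t, φ (specialize t P) = p.eval t := by
  induction P using MvPolynomial.induction_on' with
  | monomial m a =>
    refine ⟨a * Polynomial.C (φ (monomial m 1)), fun t => ?_⟩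
    rw [specialize, map_monomial, Polynomial.eval_mul, Polynomial.eval_C,
      Polynomial.coe_evalRingHom, ← smul_eq_mul, ← map_smul, smul_monomial, smul_eq_mul, mul_one]
  | add P Q hP hQ =>
    obtain ⟨p, hp⟩ := hP
    obtain ⟨q, hq⟩ := hQ
    refine ⟨p + q, fun t => ?_⟩
    rw [Polynomial.eval_add, ← hp, ← hq, ← map_add]
    simp only [specialize, map_add]

theorem IsGeneralPosition.prod_mem_severiVarietyIrr {l : Fin 6 → Fin 3 → ℂ}
    (hl : IsGeneralPosition l) : ∏ k, linForm (l k) ∈ severiVarietyIrr := by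
  obtain ⟨π, P, -, -, -, hP0, hlim, -, hbad⟩ := hl.exists_degeneration
  refine ⟨isHomogeneous_prod_linForm l, hlim ▸ hP0 0, ?_⟩
  rw [@mem_closure_iff _ (zariskiTopology _)]
  intro U hU hmem
  rw [← hlim] at hmem
  have hfin := finite_notMem_of_isOpen_zariski (exists_eval_eq_dual_specialize P) hU hmem
  obtain ⟨t, ht⟩ := (hfin.union hbad).infinite_compl.nonempty
  simp only [Set.mem_compl_iff, Set.mem_union, Set.mem_ofPred_eq, not_or, not_not] at ht
  exact ⟨_, ht.1, ht.2.2.1⟩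

/-! ### Nets of polar quadrics of the Fermat cubic -/

theorem pderiv_fermatCubic (i : Fin 6) : pderiv i fermatCubic = C 3 * X i ^ 2 := by
  have : (C 3 : MvPolynomial (Fin 6) ℂ) = 3 := map_ofNat C 3
  rw [this]
  simp [fermatCubic, map_sum, Derivation.leibniz_pow, pderiv_X, Pi.single_apply]

theorem coeff_sum_C_mul_X_sq (a : Fin 6 → ℂ) (j : Fin 6) :
    coeff (Finsupp.single j 2) (∑ i, C (a i) * X i ^ 2 : MvPolynomial (Fin 6) ℂ) = a j := by
  classical
  rw [coeff_sum, Finset.sum_eq_single j]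
  · rw [coeff_C_mul, coeff_X_pow, if_pos rfl, mul_one]
  · intro i _ hi
    rw [coeff_C_mul, coeff_X_pow, if_neg, mul_zero]
    exact fun h => hi (Finsupp.single_left_injective two_ne_zero h)
  · simp

theorem mem_polarSpace_fermatCubic {q : MvPolynomial (Fin 6) ℂ} :
    q ∈ polarSpace fermatCubic ↔ ∃ a : Fin 6 → ℂ, q = ∑ i, C (a i) * X i ^ 2 := by
  rw [polarSpace, Submodule.mem_span_range_iff_exists_fun]
  constructor
  · rintro ⟨c, rfl⟩
    refine ⟨fun i => c i * 3, Finset.sum_congr rfl fun i _ => ?_⟩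
    rw [pderiv_fermatCubic, smul_eq_C_mul, C_mul, mul_assoc]
  · rintro ⟨a, rfl⟩
    refine ⟨fun i => a i / 3, Finset.sum_congr rfl fun i _ => ?_⟩
    rw [pderiv_fermatCubic, smul_eq_C_mul, ← mul_assoc, ← C_mul,
      div_mul_cancel₀ _ (three_ne_zero (α := ℂ))]

theorem eq_sum_of_mem_polarSpace {q : MvPolynomial (Fin 6) ℂ} (hq : q ∈ polarSpace fermatCubic) :
    q = ∑ i, C (coeff (Finsupp.single i 2) q) * X i ^ 2 := by
  obtain ⟨a, rfl⟩ := mem_polarSpace_fermatCubic.mp hq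
  simp only [coeff_sum_C_mul_X_sq]

theorem finrank_polarSpace_fermatCubic : Module.finrank ℂ (polarSpace fermatCubic) = 6 := by
  rw [polarSpace, finrank_span_eq_card, Fintype.card_fin]
  rw [Fintype.linearIndependent_iff]
  intro g hg j
  have h := congrArg (coeff (Finsupp.single j 2)) hg
  have h2 : ∑ i, g i • pderiv i fermatCubic =
      ∑ i, C (g i * 3) * X i ^ 2 := Finset.sum_congr rfl fun i _ => by
    rw [pderiv_fermatCubic, smul_eq_C_mul, C_mul, mul_assoc]
  rw [h2, coeff_sum_C_mul_X_sq, coeff_zero] at h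
  exact (mul_eq_zero.mp h).resolve_right three_ne_zero

theorem coeffMatrix_sum_C_mul_X_sq (a : Fin 6 → ℂ) :
    coeffMatrix (∑ i, C (a i) * X i ^ 2) = Matrix.diagonal a := by
  have h1 : ∀ j, pderiv j (∑ i, C (a i) * X i ^ 2 : MvPolynomial (Fin 6) ℂ) =
      C (2 * a j) * X j := fun j => by
    rw [map_sum, Finset.sum_eq_single j]
    · rw [Derivation.leibniz, Derivation.leibniz_pow, pderiv_X_self, pderiv_C, C_mul]
      have : (C 2 : MvPolynomial (Fin 6) ℂ) = 2 := map_ofNat C 2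
      rw [this]
      simp
      ring
    · intro i _ hi
      rw [Derivation.leibniz, Derivation.leibniz_pow, pderiv_X_of_ne hi, pderiv_C]
      simp
    · simp
  ext i j
  rw [coeffMatrix, Matrix.of_apply, h1, Derivation.leibniz, pderiv_C, smul_zero, add_zero,
    pderiv_X, Matrix.diagonal_apply]
  by_cases hij : i = j
  · subst hij
    simp
  · rw [if_neg hij, Pi.single_eq_of_ne (Ne.symm hij)]
    simp

/-- The coefficients of the `i`-th line of the discriminant of a net of diagonal quadrics with basis
`Q`: the line consists of the members of the net without a term in the square of the `i`-th
variable. -/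
def netLine (Q : Fin 3 → polarSpace fermatCubic) (i : Fin 6) (k : Fin 3) : ℂ :=
  coeff (Finsupp.single i 2) (Q k : MvPolynomial (Fin 6) ℂ)

theorem discriminantForm_eq_prod (Q : Fin 3 → polarSpace fermatCubic) :
    discriminantForm (fun k => (Q k : MvPolynomial (Fin 6) ℂ)) =
      ∏ i, linForm (netLine Q i) := by
  have h : (∑ k, (X k : MvPolynomial (Fin 3) ℂ) •
      (coeffMatrix (Q k : MvPolynomial (Fin 6) ℂ)).map C) =
      Matrix.diagonal fun i => linForm (netLine Q i) := by
    ext1 i j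
    rw [Matrix.sum_apply, Matrix.diagonal_apply]
    have hk : ∀ k, coeffMatrix (Q k : MvPolynomial (Fin 6) ℂ) =
        Matrix.diagonal fun i => netLine Q i k := fun k => by
      rw [eq_sum_of_mem_polarSpace (Q k).2, coeffMatrix_sum_C_mul_X_sq]
      rfl
    simp only [hk, Matrix.smul_apply, Matrix.map_apply, Matrix.diagonal_apply, smul_eq_mul]
    split_ifs with hij
    · rw [linForm]
      exact Finset.sum_congr rfl fun k _ => mul_comm _ _
    · simp
  rw [discriminantForm, h, Matrix.det_diagonal]

/-- The nets of polar quadrics of the Fermat cubic that contain no nonzero quadric of rank at most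
three. The condition is stated without reference to a basis of the net. -/
def generalNets : Set (Gr3 (polarSpace fermatCubic)) :=
  {N | ∀ s : Fin 3 ↪ Fin 6, ∀ q ∈ N.1,
    (∀ j, coeff (Finsupp.single (s j) 2) (q : MvPolynomial (Fin 6) ℂ) = 0) → q = 0}

theorem coeff_sum_smul (Q : Fin 3 → polarSpace fermatCubic) (c : Fin 3 → ℂ) (i : Fin 6) :
    coeff (Finsupp.single i 2) ((∑ k, c k • Q k : polarSpace fermatCubic) :
      MvPolynomial (Fin 6) ℂ) = netLine Q i ⬝ᵥ c := by
  simp only [Submodule.coe_sum, Submodule.coe_smul, coeff_sum, coeff_smul, smul_eq_mul,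
    dotProduct, netLine]
  exact Finset.sum_congr rfl fun k _ => mul_comm _ _

theorem linearIndependent_iff_forall_dot {v : Fin 3 → Fin 3 → ℂ} :
    LinearIndependent ℂ v ↔ ∀ c : Fin 3 → ℂ, (∀ j, v j ⬝ᵥ c = 0) → c = 0 := by
  have h : LinearIndependent ℂ v ↔ IsUnit (Matrix.of v) :=
    Matrix.linearIndependent_rows_iff_isUnit (A := Matrix.of v)
  rw [h, ← Matrix.mulVec_injective_iff_isUnit]
  have : Function.Injective (Matrix.of v).mulVec ↔
      Function.Injective (Matrix.of v).mulVecLin := Iff.rfl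
  rw [this, injective_iff_map_eq_zero]
  refine forall_congr' fun c => imp_congr_left ⟨fun h j => congrFun h j, fun h => funext h⟩

theorem IsGeneralPosition.linearIndependent_of_netLine {Q : Fin 3 → polarSpace fermatCubic}
    (h : IsGeneralPosition (netLine Q)) : LinearIndependent ℂ Q := by
  rw [Fintype.linearIndependent_iff]
  intro c hc k
  refine congrFun (linearIndependent_iff_forall_dot.mp (h (Fin.castLEEmb (by decide))) c
    fun j => ?_) k
  rw [← coeff_sum_smul, hc]
  simp

/-- In terms of a basis, a net is general if no three of its six lines are concurrent. -/
theorem mem_generalNets_iff {N : Gr3 (polarSpace fermatCubic)}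
    {Q : Fin 3 → polarSpace fermatCubic} (hQ : LinearIndependent ℂ Q)
    (hN : N.1 = Submodule.span ℂ (Set.range Q)) :
    N ∈ generalNets ↔ IsGeneralPosition (netLine Q) := by
  refine forall_congr' fun s => ?_
  rw [linearIndependent_iff_forall_dot, hN]
  constructor
  · intro h c hc
    have h0 := h (∑ k, c k • Q k)
      (Submodule.sum_mem _ fun k _ => Submodule.smul_mem _ _ (Submodule.subset_span ⟨k, rfl⟩))
      fun j => by rw [coeff_sum_smul, hc]
    exact funext (Fintype.linearIndependent_iff.mp hQ c h0)
  · intro h q hq hs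
    obtain ⟨c, rfl⟩ := (Submodule.mem_span_range_iff_exists_fun ℂ).mp hq
    have hc := h c fun j => by rw [← coeff_sum_smul, hs]
    simp [hc]

theorem isOpen_isGeneralPosition_netLine :
    IsOpen[zariskiTopology (Fin 3 → polarSpace fermatCubic)]
      {Q | IsGeneralPosition (netLine Q)} := by
  let co (i : Fin 6) (k : Fin 3) : Module.Dual ℂ (Fin 3 → polarSpace fermatCubic) :=
    (lcoeff ℂ (Finsupp.single i 2)) ∘ₗ (polarSpace fermatCubic).subtype ∘ₗ LinearMap.proj k
  let Φ : MvPolynomial (Module.Dual ℂ (Fin 3 → polarSpace fermatCubic)) ℂ :=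
    ∏ s : Fin 3 ↪ Fin 6, (Matrix.of fun j k => X (co (s j) k) : Matrix (Fin 3) (Fin 3) _).det
  have h : {Q | IsGeneralPosition (netLine Q)} = {Q | eval (fun φ => φ Q) Φ ≠ 0} := by
    ext Q
    simp only [Set.mem_ofPred_eq, Φ, map_prod, Finset.prod_ne_zero_iff, Finset.mem_univ,
      true_imp_iff]
    refine forall_congr' fun s => ?_
    have h1 : LinearIndependent ℂ (fun j => netLine Q (s j)) ↔
        IsUnit (Matrix.of fun j => netLine Q (s j)) :=
      Matrix.linearIndependent_rows_iff_isUnit (A := Matrix.of fun j => netLine Q (s j))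
    rw [h1, Matrix.isUnit_iff_isUnit_det, isUnit_iff_ne_zero, RingHom.map_det]
    have h2 : (eval fun φ => φ Q).mapMatrix (Matrix.of fun j k => X (co (s j) k)) =
        Matrix.of fun j => netLine Q (s j) := by
      ext j k
      simp [co, netLine]
    rw [h2]
  rw [h]
  exact TopologicalSpace.GenerateOpen.basic _ ⟨Φ, rfl⟩

theorem exists_netLine_eq (l : Fin 6 → Fin 3 → ℂ) :
    ∃ Q : Fin 3 → polarSpace fermatCubic, netLine Q = l := by
  have hmem : ∀ k, ∑ i, C (l i k) * X i ^ 2 ∈ polarSpace fermatCubic := fun k =>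
    mem_polarSpace_fermatCubic.mpr ⟨fun i => l i k, rfl⟩
  refine ⟨fun k => ⟨_, hmem k⟩, ?_⟩
  funext i k
  rw [netLine]
  exact coeff_sum_C_mul_X_sq (fun i => l i k) i

/-- The net spanned by `∑ i ^ k X_i ^ 2` for `k = 0, 1, 2` is general, since its lines are the rows
of a Vandermonde matrix. -/
theorem exists_isGeneralPosition_netLine :
    ∃ Q : Fin 3 → polarSpace fermatCubic, IsGeneralPosition (netLine Q) := by
  obtain ⟨Q, hQ⟩ := exists_netLine_eq fun i k => ((i : ℕ) : ℂ) ^ (k : ℕ)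
  refine ⟨Q, fun s => ?_⟩
  have hQs : (fun j => netLine Q (s j)) =
      Matrix.vandermonde fun j => (((s j : Fin 6) : ℕ) : ℂ) := by
    rw [hQ]
    rfl
  rw [hQs]
  refine Matrix.linearIndependent_rows_of_det_ne_zero (A := Matrix.vandermonde _) ?_
  rw [Matrix.det_vandermonde_ne_zero_iff]
  intro a b hab
  exact s.injective (Fin.val_injective (Nat.cast_injective hab))

theorem isOpen_generalNets : IsOpen generalNets := by
  refine isOpen_coinduced.mpr ?_
  have h : Gr3.ofFrame ⁻¹' generalNets = Subtype.val ⁻¹'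
      {Q : Fin 3 → polarSpace fermatCubic | IsGeneralPosition (netLine Q)} := by
    ext Q
    exact mem_generalNets_iff Q.2 rfl
  rw [h]
  exact @isOpen_induced _ _ (zariskiTopology _) _ _ isOpen_isGeneralPosition_netLine

theorem nonempty_generalNets : generalNets.Nonempty := by
  obtain ⟨Q, hQ⟩ := exists_isGeneralPosition_netLine
  exact ⟨Gr3.ofFrame ⟨Q, hQ.linearIndependent_of_netLine⟩,
    (mem_generalNets_iff hQ.linearIndependent_of_netLine rfl).mpr hQ⟩

theorem dense_generalNets : Dense generalNets :=
  Gr3.dense_of_isOpen_frames isOpen_isGeneralPosition_netLine exists_isGeneralPosition_netLine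
    (fun _ h => h.linearIndependent_of_netLine)
    fun Q h => (mem_generalNets_iff Q.2 rfl).mpr h

theorem planeSectionForm_eq_prod {N : Gr3 (polarSpace fermatCubic)} (hN : N ∈ generalNets)
    (Q : Module.Basis (Fin 3) ℂ N.1) : ∃ l : Fin 6 → Fin 3 → ℂ, IsGeneralPosition l ∧
      planeSectionForm Q = ∏ i, linForm (l i) := by
  exact ⟨netLine fun k => (Q k : polarSpace fermatCubic),
    (mem_generalNets_iff (Gr3.linearIndependent_basis Q) (Gr3.span_basis Q).symm).mp hN,
    discriminantForm_eq_prod _⟩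

theorem fermatCubic_mem_severiLocus : fermatCubic ∈ severiLocus := by
  obtain ⟨N, hN⟩ := nonempty_generalNets
  obtain ⟨Q⟩ := N.nonempty_basis
  obtain ⟨l, hl, hD⟩ := planeSectionForm_eq_prod hN Q
  exact ⟨isSmoothCubic_fermatCubic.1, finrank_polarSpace_fermatCubic, N, Q,
    hD ▸ hl.prod_mem_severiVarietyIrr⟩

end SeveriFermat

end

theorem mainTheorem5 :
    (∃ U : Set (SeveriFermat.Gr3 (SeveriFermat.polarSpace SeveriFermat.fermatCubic)),
      IsOpen U ∧ Dense U ∧ U.Nonempty ∧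
      ∀ N ∈ U, ∀ Q : Module.Basis (Fin 3) ℂ N.1,
        SeveriFermat.IsUnionOfSixGeneralLines (SeveriFermat.planeSectionForm Q) ∧
        (∃ (T : SeveriFermat.PointedCurve) (P : MvPolynomial (Fin 3) T.A),
          T.IsIntegralTenNodalFamilyWithLimit P (SeveriFermat.planeSectionForm Q)) ∧
        (∀ S : Set (Fin 7 → ℂ), SeveriFermat.IsSexticDelPezzo S →
          ∃ (T : SeveriFermat.PointedCurve) (P : MvPolynomial (Fin 3) T.A),
            T.IsIntegralTenNodalFamilyWithLimit P (SeveriFermat.planeSectionForm Q) ∧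
            T.IsProjectionOfHyperplaneSections P S) ∧
        SeveriFermat.planeSectionForm Q ∈ SeveriFermat.severiVarietyIrr) ∧
    SeveriFermat.fermatCubic ∈ SeveriFermat.severiLocus ∧
    SeveriFermat.CubicModuli.mk
        ⟨SeveriFermat.fermatCubic, SeveriFermat.isSmoothCubic_fermatCubic⟩ ∈
      SeveriFermat.severiDivisor := by
  refine ⟨⟨SeveriFermat.generalNets, SeveriFermat.isOpen_generalNets,
    SeveriFermat.dense_generalNets, SeveriFermat.nonempty_generalNets, fun N hN Q => ?_⟩,
    SeveriFermat.fermatCubic_mem_severiLocus,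
    subset_closure ⟨_, SeveriFermat.fermatCubic_mem_severiLocus, rfl⟩⟩
  obtain ⟨l, hl, hD⟩ := SeveriFermat.planeSectionForm_eq_prod hN Q
  rw [hD]
  obtain ⟨T, P, hT, hS⟩ := hl.exists_flat_family
  exact ⟨⟨l, rfl, hl⟩, ⟨T, P, hT⟩, fun S h => ⟨T, P, hT, hS S h⟩, hl.prod_mem_severiVarietyIrr⟩
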